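/- Let $S$ be a smooth compact oriented surface without boundary, immersed in $\mathbb{E}^3$, with unit normal field $n$ and shape operator, and let $K$ be the maximum over $S$ of the operator norm of the shape operator. A \emph{discrete net of curvature lines} on $S$ is a cell decomposition of $S$ whose attaching maps are homeomorphisms onto their images, in which any two closed cells are disjoint or meet in a single closed cell, whose edges are smoothly embedded segments of curvature lines (at umbilical points every tangent direction counts as principal), and in which non-umbilical vertices have valence four and umbilical vertices have valence greater than two. Let $p$ be a vertex of such a net. For a (curved) edge $e$ emanating from $p$ let $\mathbf e\in\mathbb{E}^3$ be the straight vector from $p$ to the other endpoint of $e$. Any two distinct edges at $p$ that lie in a common 2-cell, i.e. that are consecutive in the cyclic order of the edges around $p$, span a flat triangle of the triangulated vertex star of $p$. Thus every edge vector $\mathbf e$ at $p$ is common to exactly two triangles, spanned by $(\mathbf e,\mathbf f)$ and $(\mathbf e,\mathbf g)$. Its circumcentric area is $A_{\mathbf e}=\tfrac12\,\mathrm{sgn}(\star\mathbf e)\,\|\mathbf e\|\,\|{\star\mathbf e}\|$, where, after unfolding the two triangles into a plane, on opposite sides of $\mathbf e$, $\star\mathbf e$ joins their circumcenters $C_1,C_2$,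 and $\mathrm{sgn}(\star\mathbf e)$ is positive if along the ray from $C_1$ through $C_2$ the first triangle lies before the second one, and negative otherwise (if $C_1=C_2$ the area is $0$). Let $\epsilon$ be the maximum of the lengths of the curved edges emanating from $p$, and let $\rho\ge 1$ be the smallest number such that $\epsilon/\rho\le\|\mathbf e\|$ and $\|\mathbf e\|\,\|\mathbf f\|\le\rho\,\|\mathbf e\times\mathbf f\|$ for all pairs $(\mathbf e,\mathbf f)$ that span a triangle of the vertex star (it is assumed to exist). Assume the sampling condition $\epsilon\le \frac{1}{16K\rho^2}$. If $p$ has valence four, assume moreover that, for every edge at $p$, the two triangles meeting at $\mathbf e$ lie on opposite sides of $\mathbf e$ when viewed along the normal at $p$: one of the numbers $n(p)\cdot(\mathbf e\times\mathbf f)$ and $n(p)\cdot(\mathbf e\times\mathbf g)$ is positive and the other one is negative. If $p$ is non-umbilical, an edge vector $\mathbf e$ at $p$ is associated with the principal direction that is tangent to the curved edge $e$ at $p$. Call $\mathbf e$ \emph{area maximizing} if $A_{\mathbf e}$ is maximal among all edges emanating from $p$ (when $p$ is umbilical), respectively among the edges at $p$ associated with the same principal direction as $\mathbf e$ (when $p$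 is non-umbilical). Then: (1) There is a constant $C>0$ depending only on $\rho$ such that every area maximizing edge vector $\mathbf e$ at $p$ satisfies $\frac1C\,\epsilon^2\le A_{\mathbf e}\le C\,\epsilon^2$. (2) If $p$ is non-umbilical, then for each principal direction at $p$ there is an edge at $p$ associated with it whose circumcentric area is positive. (3) If $p$ has valence four, then at least three of the four edges at $p$ are $\delta$-Delaunay with $\delta=\frac1{2\rho^2}$; that is, the angles $\alpha_{\mathbf e},\beta_{\mathbf e}$ opposite to $\mathbf e$ in the two triangles meeting at $\mathbf e$ satisfy $\alpha_{\mathbf e}\ge\delta$, $\beta_{\mathbf e}\ge\delta$ and $\alpha_{\mathbf e}+\beta_{\mathbf e}\le\pi-\delta$. -/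

import Mathlib

open Set Topology MeasureTheory
open scoped ContDiff Manifold RealInnerProductSpace

universe u

/-- The Euclidean plane. -/
abbrev Plane := EuclideanSpace ℝ (Fin 2)

/-- Euclidean three-space. -/
abbrev Space := EuclideanSpace ℝ (Fin 3)

/-- The cross product on Euclidean three-space. -/
noncomputable def cross (a b : Space) : Space :=
  WithLp.toLp 2 (crossProduct (WithLp.ofLp a) (WithLp.ofLp b))

/-! ### Oriented immersed surfaces -/

/-- A smooth oriented immersion of a surface `M` into Euclidean three-space. The orientation is
given by the (smooth) unit normal field. -/
structure ImmersedSurface (M : Type u) [TopologicalSpace M] [ChartedSpace Plane M] where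
  /-- the immersion -/
  pos : M → Space
  contMDiff_pos : ContMDiff (𝓡 2) 𝓘(ℝ, Space) ∞ pos
  immersion : ∀ x, Function.Injective (mfderiv (𝓡 2) 𝓘(ℝ, Space) pos x)
  /-- the unit normal field -/
  normal : M → Space
  contMDiff_normal : ContMDiff (𝓡 2) 𝓘(ℝ, Space) ∞ normal
  norm_normal : ∀ x, ‖normal x‖ = 1
  inner_normal : ∀ (x : M) (v : TangentSpace (𝓡 2) x),
    ⟪normal x, (mfderiv (𝓡 2) 𝓘(ℝ, Space) pos x v : Space)⟫ = 0

namespace ImmersedSurface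

variable {M : Type u} [TopologicalSpace M] [ChartedSpace Plane M] (S : ImmersedSurface M)

/-- The differential of the immersion. -/
noncomputable def dpos (x : M) : TangentSpace (𝓡 2) x →L[ℝ] Space :=
  mfderiv (𝓡 2) 𝓘(ℝ, Space) S.pos x

/-- The differential of the unit normal (Gauss map). -/
noncomputable def dnormal (x : M) : TangentSpace (𝓡 2) x →L[ℝ] Space :=
  mfderiv (𝓡 2) 𝓘(ℝ, Space) S.normal x

/-- `S.IsShape x v w` says that `w` is the image of the tangent vector `v` under the shape
(Weingarten) operator at `x`, which is determined by `dpos (Shape v) = - dnormal v`. -/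
def IsShape (x : M) (v w : TangentSpace (𝓡 2) x) : Prop :=
  S.dpos x w = - S.dnormal x v

/-- The point `x` is umbilical: the shape operator is a multiple of the identity. -/
def IsUmbilic (x : M) : Prop :=
  ∃ k : ℝ, ∀ v : TangentSpace (𝓡 2) x, S.IsShape x v (k • v)

/-- The vector `w` of three-space spans a principal direction at `x`: it is the image of a nonzero
tangent vector which is an eigenvector of the shape operator. -/
def IsPrincipal (x : M) (w : Space) : Prop :=
  w ≠ 0 ∧ ∃ (v : TangentSpace (𝓡 2) x) (k : ℝ), S.dpos x v = w ∧ S.IsShape x v (k • v)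

/-- `K` is the maximum over all points of the operator norm of the shape operator, with respect
to the metric induced by the immersion. -/
def IsCurvatureBound (K : ℝ) : Prop :=
  IsGreatest {k : ℝ | ∃ (x : M) (v w : TangentSpace (𝓡 2) x),
    ‖S.dpos x v‖ = 1 ∧ S.IsShape x v w ∧ k = ‖S.dpos x w‖} K

end ImmersedSurface

/-! ### Circumcentric areas -/

/-- The circumcenter of the triangle `A B C` in the plane (and the origin if the three points are
collinear). -/
noncomputable def planeCircumcenter (A B C : Plane) : Plane :=
  open scoped Classical in
  if h : AffineIndependent ℝ ![A, B, C] then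
    (⟨![A, B, C], h⟩ : Affine.Simplex ℝ Plane 2).circumcenter
  else 0

/-- The apex of the triangle with edge vectors `e`, `f`, after the triangle is moved isometrically
to the plane, with `e` placed along the positive first axis with its foot point at the origin, on
the side of that axis given by the sign `s`. -/
noncomputable def unfoldApex (s : ℝ) (e f : Space) : Plane :=
  !₂[⟪e, f⟫ / ‖e‖, s * ‖cross e f‖ / ‖e‖]

/-- The circumcenter of the triangle with edge vectors `e`, `f`, unfolded to the side `s`. -/
noncomputable def unfoldCircumcenter (s : ℝ) (e f : Space) : Plane :=
  planeCircumcenter !₂[0, 0] !₂[‖e‖, 0] (unfoldApex s e f)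

/-- The circumcentric area `(1/2) sgn(⋆e) ‖e‖ ‖⋆e‖` of the common edge `e` of the triangles
spanned by `e, f` and by `e, g`. These are unfolded to the upper and to the lower half plane,
respectively, and the dual edge `⋆e` joins their circumcenters, which have the same first
coordinate. Along the ray from the first to the second circumcenter the first triangle
lies before the second one exactly if that ray points downwards. -/
noncomputable def circumcentricArea (e f g : Space) : ℝ :=
  1 / 2 * SignType.sign (unfoldCircumcenter 1 e f 1 - unfoldCircumcenter (-1) e g 1)
    * ‖e‖ * dist (unfoldCircumcenter 1 e f) (unfoldCircumcenter (-1) e g)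

/-- The angle opposite to the edge `e` in the triangle spanned by `e` and `f`. -/
noncomputable def oppositeAngle (e f : Space) : ℝ :=
  InnerProductGeometry.angle (-f) (e - f)

/-- The common edge `e` of the triangles spanned by `e, f` and by `e, g` is `δ`-Delaunay. -/
def IsDelaunay (δ : ℝ) (e f g : Space) : Prop :=
  δ ≤ oppositeAngle e f ∧ δ ≤ oppositeAngle e g ∧
    oppositeAngle e f + oppositeAngle e g ≤ Real.pi - δ

/-! ### Discrete nets of curvature lines -/

/-- A discrete net on a surface `M` with a cell (CW) structure, with respect to a smooth immersion
`S`: the structure is a decomposition of `M` into cells of dimension at most two, with attaching maps that are homeomorphisms onto their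
images, such that two closed cells are disjoint or meet in a single closed cell, and with smoothly
embedded edges. -/
structure DiscreteNet {M : Type u} [TopologicalSpace M] [ChartedSpace Plane M]
    [Topology.CWComplex (univ : Set M)] (S : ImmersedSurface M) where
  dim_le : ∀ n, 2 < n → IsEmpty (Topology.RelCWComplex.cell (univ : Set M) n)
  injOn : ∀ n (i : Topology.RelCWComplex.cell (univ : Set M) n),
    InjOn (Topology.RelCWComplex.map n i) (Metric.closedBall 0 1)
  inter : ∀ n (i : Topology.RelCWComplex.cell (univ : Set M) n)
    m (j : Topology.RelCWComplex.cell (univ : Set M) m),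
    Topology.RelCWComplex.closedCell n i ∩ Topology.RelCWComplex.closedCell m j = ∅ ∨
    ∃ k, ∃ l : Topology.RelCWComplex.cell (univ : Set M) k,
      Topology.RelCWComplex.closedCell n i ∩ Topology.RelCWComplex.closedCell m j =
        Topology.RelCWComplex.closedCell k l
  /-- a regular smooth parametrization of each closed edge over the unit interval -/
  param : Topology.RelCWComplex.cell (univ : Set M) 1 → ℝ → M
  contMDiffOn_param : ∀ i, ContMDiffOn 𝓘(ℝ, ℝ) (𝓡 2) ∞ (param i) (Icc 0 1)
  injOn_param : ∀ i, InjOn (param i) (Icc 0 1)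
  deriv_param_ne : ∀ i, ∀ t ∈ Icc (0 : ℝ) 1, derivWithin (S.pos ∘ param i) (Icc 0 1) t ≠ 0
  image_Icc : ∀ i, param i '' Icc 0 1 = Topology.RelCWComplex.closedCell 1 i
  image_Ioo : ∀ i, param i '' Ioo 0 1 = Topology.RelCWComplex.openCell 1 i

namespace DiscreteNet

variable {M : Type u} [TopologicalSpace M] [ChartedSpace Plane M]
  [Topology.CWComplex (univ : Set M)] {S : ImmersedSurface M} (N : DiscreteNet S)

/-- The vertices of the net. -/
abbrev Vertex (_N : DiscreteNet S) : Type u := Topology.RelCWComplex.cell (univ : Set M) 0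

/-- The edges of the net. -/
abbrev Edge (_N : DiscreteNet S) : Type u := Topology.RelCWComplex.cell (univ : Set M) 1

/-- The two-cells of the net. -/
abbrev Face (_N : DiscreteNet S) : Type u := Topology.RelCWComplex.cell (univ : Set M) 2

/-- The position of a vertex on the surface. -/
def point (v : N.Vertex) : M := Topology.RelCWComplex.map 0 v 0

/-- An edge, parametrized in one of its two directions. -/
def path (a : N.Edge × Bool) (t : ℝ) : M :=
  if a.2 then N.param a.1 t else N.param a.1 (1 - t)

/-- The (curved) edges emanating from a vertex, each of them directed away from the vertex. -/
def Star (v : N.Vertex) : Type u := {a : N.Edge × Bool // N.path a 0 = N.point v}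

/-- The valence of a vertex. -/
noncomputable def valence (v : N.Vertex) : ℕ := Nat.card (N.Star v)

variable {N} {v : N.Vertex}

/-- The intrinsic length of a curved edge emanating from a vertex. -/
noncomputable def length (d : N.Star v) : ℝ :=
  ∫ t in (0 : ℝ)..1, ‖derivWithin (S.pos ∘ N.path d.1) (Icc 0 1) t‖

/-- The velocity, at the vertex, of a curved edge emanating from it. -/
noncomputable def velocity (d : N.Star v) : Space :=
  derivWithin (S.pos ∘ N.path d.1) (Icc 0 1) 0

/-- The straight edge vector of an edge emanating from a vertex. -/
noncomputable def edgeVec (d : N.Star v) : Space :=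
  S.pos (N.path d.1 1) - S.pos (N.path d.1 0)

/-- Two distinct edges emanating from a vertex are contained in a common two-cell, so that their
edge vectors span a triangle of the triangulated vertex star. -/
def SpanTriangle (d d' : N.Star v) : Prop :=
  d ≠ d' ∧ ∃ F : N.Face,
    Topology.RelCWComplex.closedCell (C := (univ : Set M)) 1 d.1.1 ⊆
      Topology.RelCWComplex.closedCell (C := (univ : Set M)) 2 F ∧
    Topology.RelCWComplex.closedCell (C := (univ : Set M)) 1 d'.1.1 ⊆
      Topology.RelCWComplex.closedCell (C := (univ : Set M)) 2 F

/-- The permutation `σ` is a cyclic order of the edges around the vertex `v`: it consists of a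
single cycle, and two edges span a triangle of the vertex star if and only if they are consecutive.
Each edge `d` is then common to the triangles that it spans with `σ d` and with `σ.symm d`. -/
def IsCyclicOrder (σ : Equiv.Perm (N.Star v)) : Prop :=
  (∀ d d', σ.SameCycle d d') ∧ ∀ d d', SpanTriangle d d' ↔ d' = σ d ∨ d = σ d'

/-- The circumcentric area of an edge vector in the triangulated vertex star. -/
noncomputable def area (σ : Equiv.Perm (N.Star v)) (d : N.Star v) : ℝ :=
  circumcentricArea (edgeVec d) (edgeVec (σ d)) (edgeVec (σ.symm d))

/-- An edge emanating from a vertex is associated with the direction spanned by `w`: its velocity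
at the vertex is parallel to `w`. -/
def Associated (d : N.Star v) (w : Space) : Prop :=
  ∃ c : ℝ, c ≠ 0 ∧ velocity d = c • w

/-- An edge (vector) is area maximizing: its circumcentric area is maximal among all edges
emanating from `v` if `v` is umbilical, and among those associated with the same principal direction
if `v` is not umbilical. -/
def IsAreaMaximizing (σ : Equiv.Perm (N.Star v)) (d : N.Star v) : Prop :=
  (S.IsUmbilic (N.point v) → ∀ d', area σ d' ≤ area σ d) ∧
  (¬ S.IsUmbilic (N.point v) → ∀ d', Associated d' (velocity d) → area σ d' ≤ area σ d)

/-- At every edge the two adjacent triangles of the vertex star lie on opposite sides, when they are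
viewed along the surface normal `n` at the vertex: of the two numbers `n ⬝ (e × f)` and
`n ⬝ (e × g)` one is positive and the other one is negative. -/
def IsOriented (σ : Equiv.Perm (N.Star v)) : Prop :=
  ∀ d : N.Star v,
    ⟪S.normal (N.point v), cross (edgeVec d) (edgeVec (σ d))⟫ *
      ⟪S.normal (N.point v), cross (edgeVec d) (edgeVec (σ.symm d))⟫ < 0

variable (N v)

/-- `ε` is the largest intrinsic length of the curved edges emanating from `v`. -/
def IsMaxLength (ε : ℝ) : Prop :=
  IsGreatest (range fun d : N.Star v => length d) ε

/-- `ρ` is the shape regularity at `v`: the smallest number `r ≥ 1` with `ε / r ≤ ‖e‖` and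
`‖e‖ * ‖f‖ / ‖e × f‖ ≤ r` for all pairs of edge vectors that span a triangle of the vertex star.
The second inequality is multiplied out, so that it fails for degenerate triangles. -/
def IsShapeRegularity (ε ρ : ℝ) : Prop :=
  IsLeast {r : ℝ | 1 ≤ r ∧ ∀ d d' : N.Star v, SpanTriangle d d' →
    ε / r ≤ ‖edgeVec d‖ ∧
    ‖edgeVec d‖ * ‖edgeVec d'‖ ≤ r * ‖cross (edgeVec d) (edgeVec d')‖} ρ

/-- A discrete net of curvature lines: all edges are segments of curvature lines, non-umbilical
vertices have valence four and umbilical vertices have valence greater than two. -/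
structure IsCurvatureLineNet : Prop where
  principal : ∀ (i : N.Edge), ∀ t ∈ Icc (0 : ℝ) 1,
    S.IsPrincipal (N.param i t) (derivWithin (S.pos ∘ N.param i) (Icc 0 1) t)
  valence_eq : ∀ v : N.Vertex, ¬ S.IsUmbilic (N.point v) → N.valence v = 4
  two_lt_valence : ∀ v : N.Vertex, S.IsUmbilic (N.point v) → 2 < N.valence v

end DiscreteNet

/-! ### The cross product -/

/-! The cotangent formula `circumcentricArea_eq` writes the circumcentric area as ‖e‖²/4 · (cot α +
cot β), with α and β the angles opposite to e. Shape regularity bounds ‖e‖ from both sides and each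
cotangent from above, so the upper area bound holds for every edge. For the lower bound it suffices
to exhibit one competitor of area at least ε²/(16ρ⁴). At an umbilic all edges compete and the
shortest one serves, because both angles opposite to it are acute with a definite margin
(`le_area_of_shortest`). Elsewhere a δ-Delaunay edge in the given principal direction serves, since
cot α + cot β = sin(α + β)/(sin α sin β) (`le_area_of_isDelaunay`).

That at most one of four edges fails to be Delaunay is an angle count (`isDelaunay_or_isDelaunay`).
The four triangles have total angle 4π. If the edge vectors are almost tangent to the surface,
projecting them to the tangent plane shows that the angles at p add up to almost 2π or more
(`two_pi_sub_le_sum_angle`), which leaves too little for two edges with α + β > π - δ.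

Near tangency is needed relative to the chord: |⟨n, e⟩| ≤ (3/2) K ε ‖e‖. A second-order estimate
along the curved edge only gives a multiple of K ε², and dividing by ‖e‖ ≥ ε/ρ would lose a factor
ρ. Therefore `abs_inner_normal_chord_le` replaces the edge by an energy-minimizing chain of points
of the surface with the same ends. Its second differences are normal and quadratically small, so its
length is comparable to the chord.

Finally, curvature lines are unique away from umbilics: they solve a quadratic differential equation
of which the principal directions are simple roots, and two solutions with the same initial
direction coincide by a Grönwall argument. Distinct edges thus leave a non-umbilical vertex in
distinct directions (`velocity_ne_smul`), each principal direction carries at most two of them, and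
any three edges represent both directions (`exists_mem_associated`). -/

lemma space_inner (a b : Space) : ⟪a, b⟫ = a 0 * b 0 + a 1 * b 1 + a 2 * b 2 := by
  simp [PiLp.inner_apply, Fin.sum_univ_three]; ring

lemma space_norm_sq (a : Space) : ‖a‖ ^ 2 = a 0 ^ 2 + a 1 ^ 2 + a 2 ^ 2 := by
  rw [← real_inner_self_eq_norm_sq, space_inner]; ring

lemma cross_zero' (a b : Space) : cross a b 0 = a 1 * b 2 - a 2 * b 1 := by
  simp [cross, cross_apply]

lemma cross_one' (a b : Space) : cross a b 1 = a 2 * b 0 - a 0 * b 2 := by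
  simp [cross, cross_apply]

lemma cross_two' (a b : Space) : cross a b 2 = a 0 * b 1 - a 1 * b 0 := by
  simp [cross, cross_apply]

lemma norm_cross_sq (a b : Space) : ‖cross a b‖ ^ 2 = ‖a‖ ^ 2 * ‖b‖ ^ 2 - ⟪a, b⟫ ^ 2 := by
  simp only [space_norm_sq, space_inner, cross_zero', cross_one', cross_two']; ring

lemma norm_cross_comm (a b : Space) : ‖cross a b‖ = ‖cross b a‖ := by
  rw [← sq_eq_sq₀ (norm_nonneg _) (norm_nonneg _), norm_cross_sq, norm_cross_sq,
    real_inner_comm]; ring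

lemma norm_cross_eq_sin (a b : Space) :
    ‖cross a b‖ = ‖a‖ * ‖b‖ * Real.sin (InnerProductGeometry.angle a b) := by
  rw [← sq_eq_sq₀ (norm_nonneg _) (by
    have := InnerProductGeometry.sin_angle_nonneg a b
    positivity), norm_cross_sq, mul_pow, mul_pow, Real.sin_sq,
    ← InnerProductGeometry.cos_angle_mul_norm_mul_norm a b]
  ring

lemma inner_cross_comm (n a b : Space) : ⟪n, cross a b⟫ = -⟪n, cross b a⟫ := by
  simp only [space_inner, cross_zero', cross_one', cross_two']; ring

lemma inner_cross_cross (a b c d : Space) :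
    ⟪cross a b, cross c d⟫ = ⟪a, c⟫ * ⟪b, d⟫ - ⟪a, d⟫ * ⟪b, c⟫ := by
  simp only [space_inner, cross_zero', cross_one', cross_two']; ring

lemma cross_cross_left (n a : Space) : cross a (cross n a) = ‖a‖ ^ 2 • n - ⟪n, a⟫ • a := by
  ext i
  fin_cases i <;>
  simp [space_norm_sq, space_inner, cross_zero', cross_one', cross_two'] <;> ring

/-! ### The circumcenter of a triangle in the plane -/

/-- The stated point is equidistant from the three vertices, which characterizes the circumcenter.
The hypotheses exclude collinearity, hence the default value at the origin. -/
lemma planeCircumcenter_eq {l x y : ℝ} (hl : l ≠ 0) (hy : y ≠ 0) :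
    planeCircumcenter !₂[0, 0] !₂[l, 0] !₂[x, y] =
      !₂[l / 2, (x ^ 2 + y ^ 2 - l * x) / (2 * y)] := by
  have hind : AffineIndependent ℝ ![(!₂[0, 0] : Plane), !₂[l, 0], !₂[x, y]] := by
    rw [affineIndependent_iff_not_collinear_set, collinear_iff_of_mem (p₀ := !₂[0, 0]) (by simp)]
    rintro ⟨v, hv⟩
    obtain ⟨r, hr⟩ := hv !₂[l, 0] (by simp)
    obtain ⟨t, ht⟩ := hv !₂[x, y] (by simp)
    have h0 := congrArg (fun p : Plane => p 0) hr
    have h1 := congrArg (fun p : Plane => p 1) hr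
    have h2 := congrArg (fun p : Plane => p 1) ht
    simp at h0 h1 h2
    rcases h1 with h1 | h1
    · simp [h1] at h0; exact hl h0
    · simp [h1] at h2; exact hy h2
  rw [planeCircumcenter, dif_pos hind]
  symm
  refine Affine.Simplex.eq_circumcenter_of_dist_eq _ (r :=
    √((l / 2) ^ 2 + ((x ^ 2 + y ^ 2 - l * x) / (2 * y)) ^ 2)) ?_ ?_
  · have : affineSpan ℝ (range ![(!₂[0, 0] : Plane), !₂[l, 0], !₂[x, y]]) = ⊤ :=
      hind.affineSpan_eq_top_iff_card_eq_finrank_add_one.2 (by simp)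
    simp only [this]
    exact AffineSubspace.mem_top _ _ _
  · intro i
    rw [EuclideanSpace.dist_eq]
    congr 1
    fin_cases i <;> simp [Fin.sum_univ_two, Real.dist_eq, sq_abs] <;> field_simp <;> ring

/-- The cotangent of the angle opposite to the edge `e` in the triangle spanned by `e` and `f`. -/
noncomputable def oppositeCot (e f : Space) : ℝ := (‖f‖ ^ 2 - ⟪e, f⟫) / ‖cross e f‖

/-- The circumcenter lies on the perpendicular bisector of e, at signed height (‖e‖/2) · cot of the
opposite angle. -/
lemma unfoldCircumcenter_eq {s : ℝ} (hs : s ^ 2 = 1) {e f : Space} (h : 0 < ‖cross e f‖)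
    (he : 0 < ‖e‖) :
    unfoldCircumcenter s e f = !₂[‖e‖ / 2, s * (‖e‖ * oppositeCot e f / 2)] := by
  have hs0 : s ≠ 0 := by rintro rfl; simp at hs
  rw [unfoldCircumcenter, unfoldApex, planeCircumcenter_eq he.ne' (by positivity)]
  have hn := norm_cross_sq e f
  have : ((⟪e, f⟫ / ‖e‖) ^ 2 + (s * ‖cross e f‖ / ‖e‖) ^ 2 - ‖e‖ * (⟪e, f⟫ / ‖e‖)) /
      (2 * (s * ‖cross e f‖ / ‖e‖)) = s * (‖e‖ * oppositeCot e f / 2) := by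
    rw [oppositeCot]
    have h' := h.ne'
    field_simp
    rw [hs, hn]; ring
  rw [this]

/-- Both circumcenters lie on the same perpendicular bisector, so their distance is the absolute
value of a difference of heights, and the sign in the definition undoes the absolute value. -/
lemma circumcentricArea_eq {e f g : Space} (hf : 0 < ‖cross e f‖) (hg : 0 < ‖cross e g‖)
    (he : 0 < ‖e‖) :
    circumcentricArea e f g = ‖e‖ ^ 2 / 4 * (oppositeCot e f + oppositeCot e g) := by
  rw [circumcentricArea, unfoldCircumcenter_eq (by norm_num) hf he,
    unfoldCircumcenter_eq (by norm_num) hg he]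
  have : dist (!₂[‖e‖ / 2, 1 * (‖e‖ * oppositeCot e f / 2)] : Plane)
      !₂[‖e‖ / 2, -1 * (‖e‖ * oppositeCot e g / 2)] =
      |1 * (‖e‖ * oppositeCot e f / 2) - -1 * (‖e‖ * oppositeCot e g / 2)| := by
    rw [EuclideanSpace.dist_eq]
    simp [Fin.sum_univ_two, Real.dist_eq, Real.sqrt_sq_eq_abs]
  rw [this]
  simp only [Matrix.cons_val_one, Matrix.cons_val_fin_one]
  generalize hz : 1 * (‖e‖ * oppositeCot e f / 2) - -1 * (‖e‖ * oppositeCot e g / 2) = z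
  have h1 := sign_mul_abs z
  calc _ = 1 / 2 * ‖e‖ * ((SignType.sign z : ℝ) * |z|) := by ring
    _ = _ := by rw [h1, ← hz]; ring

/-! ### Opposite angles -/

lemma norm_cross_neg_sub (e f : Space) : ‖cross (-f) (e - f)‖ = ‖cross e f‖ := by
  rw [← sq_eq_sq₀ (norm_nonneg _) (norm_nonneg _)]
  simp only [space_norm_sq, cross_zero', cross_one', cross_two', PiLp.neg_apply, PiLp.sub_apply]
  ring

lemma sin_oppositeAngle (e f : Space) :
    ‖cross e f‖ = ‖f‖ * ‖e - f‖ * Real.sin (oppositeAngle e f) := by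
  rw [← norm_cross_neg_sub, norm_cross_eq_sin, norm_neg]; rfl

lemma cos_oppositeAngle (e f : Space) :
    ‖f‖ ^ 2 - ⟪e, f⟫ = ‖f‖ * ‖e - f‖ * Real.cos (oppositeAngle e f) := by
  have := InnerProductGeometry.cos_angle_mul_norm_mul_norm (-f) (e - f)
  rw [norm_neg] at this
  rw [oppositeAngle, mul_comm, this, inner_sub_right, inner_neg_left, inner_neg_left,
    real_inner_self_eq_norm_sq, real_inner_comm]
  ring

lemma oppositeAngle_mem {e f : Space} (h : 0 < ‖cross e f‖) :
    0 < oppositeAngle e f ∧ oppositeAngle e f < Real.pi ∧ 0 < Real.sin (oppositeAngle e f) := by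
  have hs : 0 < Real.sin (oppositeAngle e f) := by
    have h0 := InnerProductGeometry.sin_angle_nonneg (-f) (e - f)
    rcases h0.lt_or_eq with h1 | h1
    · exact h1
    · rw [sin_oppositeAngle] at h
      change 0 = Real.sin (oppositeAngle e f) at h1
      rw [← h1] at h; simp at h
  refine ⟨(InnerProductGeometry.angle_nonneg _ _).lt_of_ne ?_,
    (InnerProductGeometry.angle_le_pi _ _).lt_of_ne ?_, hs⟩
  · intro h0
    change 0 = oppositeAngle e f at h0
    rw [← h0] at hs; simp at hs
  · intro h0
    change oppositeAngle e f = _ at h0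
    rw [h0] at hs; simp at hs

lemma oppositeCot_eq {e f : Space} (h : 0 < ‖cross e f‖) :
    oppositeCot e f = Real.cos (oppositeAngle e f) / Real.sin (oppositeAngle e f) := by
  have h1 := sin_oppositeAngle e f
  have h2 := (oppositeAngle_mem h).2.2
  rw [oppositeCot, cos_oppositeAngle, h1]
  have : ‖f‖ * ‖e - f‖ ≠ 0 := by
    intro h3; rw [h3, zero_mul] at h1; exact h.ne' h1
  exact mul_div_mul_left _ _ this

lemma triangle_angle_sum {e f : Space} (h : 0 < ‖cross e f‖) :
    InnerProductGeometry.angle e f + oppositeAngle e f + oppositeAngle f e = Real.pi := by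
  have hf : f ≠ 0 := by
    rintro rfl
    have := norm_cross_sq e 0
    simp at this; rw [this] at h; simp at h
  have := InnerProductGeometry.angle_add_angle_sub_add_angle_sub_eq_pi e hf
  rw [← this]
  have h1 : oppositeAngle e f = InnerProductGeometry.angle f (f - e) := by
    rw [oppositeAngle, ← InnerProductGeometry.angle_neg_neg, neg_neg, neg_sub]
  have h2 : oppositeAngle f e = InnerProductGeometry.angle e (e - f) := by
    rw [oppositeAngle, ← InnerProductGeometry.angle_neg_neg, neg_neg, neg_sub]
  rw [h1, h2]; ring

/-! ### Shape regular triangles -/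

/-- The triangle spanned by `e` and `f` is shape regular: edges at most `ε` long, at least `ε / ρ`
long, and an angle at the origin of sine at least `1 / ρ`. -/
structure ShapeRegular (ε ρ : ℝ) (e f : Space) : Prop where
  eps_pos : 0 < ε
  one_le : 1 ≤ ρ
  left_le : ‖e‖ ≤ ε
  right_le : ‖f‖ ≤ ε
  le_left : ε / ρ ≤ ‖e‖
  le_right : ε / ρ ≤ ‖f‖
  cross_le : ‖e‖ * ‖f‖ ≤ ρ * ‖cross e f‖

namespace ShapeRegular

variable {ε ρ : ℝ} {e f g : Space}

lemma symm (h : ShapeRegular ε ρ e f) : ShapeRegular ε ρ f e :=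
  ⟨h.eps_pos, h.one_le, h.right_le, h.left_le, h.le_right, h.le_left, by
    rw [mul_comm, norm_cross_comm]; exact h.cross_le⟩

lemma rho_pos (h : ShapeRegular ε ρ e f) : 0 < ρ := zero_lt_one.trans_le h.one_le

lemma left_pos (h : ShapeRegular ε ρ e f) : 0 < ‖e‖ :=
  (div_pos h.eps_pos h.rho_pos).trans_le h.le_left

lemma right_pos (h : ShapeRegular ε ρ e f) : 0 < ‖f‖ := h.symm.left_pos

lemma cross_pos (h : ShapeRegular ε ρ e f) : 0 < ‖cross e f‖ := by
  have h1 := mul_pos h.left_pos h.right_pos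
  have h2 := h1.trans_le h.cross_le
  exact pos_of_mul_pos_right h2 h.rho_pos.le

lemma eps_le_mul (h : ShapeRegular ε ρ e f) : ε ≤ ρ * ‖e‖ := by
  have := h.le_left
  rwa [div_le_iff₀' h.rho_pos] at this

/-- The numerator is at most ‖f‖(‖f‖ + ‖e‖) ≤ 2ρ‖e‖‖f‖, because both lengths are at most ε ≤ ρ‖e‖;
the denominator is at least ‖e‖‖f‖/ρ. -/
lemma oppositeCot_le (h : ShapeRegular ε ρ e f) : oppositeCot e f ≤ 2 * ρ ^ 2 := by
  rw [oppositeCot, div_le_iff₀ h.cross_pos]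
  have h1 : ‖f‖ ^ 2 - ⟪e, f⟫ ≤ ‖f‖ * (‖f‖ + ‖e‖) := by
    have := (abs_le.1 (abs_real_inner_le_norm e f)).1
    nlinarith
  have h2 : ‖f‖ + ‖e‖ ≤ 2 * ρ * ‖e‖ := by
    have := h.eps_le_mul; have := h.left_le; have := h.right_le
    linarith
  calc _ ≤ ‖f‖ * (2 * ρ * ‖e‖) := h1.trans (mul_le_mul_of_nonneg_left h2 (norm_nonneg _))
    _ = 2 * ρ * (‖e‖ * ‖f‖) := by ring
    _ ≤ 2 * ρ * (ρ * ‖cross e f‖) :=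
        mul_le_mul_of_nonneg_left h.cross_le (by linarith [h.rho_pos])
    _ = _ := by ring

/-- Replacing ‖f‖² by the smaller ‖e‖‖f‖ leaves (1 - cos θ)/sin θ = sin θ/(1 + cos θ) ≥ sin θ/2,
where θ is the angle between e and f and sin θ ≥ 1/ρ. -/
lemma le_oppositeCot (h : ShapeRegular ε ρ e f) (hef : ‖e‖ ≤ ‖f‖) :
    1 / (2 * ρ) ≤ oppositeCot e f := by
  have hρ := h.rho_pos
  rw [oppositeCot, le_div_iff₀ h.cross_pos, div_mul_eq_mul_div, one_mul,
    div_le_iff₀ (by positivity)]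
  have hsq := norm_cross_sq e f
  have hi := abs_le.1 (abs_real_inner_le_norm e f)
  have h0 : 0 < ‖e‖ * ‖f‖ := mul_pos h.left_pos h.right_pos
  have h1 : ‖e‖ * ‖f‖ ≤ ‖f‖ ^ 2 := by nlinarith [norm_nonneg f]
  have h2 : ‖cross e f‖ ^ 2 ≤ (‖e‖ * ‖f‖ - ⟪e, f⟫) * (2 * (‖e‖ * ‖f‖)) := by
    have : ‖cross e f‖ ^ 2 = (‖e‖ * ‖f‖ - ⟪e, f⟫) * (‖e‖ * ‖f‖ + ⟪e, f⟫) := by rw [hsq]; ring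
    rw [this]
    exact mul_le_mul_of_nonneg_left (by linarith) (by linarith)
  have h3 : ‖cross e f‖ ^ 2 ≤ (‖e‖ * ‖f‖ - ⟪e, f⟫) * (2 * (ρ * ‖cross e f‖)) :=
    h2.trans (mul_le_mul_of_nonneg_left (by linarith [h.cross_le]) (by linarith))
  have h4 : ‖cross e f‖ ≤ (‖e‖ * ‖f‖ - ⟪e, f⟫) * (2 * ρ) := by
    have : ‖cross e f‖ * ‖cross e f‖ ≤ ((‖e‖ * ‖f‖ - ⟪e, f⟫) * (2 * ρ)) * ‖cross e f‖ := by
      nlinarith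
    exact le_of_mul_le_mul_right this h.cross_pos
  exact h4.trans (mul_le_mul_of_nonneg_right (by linarith) (by positivity))

/-- The sine of the opposite angle is ‖e × f‖/(‖f‖‖e - f‖), and ‖e - f‖ ≤ 2ε ≤ 2ρ‖e‖; then sin x <
x. -/
lemma le_oppositeAngle (h : ShapeRegular ε ρ e f) :
    1 / (2 * ρ ^ 2) ≤ oppositeAngle e f := by
  have hρ := h.rho_pos
  have h1 := sin_oppositeAngle e f
  obtain ⟨h0, -, hs⟩ := oppositeAngle_mem h.cross_pos
  refine le_trans ?_ (Real.sin_lt h0).le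
  have h2 : ‖e - f‖ ≤ 2 * ρ * ‖e‖ := by
    have := h.eps_le_mul; have := h.left_le; have := h.right_le; have := norm_sub_le e f
    linarith
  have h3 : ‖e‖ * ‖f‖ ≤ ρ * (‖f‖ * (2 * ρ * ‖e‖) * Real.sin (oppositeAngle e f)) := by
    refine h.cross_le.trans ?_
    rw [h1]
    gcongr
  rw [div_le_iff₀ (by positivity)]
  have h4 : 0 < ‖e‖ * ‖f‖ := mul_pos h.left_pos h.right_pos
  nlinarith

lemma area_le (hf : ShapeRegular ε ρ e f) (hg : ShapeRegular ε ρ e g) :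
    circumcentricArea e f g ≤ ρ ^ 2 * ε ^ 2 := by
  rw [circumcentricArea_eq hf.cross_pos hg.cross_pos hf.left_pos]
  have h1 := hf.oppositeCot_le
  have h2 := hg.oppositeCot_le
  have h3 : ‖e‖ ^ 2 ≤ ε ^ 2 := pow_le_pow_left₀ (norm_nonneg _) hf.left_le 2
  calc _ ≤ ‖e‖ ^ 2 / 4 * (4 * ρ ^ 2) := by gcongr; linarith
    _ = ρ ^ 2 * ‖e‖ ^ 2 := by ring
    _ ≤ _ := by gcongr

lemma sq_le (h : ShapeRegular ε ρ e f) : ε ^ 2 / ρ ^ 2 ≤ ‖e‖ ^ 2 := by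
  rw [← div_pow]
  exact pow_le_pow_left₀ (div_nonneg h.eps_pos.le h.rho_pos.le) h.le_left 2

/-- Serves at umbilics, where the valence is arbitrary and the angle count is not available. -/
lemma le_area_of_shortest (hf : ShapeRegular ε ρ e f) (hg : ShapeRegular ε ρ e g)
    (h1 : ‖e‖ ≤ ‖f‖) (h2 : ‖e‖ ≤ ‖g‖) : ε ^ 2 / (16 * ρ ^ 4) ≤ circumcentricArea e f g := by
  rw [circumcentricArea_eq hf.cross_pos hg.cross_pos hf.left_pos]
  have h1 := hf.le_oppositeCot h1
  have h2 := hg.le_oppositeCot h2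
  have hρ := hf.rho_pos
  have hρ1 := hf.one_le
  calc ε ^ 2 / (16 * ρ ^ 4) = ε ^ 2 / ρ ^ 2 / 4 * (1 / (4 * ρ ^ 2)) := by field_simp; norm_num
    _ ≤ ε ^ 2 / ρ ^ 2 / 4 * (1 / ρ) := by
        gcongr
        nlinarith
    _ ≤ ‖e‖ ^ 2 / 4 * (1 / (2 * ρ) + 1 / (2 * ρ)) := by
        have : 1 / (2 * ρ) + 1 / (2 * ρ) = 1 / ρ := by field_simp; norm_num
        rw [this]
        gcongr
        exact hf.sq_le
    _ ≤ _ := by gcongr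

/-- Since cot α + cot β = sin(α + β)/(sin α sin β) ≥ sin(α + β) and α + β lies between δ and π - δ,
the sum is at least sin δ ≥ δ/2. -/
lemma le_area_of_isDelaunay (hf : ShapeRegular ε ρ e f) (hg : ShapeRegular ε ρ e g)
    (h : IsDelaunay (1 / (2 * ρ ^ 2)) e f g) :
    ε ^ 2 / (16 * ρ ^ 4) ≤ circumcentricArea e f g := by
  rw [circumcentricArea_eq hf.cross_pos hg.cross_pos hf.left_pos, oppositeCot_eq hf.cross_pos,
    oppositeCot_eq hg.cross_pos]
  obtain ⟨ha0, haπ, hsa⟩ := oppositeAngle_mem hf.cross_pos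
  obtain ⟨hb0, hbπ, hsb⟩ := oppositeAngle_mem hg.cross_pos
  obtain ⟨ha, hb, hab⟩ := h
  set α := oppositeAngle e f
  set β := oppositeAngle e g
  have hρ := hf.rho_pos
  have hρ1 := hf.one_le
  have hρ2 : (1 : ℝ) ≤ ρ ^ 2 := one_le_pow₀ hρ1
  set δ := 1 / (2 * ρ ^ 2) with hδ
  have hδ0 : 0 < δ := by positivity
  have hδ1 : δ ≤ 1 / 2 := by
    rw [hδ]; gcongr; linarith
  have hsin : δ / 2 ≤ Real.sin δ := by
    have := Real.mul_le_sin hδ0.le (by linarith [Real.pi_gt_three])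
    refine le_trans ?_ this
    have : 1 / 2 ≤ 2 / Real.pi := by
      rw [div_le_div_iff₀ two_pos Real.pi_pos]; linarith [Real.pi_le_four]
    nlinarith
  have hs : δ / 2 ≤ Real.sin (α + β) := by
    refine hsin.trans ?_
    rcases le_total (α + β) (Real.pi / 2) with h1 | h1
    · exact Real.sin_le_sin_of_le_of_le_pi_div_two (by linarith) h1 (by linarith)
    · rw [← Real.sin_pi_sub (α + β)]
      exact Real.sin_le_sin_of_le_of_le_pi_div_two (by linarith) (by linarith) (by linarith)
  have hcot : δ / 2 ≤ Real.cos α / Real.sin α + Real.cos β / Real.sin β := by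
    rw [div_add_div _ _ hsa.ne' hsb.ne', le_div_iff₀ (mul_pos hsa hsb)]
    have h1 : Real.sin α * Real.sin β ≤ 1 :=
      mul_le_one₀ (Real.sin_le_one _) hsb.le (Real.sin_le_one _)
    rw [Real.sin_add] at hs
    nlinarith
  calc ε ^ 2 / (16 * ρ ^ 4) = ε ^ 2 / ρ ^ 2 / 4 * (δ / 2) := by rw [hδ]; field_simp; ring
    _ ≤ ‖e‖ ^ 2 / 4 * (Real.cos α / Real.sin α + Real.cos β / Real.sin β) := by
      gcongr
      exact hf.sq_le

end ShapeRegular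

/-! ### The sum of the angles around a vertex -/

/-- A positively oriented orthonormal frame of the plane orthogonal to n identifies that plane with
ℂ in such a way that orientation with respect to n becomes the sign of an imaginary part. -/
lemma exists_frame {n : Space} (hn : ‖n‖ = 1) :
    ∃ a b : Space, ‖a‖ = 1 ∧ ‖b‖ = 1 ∧ ⟪a, b⟫ = 0 ∧ cross a b = n := by
  obtain ⟨c, hc, hnc⟩ : ∃ c : Space, c ≠ 0 ∧ ⟪n, c⟫ = 0 := by
    by_cases h : n 0 = 0
    · refine ⟨!₂[1, 0, 0], ?_, by simp [space_inner, h]⟩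
      intro h0
      have := congrArg (fun p : Space => p 0) h0
      simp at this
    · refine ⟨!₂[- n 1, n 0, 0], ?_, by simp [space_inner]; ring⟩
      intro h0
      have := congrArg (fun p : Space => p 1) h0
      simp at this
      exact h this
  have hc' : ‖c‖ ≠ 0 := norm_ne_zero_iff.2 hc
  set a : Space := ‖c‖⁻¹ • c with ha
  have ha1 : ‖a‖ = 1 := by rw [ha, norm_smul, norm_inv, norm_norm, inv_mul_cancel₀ hc']
  have hna : ⟪n, a⟫ = 0 := by rw [ha, inner_smul_right, hnc, mul_zero]
  refine ⟨a, cross n a, ha1, ?_, ?_, ?_⟩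
  · have := norm_cross_sq n a
    rw [hna, hn, ha1] at this
    rw [← sq_eq_sq₀ (norm_nonneg _) zero_le_one, this]; norm_num
  · simp only [space_inner, cross_zero', cross_one', cross_two']; ring
  · rw [cross_cross_left, hna, ha1]; simp

/-- The coordinates of the projection of a vector to the plane spanned by `a` and `b`. -/
noncomputable def planeCoord (a b e : Space) : ℂ := ⟨⟪a, e⟫, ⟪b, e⟫⟩

/-- The vector of the plane spanned by `a` and `b` with the given coordinates. -/
noncomputable def planeVec (a b : Space) (z : ℂ) : Space := z.re • a + z.im • b

section Frame

variable {a b : Space}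


lemma inner_planeVec (ha : ‖a‖ = 1) (hb : ‖b‖ = 1) (hab : ⟪a, b⟫ = 0)
    (z w : ℂ) : ⟪planeVec a b z, planeVec a b w⟫ = ⟪z, w⟫ := by
  have h1 := real_inner_self_eq_norm_sq a
  have h2 := real_inner_self_eq_norm_sq b
  rw [ha] at h1; rw [hb] at h2
  have h3 : ⟪b, a⟫ = 0 := by rw [real_inner_comm]; exact hab
  simp only [planeVec, inner_add_left, inner_add_right, inner_smul_left, inner_smul_right, h1, h2,
    h3, hab, Complex.inner, Complex.mul_re, Complex.conj_re, Complex.conj_im]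
  simp

lemma norm_planeVec (ha : ‖a‖ = 1) (hb : ‖b‖ = 1) (hab : ⟪a, b⟫ = 0)
    (z : ℂ) : ‖planeVec a b z‖ = ‖z‖ := by
  rw [← sq_eq_sq₀ (norm_nonneg _) (norm_nonneg _), ← real_inner_self_eq_norm_sq,
    ← real_inner_self_eq_norm_sq, inner_planeVec ha hb hab]

lemma angle_planeVec (ha : ‖a‖ = 1) (hb : ‖b‖ = 1) (hab : ⟪a, b⟫ = 0)
    (z w : ℂ) :
    InnerProductGeometry.angle (planeVec a b z) (planeVec a b w) =
      InnerProductGeometry.angle z w := by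
  rw [InnerProductGeometry.angle, InnerProductGeometry.angle, inner_planeVec ha hb hab,
    norm_planeVec ha hb hab, norm_planeVec ha hb hab]

lemma norm_sq_eq_planeCoord (ha : ‖a‖ = 1) (hb : ‖b‖ = 1) (hab : ⟪a, b⟫ = 0)
    (e : Space) :
    ‖e‖ ^ 2 = ‖planeCoord a b e‖ ^ 2 + ⟪cross a b, e⟫ ^ 2 := by
  -- A polynomial identity for arbitrary a and b; for an orthonormal pair it reduces to Pythagoras.
  have key : (‖a‖ ^ 2 * ‖b‖ ^ 2 - ⟪a, b⟫ ^ 2) * ‖e‖ ^ 2 =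
      ‖b‖ ^ 2 * ⟪a, e⟫ ^ 2 + ‖a‖ ^ 2 * ⟪b, e⟫ ^ 2 - 2 * ⟪a, b⟫ * ⟪a, e⟫ * ⟪b, e⟫ +
        ⟪cross a b, e⟫ ^ 2 := by
    simp only [space_inner, space_norm_sq, cross_zero', cross_one', cross_two']
    ring
  rw [ha, hb, hab] at key
  have h : ‖planeCoord a b e‖ ^ 2 = ⟪a, e⟫ ^ 2 + ⟪b, e⟫ ^ 2 := by
    rw [← Complex.normSq_eq_norm_sq, Complex.normSq_apply, planeCoord]; ring
  rw [h]; linarith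

lemma inner_planeVec_planeCoord (e : Space) :
    ⟪e, planeVec a b (planeCoord a b e)⟫ = ‖planeCoord a b e‖ ^ 2 := by
  rw [← Complex.normSq_eq_norm_sq, Complex.normSq_apply, planeVec, planeCoord, inner_add_right,
    inner_smul_right, inner_smul_right, real_inner_comm e a, real_inner_comm e b]

/-- The cosine of the angle between e and its projection is the quotient of their lengths, which
Pythagoras bounds below by cos η. -/
lemma angle_planeVec_planeCoord_le (ha : ‖a‖ = 1) (hb : ‖b‖ = 1) (hab : ⟪a, b⟫ = 0)
    {e : Space} {η : ℝ} (he : 0 < ‖planeCoord a b e‖) (h0 : 0 ≤ η)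
    (h1 : η ≤ Real.pi / 2) (h : |⟪cross a b, e⟫| ≤ ‖e‖ * Real.sin η) :
    InnerProductGeometry.angle e (planeVec a b (planeCoord a b e)) ≤ η := by
  rw [InnerProductGeometry.angle, inner_planeVec_planeCoord, norm_planeVec ha hb hab,
    ← Real.arccos_cos h0 (by linarith [Real.pi_pos])]
  apply Real.arccos_le_arccos
  have hsq := norm_sq_eq_planeCoord ha hb hab e
  have hepos : 0 < ‖e‖ := by
    by_contra h'
    have : ‖e‖ = 0 := le_antisymm (not_lt.1 h') (norm_nonneg _)
    rw [this] at hsq; nlinarith [sq_nonneg ⟪cross a b, e⟫]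
  have hc : 0 ≤ Real.cos η := Real.cos_nonneg_of_neg_pi_div_two_le_of_le (by linarith) h1
  rw [sq, mul_div_mul_right _ _ he.ne', le_div_iff₀ hepos]
  apply le_of_sq_le_sq _ he.le
  have h2 : ⟪cross a b, e⟫ ^ 2 ≤ (‖e‖ * Real.sin η) ^ 2 := by
    rw [← sq_abs]; exact pow_le_pow_left₀ (abs_nonneg _) h 2
  have := Real.sin_sq_add_cos_sq η
  nlinarith

end Frame

lemma conj_planeCoord_mul_im (a b e f : Space) :
    ((starRingEnd ℂ) (planeCoord a b e) * planeCoord a b f).im = ⟪cross a b, cross e f⟫ := by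
  rw [inner_cross_cross]
  simp [planeCoord]; ring

/-- The quotients z (σ d) / z d multiply to 1 for any permutation, so their arguments add up to a
multiple of 2π. All arguments are positive, hence the multiple is at least one. -/
lemma two_pi_le_sum_arg {ι : Type*} [Fintype ι] [Nonempty ι] (σ : Equiv.Perm ι) (z : ι → ℂ)
    (h : ∀ d, 0 < ((starRingEnd ℂ) (z d) * z (σ d)).im) :
    2 * Real.pi ≤ ∑ d, InnerProductGeometry.angle (z d) (z (σ d)) := by
  have hz : ∀ d, z d ≠ 0 := by
    intro d h0
    have := h d
    simp [h0] at this
  have him : ∀ d, 0 < (z (σ d) / z d).im := by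
    intro d
    have : z (σ d) / z d = ((starRingEnd ℂ) (z d) * z (σ d)) * ((Complex.normSq (z d))⁻¹ : ℝ) := by
      rw [div_eq_mul_inv, Complex.inv_def]; ring
    rw [this, Complex.im_mul_ofReal]
    exact mul_pos (h d) (inv_pos.2 (Complex.normSq_pos.2 (hz d)))
  have harg : ∀ d, InnerProductGeometry.angle (z d) (z (σ d)) = (z (σ d) / z d).arg := by
    intro d
    rw [InnerProductGeometry.angle_comm, Complex.angle_eq_abs_arg (hz _) (hz _),
      abs_of_nonneg (Complex.arg_nonneg_iff.2 (him d).le)]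
  have hpos : ∀ d, 0 < (z (σ d) / z d).arg := by
    intro d
    refine (Complex.arg_nonneg_iff.2 (him d).le).lt_of_ne fun h0 => ?_
    have := (Complex.arg_eq_zero_iff.1 h0.symm).2
    exact (him d).ne' this
  simp only [harg]
  have hexp : Complex.exp ((∑ d, (z (σ d) / z d).arg : ℝ) * Complex.I) = 1 := by
    have h1 : ∀ d, Complex.exp ((z (σ d) / z d).arg * Complex.I) =
        (z (σ d) / ‖z (σ d)‖) / (z d / ‖z d‖) := by
      intro d
      have h2 := Complex.norm_mul_exp_arg_mul_I (z (σ d) / z d)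
      have h3 : ‖z d‖ ≠ 0 := norm_ne_zero_iff.2 (hz d)
      have h4 : ‖z (σ d)‖ ≠ 0 := norm_ne_zero_iff.2 (hz _)
      have h3' : (‖z d‖ : ℂ) ≠ 0 := by exact_mod_cast h3
      have h4' : (‖z (σ d)‖ : ℂ) ≠ 0 := by exact_mod_cast h4
      have h5 := hz d
      rw [norm_div, Complex.ofReal_div] at h2
      have h6 : Complex.exp ((z (σ d) / z d).arg * Complex.I) =
          (z (σ d) / z d) / (‖z (σ d)‖ / ‖z d‖ : ℂ) := by
        rw [eq_div_iff (div_ne_zero h4' h3'), mul_comm]; exact h2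
      rw [h6]; field_simp
    push_cast
    rw [Finset.sum_mul, Complex.exp_sum, Finset.prod_congr rfl fun d _ => h1 d,
      Finset.prod_div_distrib, Equiv.prod_comp σ fun d => z d / (‖z d‖ : ℂ), div_self]
    exact Finset.prod_ne_zero_iff.2 fun d _ =>
      div_ne_zero (hz d) (by exact_mod_cast norm_ne_zero_iff.2 (hz d))
  obtain ⟨k, hk⟩ := Complex.exp_eq_one_iff.1 hexp
  have hk' : (∑ d, (z (σ d) / z d).arg : ℝ) = k * (2 * Real.pi) := by
    have h0 : ((∑ d, (z (σ d) / z d).arg : ℝ) : ℂ) * Complex.I =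
        ((k * (2 * Real.pi) : ℝ) : ℂ) * Complex.I := by rw [hk]; push_cast; ring
    exact_mod_cast mul_right_cancel₀ Complex.I_ne_zero h0
  have hsum : 0 < ∑ d, (z (σ d) / z d).arg :=
    Finset.sum_pos (fun d _ => hpos d) Finset.univ_nonempty
  rw [hk'] at hsum ⊢
  have hk1 : 0 < k := by
    have : (0 : ℝ) < k := pos_of_mul_pos_left hsum (by positivity)
    exact_mod_cast this
  have hk2 : (1 : ℝ) ≤ k := by exact_mod_cast hk1
  nlinarith [Real.pi_pos]

/-- Each vector makes an angle at most η with its projection, so by the triangle inequality for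
angles projecting changes each angle by at most 2η. -/
lemma two_pi_sub_le_sum_angle {ι : Type*} [Fintype ι] [Nonempty ι] (σ : Equiv.Perm ι)
    (e : ι → Space) {n : Space} (hn : ‖n‖ = 1) (h : ∀ d, 0 < ⟪n, cross (e d) (e (σ d))⟫)
    {η : ℝ} (h0 : 0 ≤ η) (h1 : η ≤ Real.pi / 2) (hη : ∀ d, |⟪n, e d⟫| ≤ ‖e d‖ * Real.sin η) :
    2 * Real.pi - 2 * Fintype.card ι * η ≤
      ∑ d, InnerProductGeometry.angle (e d) (e (σ d)) := by
  obtain ⟨a, b, ha, hb, hab, rfl⟩ := exists_frame hn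
  have him : ∀ d, 0 <
      ((starRingEnd ℂ) (planeCoord a b (e d)) * planeCoord a b (e (σ d))).im := by
    intro d; rw [conj_planeCoord_mul_im]; exact h d
  have hz : ∀ d, 0 < ‖planeCoord a b (e d)‖ := by
    intro d
    rw [norm_pos_iff]
    intro h0
    have := him d
    simp [h0] at this
  have hsum := two_pi_le_sum_arg σ (fun d => planeCoord a b (e d)) him
  have hle : ∀ d, InnerProductGeometry.angle (planeCoord a b (e d)) (planeCoord a b (e (σ d))) ≤
      InnerProductGeometry.angle (e d) (e (σ d)) + 2 * η := by
    intro d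
    rw [← angle_planeVec ha hb hab]
    have i1 := InnerProductGeometry.angle_le_angle_add_angle
      (planeVec a b (planeCoord a b (e d))) (e d) (planeVec a b (planeCoord a b (e (σ d))))
    have i2 := InnerProductGeometry.angle_le_angle_add_angle
      (e d) (e (σ d)) (planeVec a b (planeCoord a b (e (σ d))))
    have i3 := angle_planeVec_planeCoord_le ha hb hab (hz d) h0 h1 (hη d)
    have i4 := angle_planeVec_planeCoord_le ha hb hab (hz (σ d)) h0 h1 (hη (σ d))
    rw [InnerProductGeometry.angle_comm] at i3
    linarith
  have := hsum.trans (Finset.sum_le_sum fun d _ => hle d)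
  rw [Finset.sum_add_distrib, Finset.sum_const, Finset.card_univ, nsmul_eq_mul] at this
  linarith

/-- In a cyclic arrangement of four shape regular triangles that are almost orthogonal to a unit
vector, at most one edge is not Delaunay. -/
lemma isDelaunay_or_isDelaunay {ι : Type*} [Fintype ι] (σ : Equiv.Perm ι)
    (hcard : Fintype.card ι = 4) (e : ι → Space) {n : Space} (hn : ‖n‖ = 1)
    (h : ∀ d, 0 < ⟪n, cross (e d) (e (σ d))⟫) {ε ρ : ℝ}
    (hreg : ∀ d, ShapeRegular ε ρ (e d) (e (σ d)))
    (hη : ∀ d, |⟪n, e d⟫| ≤ 3 / 2 * (1 / (16 * ρ ^ 2)) * ‖e d‖) {d d' : ι} (hd : d ≠ d') :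
    IsDelaunay (1 / (2 * ρ ^ 2)) (e d) (e (σ d)) (e (σ.symm d)) ∨
      IsDelaunay (1 / (2 * ρ ^ 2)) (e d') (e (σ d')) (e (σ.symm d')) := by
  classical
  have : Nonempty ι := ⟨d⟩
  have hρ := (hreg d).rho_pos
  have hρ1 := (hreg d).one_le
  have hρ2 : (1 : ℝ) ≤ ρ ^ 2 := one_le_pow₀ hρ1
  have hreg' : ∀ d, ShapeRegular ε ρ (e d) (e (σ.symm d)) := fun d => by
    have := (hreg (σ.symm d)).symm
    rwa [Equiv.apply_symm_apply] at this
  set δ := 1 / (2 * ρ ^ 2) with hδ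
  have hδ0 : 0 < δ := by positivity
  have hδ1 : δ ≤ 1 / 2 := by rw [hδ]; gcongr; linarith
  -- The tilt bound equals 3δ/16, which is below sin(δ/4). With η = δ/4 the four angles at the
  -- vertex lose at most 8η = 2δ.
  have hsin : 3 / 2 * (1 / (16 * ρ ^ 2)) ≤ Real.sin (δ / 4) := by
    have h1 := Real.sin_gt_sub_cube (x := δ / 4) (by positivity)
    have h2 : 3 / 2 * (1 / (16 * ρ ^ 2)) = 3 / 16 * δ := by rw [hδ]; field_simp
    rw [h2]
    have h3 : (δ / 4) ^ 3 ≤ δ / 64 := by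
      have : δ ^ 2 ≤ 1 := by nlinarith
      nlinarith
    linarith
  have hsum := two_pi_sub_le_sum_angle σ e hn h (η := δ / 4) (by positivity)
    (by linarith [Real.pi_gt_three]) fun d => (hη d).trans (by
      rw [mul_comm]; gcongr)
  rw [hcard] at hsum
  by_contra hcon
  rw [not_or] at hcon
  -- Shape regularity already gives the lower bounds on the two angles, so only the bound on their
  -- sum can fail.
  have hbad : ∀ d, ¬ IsDelaunay δ (e d) (e (σ d)) (e (σ.symm d)) →
      Real.pi - δ < oppositeAngle (e d) (e (σ d)) + oppositeAngle (e d) (e (σ.symm d)) := by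
    intro d hd
    by_contra h'
    exact hd ⟨(hreg d).le_oppositeAngle, (hreg' d).le_oppositeAngle, not_lt.1 h'⟩
  -- Reindexing by σ collects, for each d, both opposite angles of the triangle spanned by d and σ
  -- d; together with its angle at the vertex they give π.
  have htot : ∑ d, (oppositeAngle (e d) (e (σ d)) + oppositeAngle (e d) (e (σ.symm d))) +
      ∑ d, InnerProductGeometry.angle (e d) (e (σ d)) = 4 * Real.pi := by
    have h1 : ∑ d, oppositeAngle (e d) (e (σ.symm d)) = ∑ d, oppositeAngle (e (σ d)) (e d) := by
      rw [← Equiv.sum_comp σ]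
      simp
    rw [Finset.sum_add_distrib, h1, ← Finset.sum_add_distrib, ← Finset.sum_add_distrib,
      Finset.sum_congr rfl fun d _ => show _ = Real.pi by
        rw [← triangle_angle_sum (hreg d).cross_pos]; ring]
    simp [hcard]
  have hlow : ∀ d, 2 * δ ≤
      oppositeAngle (e d) (e (σ d)) + oppositeAngle (e d) (e (σ.symm d)) := by
    intro d
    linarith [(hreg d).le_oppositeAngle, (hreg' d).le_oppositeAngle]
  -- Two bad edges and a remainder of at least 2δ for each of the other two would exceed 2π + 2δ,
  -- which is all that the angles at the vertex leave of 4π.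
  have hsplit : 2 * (Real.pi - δ) + 4 * δ <
      ∑ d, (oppositeAngle (e d) (e (σ d)) + oppositeAngle (e d) (e (σ.symm d))) := by
    rw [← Finset.add_sum_erase _ _ (Finset.mem_univ d),
      ← Finset.add_sum_erase _ _ (Finset.mem_erase.2 ⟨hd.symm, Finset.mem_univ d'⟩)]
    have h1 := hbad d hcon.1
    have h2 := hbad d' hcon.2
    have h3 := Finset.card_nsmul_le_sum ((Finset.univ.erase d).erase d')
      (fun d => oppositeAngle (e d) (e (σ d)) + oppositeAngle (e d) (e (σ.symm d))) (2 * δ)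
      fun d _ => hlow d
    rw [Finset.card_erase_of_mem (Finset.mem_erase.2 ⟨hd.symm, Finset.mem_univ d'⟩),
      Finset.card_erase_of_mem (Finset.mem_univ d), Finset.card_univ, hcard] at h3
    norm_num at h3
    linarith
  push_cast at hsum
  linarith

/-! ### Parametrized surface patches -/

/-- A smooth immersed parametrized surface patch `r` with unit normal `ν`. -/
structure IsPatch (U : Set Plane) (r ν : Plane → Space) : Prop where
  isOpen : IsOpen U
  contDiffOn_pos : ContDiffOn ℝ ∞ r U
  contDiffOn_normal : ContDiffOn ℝ ∞ ν U
  injective : ∀ u ∈ U, Function.Injective (fderiv ℝ r u)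
  norm_normal : ∀ u ∈ U, ‖ν u‖ = 1
  inner_normal : ∀ u ∈ U, ∀ w, ⟪ν u, fderiv ℝ r u w⟫ = 0

namespace IsPatch

variable {U : Set Plane} {r ν : Plane → Space} {u : Plane}

lemma contDiffAt_pos (h : IsPatch U r ν) (hu : u ∈ U) : ContDiffAt ℝ ∞ r u :=
  h.contDiffOn_pos.contDiffAt (h.isOpen.mem_nhds hu)

lemma contDiffAt_normal (h : IsPatch U r ν) (hu : u ∈ U) : ContDiffAt ℝ ∞ ν u :=
  h.contDiffOn_normal.contDiffAt (h.isOpen.mem_nhds hu)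

lemma hasFDerivAt_pos (h : IsPatch U r ν) (hu : u ∈ U) : HasFDerivAt r (fderiv ℝ r u) u :=
  ((h.contDiffAt_pos hu).differentiableAt (by simp)).hasFDerivAt

lemma hasFDerivAt_normal (h : IsPatch U r ν) (hu : u ∈ U) : HasFDerivAt ν (fderiv ℝ ν u) u :=
  ((h.contDiffAt_normal hu).differentiableAt (by simp)).hasFDerivAt

lemma inner_fderiv_normal (h : IsPatch U r ν) (hu : u ∈ U) (w : Plane) :
    ⟪ν u, fderiv ℝ ν u w⟫ = 0 := by
  have h1 : HasFDerivAt (fun p => ⟪ν p, ν p⟫) _ u :=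
    (h.hasFDerivAt_normal hu).inner ℝ (h.hasFDerivAt_normal hu)
  have h2 : (fun p => ⟪ν p, ν p⟫) =ᶠ[𝓝 u] fun _ => (1 : ℝ) := by
    filter_upwards [h.isOpen.mem_nhds hu] with p hp
    rw [real_inner_self_eq_norm_sq, h.norm_normal p hp]; norm_num
  have h3 := h1.unique ((hasFDerivAt_const (1 : ℝ) u).congr_of_eventuallyEq h2)
  have h4 := congrArg (fun L : Plane →L[ℝ] ℝ => L w) h3
  simp [fderivInnerCLM_apply] at h4
  have h5 := real_inner_comm (ν u) (fderiv ℝ ν u w)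
  linarith

lemma contDiffAt_fderiv_pos (h : IsPatch U r ν) (hu : u ∈ U) : ContDiffAt ℝ ∞ (fderiv ℝ r) u :=
  (h.contDiffAt_pos hu).fderiv_right (by simp)

lemma contDiffAt_fderiv_normal (h : IsPatch U r ν) (hu : u ∈ U) :
    ContDiffAt ℝ ∞ (fderiv ℝ ν) u :=
  (h.contDiffAt_normal hu).fderiv_right (by simp)

/-- The shape operator is self-adjoint. -/
lemma inner_fderiv_comm (h : IsPatch U r ν) (hu : u ∈ U) (v w : Plane) :
    ⟪fderiv ℝ ν u v, fderiv ℝ r u w⟫ = ⟪fderiv ℝ ν u w, fderiv ℝ r u v⟫ := by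
  -- Differentiating ⟨ν, dr w⟩ = 0 expresses the form through the second derivative of r, which is
  -- symmetric.
  have key : ∀ v w : Plane, ⟪fderiv ℝ ν u v, fderiv ℝ r u w⟫ =
      -⟪ν u, fderiv ℝ (fderiv ℝ r) u v w⟫ := by
    intro v w
    have hd : HasFDerivAt (fun p => fderiv ℝ r p w)
        ((ContinuousLinearMap.apply ℝ Space w).comp (fderiv ℝ (fderiv ℝ r) u)) u :=
      (ContinuousLinearMap.apply ℝ Space w).hasFDerivAt.comp u
        ((h.contDiffAt_fderiv_pos hu).differentiableAt (by simp)).hasFDerivAt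
    have h1 : HasFDerivAt (fun p => ⟪ν p, fderiv ℝ r p w⟫) _ u :=
      (h.hasFDerivAt_normal hu).inner ℝ hd
    have h2 : (fun p => ⟪ν p, fderiv ℝ r p w⟫) =ᶠ[𝓝 u] fun _ => (0 : ℝ) := by
      filter_upwards [h.isOpen.mem_nhds hu] with p hp using h.inner_normal p hp w
    have h3 := h1.unique ((hasFDerivAt_const (0 : ℝ) u).congr_of_eventuallyEq h2)
    have h4 := congrArg (fun L : Plane →L[ℝ] ℝ => L v) h3
    simp [fderivInnerCLM_apply] at h4
    linarith
  rw [key, key]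
  have hs : IsSymmSndFDerivAt ℝ r u := by
    refine (h.contDiffAt_pos hu).isSymmSndFDerivAt ?_
    simp only [minSmoothness_of_isRCLikeNormedField]
    exact WithTop.coe_le_coe.2 le_top
  rw [hs.eq v w]

/-- Near each point the distance to the tangent plane is at most quadratic. -/
lemma exists_quadratic_bound (h : IsPatch U r ν) (hu : u ∈ U) {K : ℝ} (hK : 0 ≤ K)
    (hb : ∀ p ∈ U, ∀ w, ‖fderiv ℝ ν p w‖ ≤ K * ‖fderiv ℝ r p w‖) :
    ∃ V ⊆ U, IsOpen V ∧ u ∈ V ∧ ∀ p ∈ V, ∀ q ∈ V,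
      |⟪ν p, r q - r p⟫| ≤ 11 / 10 * K * ‖r q - r p‖ ^ 2 ∧ (r p = r q → p = q) := by
  set L := fderiv ℝ r u with hL
  obtain ⟨c, hc, hcL⟩ : ∃ c > 0, ∀ w, c * ‖w‖ ≤ ‖L w‖ := by
    obtain ⟨k, hk, ha⟩ := L.toLinearMap.exists_antilipschitzWith
      (LinearMap.ker_eq_bot.2 (h.injective u hu))
    refine ⟨(k : ℝ)⁻¹, by positivity, fun w => ?_⟩
    have := ha.le_mul_dist w 0
    simp only [dist_zero_right, map_zero] at this
    rw [inv_mul_le_iff₀ (by exact_mod_cast hk)]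
    exact this
  have hcont : ContinuousAt (fderiv ℝ r) u := (h.contDiffAt_fderiv_pos hu).continuousAt
  obtain ⟨ρ, hρ, hball⟩ := Metric.mem_nhds_iff.1
    (Filter.inter_mem (h.isOpen.mem_nhds hu)
      (hcont.preimage_mem_nhds (Metric.ball_mem_nhds L (show 0 < c / 50 by positivity))))
  have hU : ∀ p ∈ Metric.ball u ρ, p ∈ U := fun p hp => (hball hp).1
  -- On the ball the differential stays within two percent of L. The final factor is then (51/49)² <
  -- 11/10.
  have hd : ∀ p ∈ Metric.ball u ρ, ∀ w, ‖fderiv ℝ r p w - L w‖ ≤ 1 / 50 * ‖L w‖ := by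
    intro p hp w
    have h1 : ‖fderiv ℝ r p - L‖ ≤ c / 50 := by
      have := (hball hp).2
      rw [mem_preimage, Metric.mem_ball, dist_eq_norm] at this
      exact this.le
    calc ‖fderiv ℝ r p w - L w‖ = ‖(fderiv ℝ r p - L) w‖ := rfl
      _ ≤ c / 50 * ‖w‖ := (ContinuousLinearMap.le_opNorm _ _).trans (by gcongr)
      _ ≤ _ := by linarith [hcL w]
  refine ⟨Metric.ball u ρ, hU, Metric.isOpen_ball, Metric.mem_ball_self hρ, fun p hp q hq => ?_⟩
  set w := q - p with hw
  set ℓ := ‖L w‖ with hℓ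
  have hℓ0 : 0 ≤ ℓ := norm_nonneg _
  have hseg : ∀ t ∈ Icc (0 : ℝ) 1, p + t • w ∈ Metric.ball u ρ := by
    intro t ht
    have := (convex_ball u ρ).add_smul_sub_mem hp hq ht
    exact this
  have hline : ∀ t : ℝ, HasDerivAt (fun t : ℝ => p + t • w) w t := by
    intro t
    simpa using ((hasDerivAt_id t).smul_const w).const_add p
  have hr : ∀ t ∈ Icc (0 : ℝ) 1, HasDerivAt (fun t : ℝ => r (p + t • w))
      (fderiv ℝ r (p + t • w) w) t := fun t ht =>
    (h.hasFDerivAt_pos (hU _ (hseg t ht))).comp_hasDerivAt t (hline t)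
  have hν : ∀ t ∈ Icc (0 : ℝ) 1, HasDerivAt (fun t : ℝ => ν (p + t • w))
      (fderiv ℝ ν (p + t • w) w) t := fun t ht =>
    (h.hasFDerivAt_normal (hU _ (hseg t ht))).comp_hasDerivAt t (hline t)
  have hup : ∀ t ∈ Icc (0 : ℝ) 1, ‖fderiv ℝ r (p + t • w) w‖ ≤ 51 / 50 * ℓ := by
    intro t ht
    have h1 := hd _ (hseg t ht) w
    have h2 := norm_le_norm_add_norm_sub' (fderiv ℝ r (p + t • w) w) (L w)
    linarith
  have h1q : p + (1 : ℝ) • w = q := by rw [hw]; simp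
  have hlow : 49 / 50 * ℓ ≤ ‖r q - r p‖ := by
    have h1 : ∀ t ∈ Icc (0 : ℝ) 1, HasDerivWithinAt (fun t : ℝ => r (p + t • w) - t • L w)
        (fderiv ℝ r (p + t • w) w - L w) (Icc 0 1) t := fun t ht => by
      have := (hr t ht).sub ((hasDerivAt_id t).smul_const (L w))
      simp only [one_smul] at this
      exact this.hasDerivWithinAt
    have h2 := norm_image_sub_le_of_norm_deriv_le_segment_01' h1
      (C := 1 / 50 * ℓ) fun t ht => hd _ (hseg t (Ico_subset_Icc_self ht)) w
    rw [h1q] at h2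
    simp only [zero_smul, add_zero, one_smul, sub_zero] at h2
    have h3 : ‖L w‖ ≤ ‖r q - r p‖ + ‖r q - L w - r p‖ := by
      have : L w = (r q - r p) - (r q - L w - r p) := by abel
      calc ‖L w‖ = ‖(r q - r p) - (r q - L w - r p)‖ := by rw [← this]
        _ ≤ _ := norm_sub_le _ _
    linarith
  constructor
  · have hνd : ∀ t ∈ Icc (0 : ℝ) 1, ‖ν (p + t • w) - ν p‖ ≤ K * (51 / 50 * ℓ) := by
      intro t ht
      have h2 := norm_image_sub_le_of_norm_deriv_le_segment'
        (f := fun t : ℝ => ν (p + t • w)) (a := 0) (b := 1) (C := K * (51 / 50 * ℓ))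
        (fun s hs => (hν s hs).hasDerivWithinAt)
        (fun s hs => (hb _ (hU _ (hseg s (Ico_subset_Icc_self hs))) w).trans
          (mul_le_mul_of_nonneg_left (hup s (Ico_subset_Icc_self hs)) hK)) t ht
      simp only [zero_smul, add_zero, sub_zero] at h2
      refine h2.trans (mul_le_of_le_one_right (by positivity) ht.2)
    have h1 : ∀ t ∈ Icc (0 : ℝ) 1, HasDerivWithinAt (fun t : ℝ => ⟪ν p, r (p + t • w)⟫)
        ⟪ν p, fderiv ℝ r (p + t • w) w⟫ (Icc 0 1) t := fun t ht => by
      have := (hasDerivAt_const t (ν p)).inner ℝ (hr t ht)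
      simp only [inner_zero_left, add_zero] at this
      exact this.hasDerivWithinAt
    have h2 := norm_image_sub_le_of_norm_deriv_le_segment_01' h1
      (C := K * (51 / 50 * ℓ) * (51 / 50 * ℓ)) fun t ht => by
        have ht' := Ico_subset_Icc_self ht
        -- The normal at the moving point is orthogonal to the velocity, so only the variation of
        -- the normal contributes. This makes the estimate quadratic.
        have h3 : ⟪ν p, fderiv ℝ r (p + t • w) w⟫ =
            -⟪ν (p + t • w) - ν p, fderiv ℝ r (p + t • w) w⟫ := by
          rw [inner_sub_left, h.inner_normal _ (hU _ (hseg t ht'))]; ring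
        rw [h3, norm_neg]
        refine (norm_inner_le_norm _ _).trans ?_
        exact mul_le_mul (hνd t ht') (hup t ht') (norm_nonneg _) (by positivity)
    simp only [h1q, zero_smul, add_zero, Real.norm_eq_abs] at h2
    rw [inner_sub_right]
    refine h2.trans ?_
    have h3 : ℓ ≤ 50 / 49 * ‖r q - r p‖ := by linarith
    have h4 : ℓ ^ 2 ≤ (50 / 49 * ‖r q - r p‖) ^ 2 := pow_le_pow_left₀ hℓ0 h3 2
    have h5 : K * ℓ ^ 2 ≤ K * (50 / 49 * ‖r q - r p‖) ^ 2 := by gcongr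
    have h6 : 0 ≤ K * ‖r q - r p‖ ^ 2 := by positivity
    nlinarith
  · intro heq
    rw [heq, sub_self, norm_zero] at hlow
    have h1 := hcL w
    have h2 : ‖w‖ = 0 := by
      have := norm_nonneg w
      nlinarith
    rw [norm_eq_zero, hw, sub_eq_zero] at h2
    exact h2.symm

end IsPatch

/-- A dimension count: the range of L is two-dimensional and lies in the two-dimensional orthogonal
complement of n. -/
lemma exists_eq_of_inner_eq_zero {n : Space} (hn : ‖n‖ = 1) {L : Plane →ₗ[ℝ] Space}
    (hL : Function.Injective L) (h : ∀ v, ⟪n, L v⟫ = 0) {z : Space} (hz : ⟪n, z⟫ = 0) :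
    ∃ v, L v = z := by
  have hle : LinearMap.range L ≤ (ℝ ∙ n)ᗮ := by
    rintro _ ⟨v, rfl⟩
    rw [Submodule.mem_orthogonal_singleton_iff_inner_right]
    exact h v
  have : Fact (Module.finrank ℝ Space = 2 + 1) := ⟨by simp⟩
  have hfin : Module.finrank ℝ (LinearMap.range L) = Module.finrank ℝ (ℝ ∙ n)ᗮ := by
    rw [LinearMap.finrank_range_of_inj hL,
      Submodule.finrank_orthogonal_span_singleton (n := 2) (by rw [← norm_ne_zero_iff, hn]; norm_num)]
    simp
  have heq := Submodule.eq_of_le_of_finrank_eq hle hfin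
  have : z ∈ LinearMap.range L := by
    rw [heq, Submodule.mem_orthogonal_singleton_iff_inner_right]; exact hz
  exact this

/-! ### Charts of an immersed surface -/

section Chart

variable {M : Type u} [TopologicalSpace M] [ChartedSpace Plane M]

/-- The differential at `x` of the chart at `x₀`. -/
noncomputable def chartDiff (x₀ x : M) : TangentSpace (𝓡 2) x →L[ℝ] Plane :=
  mfderiv (𝓡 2) 𝓘(ℝ, Plane) (extChartAt (𝓡 2) x₀) x

lemma contDiffOn_comp_extChartAt_symm [IsManifold (𝓡 2) ∞ M] {F : M → Space} (hF : ContMDiff (𝓡 2) 𝓘(ℝ, Space) ∞ F)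
    (x₀ : M) :
    ContDiffOn ℝ ∞ (F ∘ (extChartAt (𝓡 2) x₀).symm) (extChartAt (𝓡 2) x₀).target :=
  contMDiffOn_iff_contDiffOn.1
    (hF.comp_contMDiffOn (contMDiffOn_extChartAt_symm x₀))

lemma mfderiv_eq_fderiv_chart [IsManifold (𝓡 2) ∞ M] {F : M → Space} (hF : ContMDiff (𝓡 2) 𝓘(ℝ, Space) ∞ F)
    {x₀ x : M} (hx : x ∈ (extChartAt (𝓡 2) x₀).source) (v : TangentSpace (𝓡 2) x) :
    mfderiv (𝓡 2) 𝓘(ℝ, Space) F x v =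
      fderiv ℝ (F ∘ (extChartAt (𝓡 2) x₀).symm) (extChartAt (𝓡 2) x₀ x)
        (mfderiv (𝓡 2) 𝓘(ℝ, Plane) (extChartAt (𝓡 2) x₀) x v) := by
  set φ := extChartAt (𝓡 2) x₀ with hφ
  have h1 : F =ᶠ[𝓝 x] (F ∘ φ.symm) ∘ φ := by
    filter_upwards [(isOpen_extChartAt_source x₀).mem_nhds hx] with y hy
    simp only [Function.comp, hφ]
    rw [(extChartAt (𝓡 2) x₀).left_inv hy]
  have h2 : MDifferentiableAt 𝓘(ℝ, Plane) 𝓘(ℝ, Space) (F ∘ φ.symm) (φ x) := by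
    refine DifferentiableAt.mdifferentiableAt ?_
    refine ((contDiffOn_comp_extChartAt_symm hF x₀).contDiffAt ?_).differentiableAt (by simp)
    exact (isOpen_extChartAt_target x₀).mem_nhds (φ.map_source hx)
  have h3 : MDifferentiableAt (𝓡 2) 𝓘(ℝ, Plane) φ x :=
    mdifferentiableAt_extChartAt (by rwa [extChartAt_source] at hx)
  rw [h1.mfderiv_eq, mfderiv_comp x h2 h3, mfderiv_eq_fderiv]
  rfl

namespace ImmersedSurface

variable (S : ImmersedSurface M)

/-- The immersion, in the coordinates of the chart at `x₀`. -/
noncomputable def chartPos (x₀ : M) : Plane → Space := S.pos ∘ (extChartAt (𝓡 2) x₀).symm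

/-- The normal, in the coordinates of the chart at `x₀`. -/
noncomputable def chartNormal (x₀ : M) : Plane → Space := S.normal ∘ (extChartAt (𝓡 2) x₀).symm

lemma exists_dpos_eq (x : M) {z : Space} (hz : ⟪S.normal x, z⟫ = 0) :
    ∃ v : TangentSpace (𝓡 2) x, S.dpos x v = z :=
  exists_eq_of_inner_eq_zero (S.norm_normal x) (L := (S.dpos x).toLinearMap) (S.immersion x)
    (S.inner_normal x) hz

lemma IsCurvatureBound.nonneg {S : ImmersedSurface M} {K : ℝ} (h : S.IsCurvatureBound K) : 0 ≤ K := by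
  obtain ⟨x, v, w, -, -, rfl⟩ := h.1
  exact norm_nonneg _

variable [IsManifold (𝓡 2) ∞ M]

lemma dpos_eq {x₀ x : M} (hx : x ∈ (extChartAt (𝓡 2) x₀).source) (v : TangentSpace (𝓡 2) x) :
    S.dpos x v = fderiv ℝ (S.chartPos x₀) (extChartAt (𝓡 2) x₀ x)
      (chartDiff x₀ x v) :=
  mfderiv_eq_fderiv_chart S.contMDiff_pos hx v

lemma dnormal_eq {x₀ x : M} (hx : x ∈ (extChartAt (𝓡 2) x₀).source) (v : TangentSpace (𝓡 2) x) :
    S.dnormal x v = fderiv ℝ (S.chartNormal x₀) (extChartAt (𝓡 2) x₀ x)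
      (chartDiff x₀ x v) :=
  mfderiv_eq_fderiv_chart S.contMDiff_normal hx v

lemma exists_chartDiff_eq {x₀ x : M} (hx : x ∈ (extChartAt (𝓡 2) x₀).source)
    (w : Plane) : ∃ v : TangentSpace (𝓡 2) x,
      chartDiff x₀ x v = w := by
  obtain ⟨e, he⟩ := isInvertible_mfderiv_extChartAt (I := 𝓡 2) hx
  exact ⟨e.symm w, (DFunLike.congr_fun he.symm (e.symm w)).trans (e.apply_symm_apply w)⟩

lemma isPatch (x₀ : M) :
    IsPatch (extChartAt (𝓡 2) x₀).target (S.chartPos x₀) (S.chartNormal x₀) where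
  isOpen := isOpen_extChartAt_target x₀
  contDiffOn_pos := contDiffOn_comp_extChartAt_symm S.contMDiff_pos x₀
  contDiffOn_normal := contDiffOn_comp_extChartAt_symm S.contMDiff_normal x₀
  injective u hu := by
    have hx := (extChartAt (𝓡 2) x₀).map_target hu
    have hux := (extChartAt (𝓡 2) x₀).right_inv hu
    intro w w' hw
    obtain ⟨v, rfl⟩ := exists_chartDiff_eq hx w
    obtain ⟨v', rfl⟩ := exists_chartDiff_eq hx w'
    have h1 := S.dpos_eq hx v
    have h2 := S.dpos_eq hx v'
    rw [hux] at h1 h2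
    rw [S.immersion _ (h1.trans (hw.trans h2.symm))]
  norm_normal u hu := S.norm_normal _
  inner_normal u hu w := by
    have hx := (extChartAt (𝓡 2) x₀).map_target hu
    have hux := (extChartAt (𝓡 2) x₀).right_inv hu
    obtain ⟨v, rfl⟩ := exists_chartDiff_eq hx w
    have h1 := S.dpos_eq hx v
    rw [hux] at h1
    rw [← h1]
    exact S.inner_normal _ v

lemma inner_dnormal (x : M) (v : TangentSpace (𝓡 2) x) : ⟪S.normal x, S.dnormal x v⟫ = 0 := by
  have hx := mem_extChartAt_source (I := 𝓡 2) x
  rw [S.dnormal_eq hx]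
  have := (S.isPatch x).inner_fderiv_normal ((extChartAt (𝓡 2) x).map_source hx)
    (chartDiff x x v)
  rwa [chartNormal, Function.comp, (extChartAt (𝓡 2) x).left_inv hx] at this

lemma inner_dnormal_comm (x : M) (v w : TangentSpace (𝓡 2) x) :
    ⟪S.dnormal x v, S.dpos x w⟫ = ⟪S.dnormal x w, S.dpos x v⟫ := by
  have hx := mem_extChartAt_source (I := 𝓡 2) x
  rw [S.dnormal_eq hx, S.dnormal_eq hx, S.dpos_eq hx, S.dpos_eq hx]
  exact (S.isPatch x).inner_fderiv_comm ((extChartAt (𝓡 2) x).map_source hx) _ _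

lemma exists_isShape (x : M) (v : TangentSpace (𝓡 2) x) : ∃ w, S.IsShape x v w :=
  S.exists_dpos_eq x (by rw [inner_neg_right, S.inner_dnormal, neg_zero])

variable {S}

/-- The bound K refers to unit vectors with an image under the shape operator. Such an image always
exists because the differential of the normal is tangential; the rest is homogeneity. -/
lemma IsCurvatureBound.norm_dnormal_le {K : ℝ} (h : S.IsCurvatureBound K) (x : M)
    (v : TangentSpace (𝓡 2) x) : ‖S.dnormal x v‖ ≤ K * ‖S.dpos x v‖ := by
  obtain ⟨w, hw⟩ := S.exists_isShape x v
  rcases eq_or_ne (S.dpos x v) 0 with h0 | h0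
  · have : v = 0 := S.immersion x (by
      rw [map_zero]; exact h0)
    rw [this, map_zero, map_zero]; simp
  · have hc : ‖S.dpos x v‖ ≠ 0 := norm_ne_zero_iff.2 h0
    have h1 := h.2 ⟨x, ‖S.dpos x v‖⁻¹ • v, ‖S.dpos x v‖⁻¹ • w, by
      rw [map_smul, norm_smul, norm_inv, norm_norm, inv_mul_cancel₀ hc], by
      rw [IsShape, map_smul, map_smul, hw, smul_neg], rfl⟩
    rw [map_smul, hw, norm_smul, norm_inv, norm_norm, norm_neg,
      inv_mul_le_iff₀ (by positivity)] at h1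
    linarith

lemma IsCurvatureBound.norm_fderiv_le {K : ℝ} (h : S.IsCurvatureBound K) {x₀ : M} {u : Plane}
    (hu : u ∈ (extChartAt (𝓡 2) x₀).target) (w : Plane) :
    ‖fderiv ℝ (S.chartNormal x₀) u w‖ ≤ K * ‖fderiv ℝ (S.chartPos x₀) u w‖ := by
  have hx := (extChartAt (𝓡 2) x₀).map_target hu
  have hux := (extChartAt (𝓡 2) x₀).right_inv hu
  obtain ⟨v, rfl⟩ := exists_chartDiff_eq hx w
  have h1 := S.dpos_eq hx v
  have h2 := S.dnormal_eq hx v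
  rw [hux] at h1 h2
  rw [← h1, ← h2]
  exact h.norm_dnormal_le _ v

end ImmersedSurface

end Chart

/-! ### Discrete geodesics -/

/-- The increments `v i` of a discrete geodesic with small energy: if each increment is almost
orthogonal to the unit normals at both of its ends, and consecutive increments differ by a
multiple of the normal, then the total displacement is almost orthogonal to the first normal. -/
lemma abs_inner_sum_le_of_discrete_geodesic {v n : ℕ → Space} {N : ℕ} (hN : 0 < N) {K L : ℝ}
    (hK : 0 ≤ K) (hL : 0 ≤ L) (hKL : K * L ≤ 11 / 160) (hn : ∀ i, ‖n i‖ = 1)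
    (h₀ : ∀ i < N, |⟪n i, v i⟫| ≤ K * ‖v i‖ ^ 2)
    (h₁ : ∀ i < N, |⟪n (i + 1), v i⟫| ≤ K * ‖v i‖ ^ 2)
    (h₂ : ∀ i, i + 1 < N → ∃ c : ℝ, v (i + 1) - v i = c • n (i + 1))
    (h₃ : ∑ i ∈ Finset.range N, ‖v i‖ ^ 2 ≤ L ^ 2 / N) :
    |⟪n 0, ∑ i ∈ Finset.range N, v i⟫| ≤ 15 / 11 * K * L * ‖∑ i ∈ Finset.range N, v i‖ := by
  have hN' : (0 : ℝ) < N := by exact_mod_cast hN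
  -- The multiplier is the difference of the normal components of two consecutive increments, each
  -- quadratically small.
  have hstep : ∀ i, i + 1 < N → ∃ c : ℝ, v (i + 1) = v i + c • n (i + 1) ∧
      |c| ≤ K * ‖v (i + 1)‖ ^ 2 + K * ‖v i‖ ^ 2 := by
    intro i hi
    obtain ⟨c, hc⟩ := h₂ i hi
    refine ⟨c, by rw [← hc]; abel, ?_⟩
    have : c = ⟪n (i + 1), v (i + 1)⟫ - ⟪n (i + 1), v i⟫ := by
      rw [← inner_sub_right, hc, inner_smul_right, real_inner_self_eq_norm_sq, hn]; ring
    rw [this]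
    exact (abs_sub _ _).trans (add_le_add (h₀ _ hi) (h₁ _ (by omega)))
  have hdist : ∀ i, i + 1 < N → dist (v i) (v (i + 1)) ≤
      K * ‖v (i + 1)‖ ^ 2 + K * ‖v i‖ ^ 2 := by
    intro i hi
    obtain ⟨c, hc, hc'⟩ := hstep i hi
    rw [hc, dist_self_add_right, norm_smul, hn, mul_one, Real.norm_eq_abs, ← hc]
    exact hc'
  obtain ⟨i₁, hi₁, hmax⟩ := Finset.exists_max_image (Finset.range N) (fun i => ‖v i‖)
    ⟨0, Finset.mem_range.2 hN⟩
  rw [Finset.mem_range] at hi₁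
  set V := ‖v i₁‖ with hV
  have hV0 : 0 ≤ V := norm_nonneg _
  have hle : ∀ i < N, ‖v i‖ ≤ V := fun i hi => hmax i (Finset.mem_range.2 hi)
  have hle2 : ∀ i < N, ‖v i‖ ^ 2 ≤ V ^ 2 := fun i hi =>
    pow_le_pow_left₀ (norm_nonneg _) (hle i hi) 2
  -- an increment of at most average length
  obtain ⟨i₀, hi₀, hmin⟩ : ∃ i < N, ‖v i‖ ≤ L / N := by
    obtain ⟨i, hi, h⟩ := Finset.exists_le_of_sum_le (s := Finset.range N)
      (f := fun i => ‖v i‖ ^ 2) (g := fun _ => (L / N) ^ 2) ⟨0, Finset.mem_range.2 hN⟩ (by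
        rw [Finset.sum_const, Finset.card_range, nsmul_eq_mul]
        refine h₃.trans (le_of_eq ?_)
        field_simp)
    exact ⟨i, Finset.mem_range.1 hi, le_of_sq_le_sq h (by positivity)⟩
  -- The increments vary in total by at most 2K times the energy.
  have hvar : ∀ i j, i ≤ j → j < N → dist (v i) (v j) ≤ 2 * K * (L ^ 2 / N) := by
    intro i j hij hj
    have h1 := dist_le_Ico_sum_of_dist_le (f := v) hij
      (d := fun k => K * ‖v (k + 1)‖ ^ 2 + K * ‖v k‖ ^ 2) fun {k} _ hk => hdist k (by omega)
    refine h1.trans ?_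
    have h2 : ∑ k ∈ Finset.Ico i j, ‖v k‖ ^ 2 ≤ ∑ k ∈ Finset.range N, ‖v k‖ ^ 2 := by
      refine Finset.sum_le_sum_of_subset_of_nonneg ?_ fun _ _ _ => by positivity
      intro k hk
      rw [Finset.mem_Ico] at hk; rw [Finset.mem_range]; omega
    have h3 : ∑ k ∈ Finset.Ico i j, ‖v (k + 1)‖ ^ 2 ≤ ∑ k ∈ Finset.range N, ‖v k‖ ^ 2 := by
      rw [Finset.sum_Ico_add' (fun k => ‖v k‖ ^ 2) i j 1]
      refine Finset.sum_le_sum_of_subset_of_nonneg ?_ fun _ _ _ => by positivity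
      intro k hk
      rw [Finset.mem_Ico] at hk; rw [Finset.mem_range]; omega
    rw [Finset.sum_add_distrib, ← Finset.mul_sum, ← Finset.mul_sum]
    have h4 := mul_le_mul_of_nonneg_left (h2.trans h₃) hK
    have h5 := mul_le_mul_of_nonneg_left (h3.trans h₃) hK
    linarith
  -- Comparing the longest increment with one of at most average length bounds it independently of
  -- the length of the chord.
  have hVN : N * V ≤ L * (1 + 2 * K * L) := by
    have h1 : dist (v i₁) (v i₀) ≤ 2 * K * (L ^ 2 / N) := by
      rcases le_total i₀ i₁ with h | h
      · rw [dist_comm]; exact hvar _ _ h hi₁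
      · exact hvar _ _ h hi₀
    have h2 : V ≤ ‖v i₀‖ + dist (v i₁) (v i₀) := by
      rw [dist_eq_norm, hV]
      exact norm_le_norm_add_norm_sub' _ _
    have h3 : V ≤ L / N + 2 * K * (L ^ 2 / N) := by linarith
    calc N * V ≤ N * (L / N + 2 * K * (L ^ 2 / N)) := by gcongr
      _ = _ := by field_simp
  -- all increments are close to the longest one
  have hclose : ∀ i j, i ≤ j → j < N → dist (v i) (v j) ≤ N * (2 * K * V ^ 2) := by
    intro i j hij hj
    have h1 := dist_le_Ico_sum_of_dist_le (f := v) hij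
      (d := fun _ => 2 * K * V ^ 2) fun {k} _ hk => (hdist k (by omega)).trans (by
        have h4 := mul_le_mul_of_nonneg_left (hle2 (k + 1) (by omega)) hK
        have h5 := mul_le_mul_of_nonneg_left (hle2 k (by omega)) hK
        linarith)
    refine h1.trans ?_
    rw [Finset.sum_const, Nat.card_Ico, nsmul_eq_mul]
    gcongr
    exact_mod_cast (by omega : j - i ≤ N)
  set e := ∑ i ∈ Finset.range N, v i with he
  set a := N * V with ha
  have ha0 : 0 ≤ a := by positivity
  -- The chord is compared with N copies of the longest increment, so it is nearly as long as a.
  have hlow : a - 2 * K * a ^ 2 ≤ ‖e‖ := by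
    have h1 : ‖(N : ℝ) • v i₁ - e‖ ≤ N * (N * (2 * K * V ^ 2)) := by
      have : (N : ℝ) • v i₁ - e = ∑ i ∈ Finset.range N, (v i₁ - v i) := by
        rw [Finset.sum_sub_distrib, Finset.sum_const, Finset.card_range, ← he,
          Nat.cast_smul_eq_nsmul]
      rw [this]
      refine (norm_sum_le_of_le _ (n := fun _ => N * (2 * K * V ^ 2)) fun i hi => ?_).trans ?_
      · rw [← dist_eq_norm]
        rw [Finset.mem_range] at hi
        rcases le_total i i₁ with h | h
        · rw [dist_comm]; exact hclose _ _ h hi₁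
        · exact hclose _ _ h hi
      · rw [Finset.sum_const, Finset.card_range, nsmul_eq_mul]
    have h2 : ‖(N : ℝ) • v i₁‖ ≤ ‖e‖ + ‖(N : ℝ) • v i₁ - e‖ := norm_le_norm_add_norm_sub' _ _
    rw [norm_smul, Real.norm_natCast, ← hV, ← ha] at h2
    have h3 : (N : ℝ) * (N * (2 * K * V ^ 2)) = 2 * K * a ^ 2 := by rw [ha]; ring
    linarith
  -- Each step adds at most 2KV² to the component along the first normal; the odd numbers then sum
  -- to N², giving K a² in total.
  have hinner : ∀ j < N, |⟪n 0, v j⟫| ≤ K * V ^ 2 * (2 * j + 1) := by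
    intro j
    induction j with
    | zero =>
      intro h
      refine (h₀ 0 h).trans ?_
      have := mul_le_mul_of_nonneg_left (hle2 0 h) hK
      simpa using this
    | succ j ih =>
      intro h
      obtain ⟨c, hc, hc'⟩ := hstep j h
      have h1 := ih (by omega)
      have h4 := mul_le_mul_of_nonneg_left (hle2 (j + 1) h) hK
      have h5 := mul_le_mul_of_nonneg_left (hle2 j (by omega)) hK
      have h6 : |c * ⟪n 0, n (j + 1)⟫| ≤ 2 * K * V ^ 2 := by
        rw [abs_mul]
        have h7 : |⟪n 0, n (j + 1)⟫| ≤ 1 := by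
          have := abs_real_inner_le_norm (n 0) (n (j + 1))
          rwa [hn, hn, one_mul] at this
        calc |c| * |⟪n 0, n (j + 1)⟫| ≤ |c| * 1 := by gcongr
          _ ≤ _ := by linarith
      rw [hc, inner_add_right, inner_smul_right]
      refine (abs_add_le _ _).trans ?_
      push_cast
      linarith
  have hup : |⟪n 0, e⟫| ≤ K * a ^ 2 := by
    rw [he, inner_sum]
    refine (Finset.abs_sum_le_sum_abs _ _).trans ((Finset.sum_le_sum fun j hj =>
      hinner j (Finset.mem_range.1 hj)).trans (le_of_eq ?_))
    have hodd : ∀ m : ℕ, ∑ j ∈ Finset.range m, (2 * (j : ℝ) + 1) = m ^ 2 := by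
      intro m
      induction m with
      | zero => simp
      | succ m ih => rw [Finset.sum_range_succ, ih]; push_cast; ring
    rw [← Finset.mul_sum, hodd, ha]; ring
  -- Here 91/80 = 1 + 2 · 11/160. The factor 15/11 below leaves room for the loss 1 - 2Ka in the
  -- length of the chord.
  have hKa : K * a ≤ K * L * (91 / 80) := by
    have h1 : K * a ≤ K * (L * (1 + 2 * K * L)) := by gcongr
    have h2 : 0 ≤ K * L := by positivity
    nlinarith
  have h1 : K * a ^ 2 ≤ 15 / 11 * (K * L) * (a - 2 * K * a ^ 2) := by
    have h2 : 0 ≤ K * L := by positivity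
    have h3 : 0 ≤ K * a := by positivity
    have h4 : K * a ≤ 15 / 11 * (K * L) * (1 - 2 * (K * a)) := by nlinarith
    have h5 := mul_le_mul_of_nonneg_right h4 ha0
    linarith
  have h2 : 15 / 11 * (K * L) * (a - 2 * K * a ^ 2) ≤ 15 / 11 * (K * L) * ‖e‖ := by gcongr
  linarith

/-! ### Equidistant points on a curve -/

section Curve

variable {c c' : ℝ → Space}

lemma intervalIntegrable_of_continuousOn_Icc {f : ℝ → ℝ} (hf : ContinuousOn f (Icc 0 1)) {s t : ℝ}
    (hs : s ∈ Icc (0 : ℝ) 1) (ht : t ∈ Icc (0 : ℝ) 1) : IntervalIntegrable f volume s t :=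
  (hf.mono ((convex_Icc (0 : ℝ) 1).ordConnected.uIcc_subset hs ht)).intervalIntegrable

lemma norm_sub_le_integral_norm_deriv
    (hc : ∀ t ∈ Icc (0 : ℝ) 1, HasDerivWithinAt c (c' t) (Icc 0 1) t)
    (hc' : ContinuousOn c' (Icc 0 1)) {s t : ℝ} (hs : 0 ≤ s) (hst : s ≤ t) (ht : t ≤ 1) :
    ‖c t - c s‖ ≤ ∫ x in s..t, ‖c' x‖ := by
  have hsub : Icc s t ⊆ Icc 0 1 := Icc_subset_Icc hs ht
  have h1 : ∫ x in s..t, c' x = c t - c s := by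
    refine intervalIntegral.integral_eq_sub_of_hasDeriv_right ?_ ?_ ?_
    · rw [uIcc_of_le hst]
      exact fun x hx => ((hc x (hsub hx)).continuousWithinAt).mono hsub
    · intro x hx
      rw [min_eq_left hst, max_eq_right hst] at hx
      have hx' : x ∈ Icc (0 : ℝ) 1 := hsub (Ioo_subset_Icc_self hx)
      refine (hc x hx').mono_of_mem_nhdsWithin ?_
      exact mem_nhdsWithin_of_mem_nhds (Icc_mem_nhds (by linarith [hx.1]) (by linarith [hx.2]))
    · refine ContinuousOn.intervalIntegrable ?_
      rw [uIcc_of_le hst]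
      exact hc'.mono hsub
  rw [← h1]
  exact intervalIntegral.norm_integral_le_integral_norm hst

/-- Arc length is continuous, so it takes all multiples of L/N. The constant κ is the minimal speed
and does not depend on N: equal steps in arc length are therefore uniformly small steps in the
parameter. -/
lemma exists_equidistant_points
    (hc : ∀ t ∈ Icc (0 : ℝ) 1, HasDerivWithinAt c (c' t) (Icc 0 1) t)
    (hc' : ContinuousOn c' (Icc 0 1)) (hne : ∀ t ∈ Icc (0 : ℝ) 1, c' t ≠ 0) :
    ∃ κ > 0, ∀ N : ℕ, 0 < N → ∃ t : ℕ → ℝ, t 0 = 0 ∧ t N = 1 ∧ (∀ i, t i ∈ Icc (0 : ℝ) 1) ∧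
      ∀ i < N, κ * |t (i + 1) - t i| ≤ (∫ x in (0 : ℝ)..1, ‖c' x‖) / N ∧
        ‖c (t (i + 1)) - c (t i)‖ ≤ (∫ x in (0 : ℝ)..1, ‖c' x‖) / N := by
  have hnorm : ContinuousOn (fun t => ‖c' t‖) (Icc 0 1) := hc'.norm
  have h01 : (0 : ℝ) ∈ Icc (0 : ℝ) 1 := ⟨le_rfl, zero_le_one⟩
  have h11 : (1 : ℝ) ∈ Icc (0 : ℝ) 1 := ⟨zero_le_one, le_rfl⟩
  obtain ⟨t₀, ht₀, hmin⟩ := isCompact_Icc.exists_isMinOn ⟨0, h01⟩ hnorm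
  set κ := ‖c' t₀‖ with hκ
  have hκ0 : 0 < κ := norm_pos_iff.2 (hne t₀ ht₀)
  refine ⟨κ, hκ0, fun N hN => ?_⟩
  have hN' : (0 : ℝ) < N := by exact_mod_cast hN
  set ℓ : ℝ → ℝ := fun t => ∫ x in (0 : ℝ)..t, ‖c' x‖ with hℓ
  set L := ∫ x in (0 : ℝ)..1, ‖c' x‖ with hL
  have hL0 : 0 ≤ L := intervalIntegral.integral_nonneg zero_le_one fun _ _ => norm_nonneg _
  have hdiff : ∀ s ∈ Icc (0 : ℝ) 1, ∀ t ∈ Icc (0 : ℝ) 1,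
      ℓ t - ℓ s = ∫ x in s..t, ‖c' x‖ := fun s hs t ht =>
    intervalIntegral.integral_interval_sub_left
      (intervalIntegrable_of_continuousOn_Icc hnorm h01 ht)
      (intervalIntegrable_of_continuousOn_Icc hnorm h01 hs)
  have hlow : ∀ s ∈ Icc (0 : ℝ) 1, ∀ t ∈ Icc (0 : ℝ) 1, s ≤ t → κ * (t - s) ≤ ℓ t - ℓ s := by
    intro s hs t ht hst
    rw [hdiff s hs t ht]
    have := intervalIntegral.integral_mono_on (f := fun _ => κ) (g := fun x => ‖c' x‖) hst
      (by simp) (intervalIntegrable_of_continuousOn_Icc hnorm hs ht)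
      fun x hx => hmin ⟨hs.1.trans hx.1, hx.2.trans ht.2⟩
    rw [intervalIntegral.integral_const, smul_eq_mul] at this
    linarith
  have hlow' : ∀ s ∈ Icc (0 : ℝ) 1, ∀ t ∈ Icc (0 : ℝ) 1, κ * |t - s| ≤ |ℓ t - ℓ s| := by
    intro s hs t ht
    rcases le_total s t with h | h
    · rw [abs_of_nonneg (sub_nonneg.2 h)]
      exact (hlow s hs t ht h).trans (le_abs_self _)
    · rw [abs_sub_comm, abs_of_nonneg (sub_nonneg.2 h), abs_sub_comm]
      exact (hlow t ht s hs h).trans (le_abs_self _)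
  have hchord : ∀ s ∈ Icc (0 : ℝ) 1, ∀ t ∈ Icc (0 : ℝ) 1, ‖c t - c s‖ ≤ |ℓ t - ℓ s| := by
    intro s hs t ht
    rcases le_total s t with h | h
    · refine le_trans ?_ (le_abs_self _)
      rw [hdiff s hs t ht]
      exact norm_sub_le_integral_norm_deriv hc hc' hs.1 h ht.2
    · rw [norm_sub_rev, abs_sub_comm]
      refine le_trans ?_ (le_abs_self _)
      rw [hdiff t ht s hs]
      exact norm_sub_le_integral_norm_deriv hc hc' ht.1 h hs.2
  have hcont : ContinuousOn ℓ (Icc 0 1) := by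
    have := intervalIntegral.continuousOn_primitive_interval (μ := volume) (a := 0) (b := 1)
      (f := fun x => ‖c' x‖)
      (by rw [uIcc_of_le zero_le_one]; exact hnorm.integrableOn_Icc)
    rwa [uIcc_of_le zero_le_one] at this
  have hℓ0 : ℓ 0 = 0 := intervalIntegral.integral_same
  -- Truncating at N keeps the parameters in the unit interval for all indices.
  have hex : ∀ i : ℕ, ∃ t ∈ Icc (0 : ℝ) 1, ℓ t = (min i N : ℕ) * (L / N) := by
    intro i
    have h2 : ((min i N : ℕ) : ℝ) ≤ N := by exact_mod_cast min_le_right i N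
    obtain ⟨t, ht, h⟩ := intermediate_value_Icc zero_le_one hcont
      (show ((min i N : ℕ) : ℝ) * (L / N) ∈ Icc (ℓ 0) (ℓ 1) by
        rw [hℓ0]
        refine ⟨by positivity, ?_⟩
        calc ((min i N : ℕ) : ℝ) * (L / N) ≤ N * (L / N) := by gcongr
          _ = L := by field_simp)
    exact ⟨t, ht, h⟩
  choose t ht htℓ using hex
  have hinj : ∀ s ∈ Icc (0 : ℝ) 1, ∀ t ∈ Icc (0 : ℝ) 1, ℓ s = ℓ t → s = t := by
    intro s hs t ht h
    have h1 := hlow' s hs t ht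
    rw [h, sub_self, abs_zero] at h1
    have h2 : |t - s| ≤ 0 := by
      by_contra h3
      push Not at h3
      have := mul_pos hκ0 h3
      linarith
    have := abs_nonpos_iff.1 h2
    linarith
  have hstep : ∀ i < N, |ℓ (t (i + 1)) - ℓ (t i)| = L / N := by
    intro i hi
    rw [htℓ, htℓ, min_eq_left hi.le, min_eq_left (Nat.succ_le_of_lt hi)]
    push_cast
    rw [← sub_mul, add_sub_cancel_left, one_mul, abs_of_nonneg (by positivity)]
  refine ⟨t, hinj _ (ht 0) _ h01 ?_, hinj _ (ht N) _ h11 ?_, ht, fun i hi => ⟨?_, ?_⟩⟩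
  · rw [htℓ, hℓ0]; simp
  · rw [htℓ, min_self]
    change (N : ℝ) * (L / N) = L
    field_simp
  · rw [← hstep i hi]; exact hlow' _ (ht i) _ (ht (i + 1))
  · rw [← hstep i hi]; exact hchord _ (ht i) _ (ht (i + 1))

end Curve

/-! ### Short geodesics on an immersed surface -/

/-- Subtracting the normal component leaves a vector that is itself a value of the differential,
hence orthogonal to itself. -/
lemma IsPatch.eq_smul_normal {U : Set Plane} {r ν : Plane → Space} {u : Plane}
    (h : IsPatch U r ν) (hu : u ∈ U) {z : Space} (hz : ∀ w, ⟪z, fderiv ℝ r u w⟫ = 0) :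
    ∃ c : ℝ, z = c • ν u := by
  refine ⟨⟪ν u, z⟫, ?_⟩
  have h1 : ⟪ν u, z - ⟪ν u, z⟫ • ν u⟫ = 0 := by
    rw [inner_sub_right, inner_smul_right, real_inner_self_eq_norm_sq, h.norm_normal u hu]; ring
  obtain ⟨w, hw⟩ := exists_eq_of_inner_eq_zero (h.norm_normal u hu)
    (L := (fderiv ℝ r u).toLinearMap) (h.injective u hu) (h.inner_normal u hu) h1
  have hw' : fderiv ℝ r u w = z - ⟪ν u, z⟫ • ν u := hw
  have h2 : ⟪z - ⟪ν u, z⟫ • ν u, z - ⟪ν u, z⟫ • ν u⟫ = 0 := by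
    conv_lhs => rw [inner_sub_left, inner_smul_left, h1, mul_zero, sub_zero, ← hw', hz]
  rw [inner_self_eq_zero, sub_eq_zero] at h2
  exact h2

/-! ### Energy-minimizing chains on a compact immersed surface. -/

namespace ImmersedSurface

variable {M : Type u} [TopologicalSpace M] [ChartedSpace Plane M]
  (S : ImmersedSurface M)

/-- An immersed surface may intersect itself, so closeness in space alone does not imply closeness
on M. Within W it does: on the compact set W \ W' the chord length is positive and attains its
minimum. -/
lemma exists_isOpen_of_norm_lt [CompactSpace M] {W' W : Set (M × M)} (hW' : IsOpen W')
    (hW : IsClosed W) (hdiag : ∀ x, (x, x) ∈ W')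
    (hinj : ∀ p ∈ W, S.pos p.1 = S.pos p.2 → p.1 = p.2) :
    ∃ δ > 0, ∀ p ∈ W, ‖S.pos p.2 - S.pos p.1‖ < δ → p ∈ W' := by
  have hc : IsCompact (W \ W') := (hW.sdiff hW').isCompact
  have hcont : Continuous fun p : M × M => ‖S.pos p.2 - S.pos p.1‖ := by
    have := S.contMDiff_pos.continuous
    fun_prop
  rcases (W \ W').eq_empty_or_nonempty with he | hne
  · exact ⟨1, one_pos, fun p hp _ => by
      by_contra h
      exact (he ▸ (⟨hp, h⟩ : p ∈ W \ W') : p ∈ (∅ : Set (M × M)))⟩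
  · obtain ⟨p₀, hp₀, hmin⟩ := hc.exists_isMinOn hne hcont.continuousOn
    refine ⟨‖S.pos p₀.2 - S.pos p₀.1‖, ?_, fun p hp hlt => ?_⟩
    · rw [gt_iff_lt, norm_pos_iff, sub_ne_zero]
      intro h
      have := hinj p₀ hp₀.1 h.symm
      apply hp₀.2
      have h2 := hdiag p₀.1
      rwa [show (p₀.1, p₀.1) = p₀ from Prod.ext rfl this] at h2
    · by_contra h
      exact absurd (hmin ⟨hp, h⟩) (not_le.2 hlt)

variable [IsManifold (𝓡 2) ∞ M]

/-- The local quadratic bounds hold on a neighborhood of the diagonal, and normality of the compact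
space M × M shrinks it. The closed set W serves for the existence of minimizers, the open set W' for
their variation. -/
lemma exists_nhds_diagonal [T2Space M] [CompactSpace M] {K : ℝ} (hK : S.IsCurvatureBound K) :
    ∃ W' W : Set (M × M), IsOpen W' ∧ IsClosed W ∧ W' ⊆ W ∧ (∀ x, (x, x) ∈ W') ∧
      ∀ p ∈ W,
        |⟪S.normal p.1, S.pos p.2 - S.pos p.1⟫| ≤ 11 / 10 * K * ‖S.pos p.2 - S.pos p.1‖ ^ 2 ∧
        |⟪S.normal p.2, S.pos p.2 - S.pos p.1⟫| ≤ 11 / 10 * K * ‖S.pos p.2 - S.pos p.1‖ ^ 2 ∧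
        (S.pos p.1 = S.pos p.2 → p.1 = p.2) := by
  have hloc : ∀ x : M, ∃ V : Set M, IsOpen V ∧ x ∈ V ∧ ∀ y ∈ V, ∀ z ∈ V,
      |⟪S.normal y, S.pos z - S.pos y⟫| ≤ 11 / 10 * K * ‖S.pos z - S.pos y‖ ^ 2 ∧
      (S.pos y = S.pos z → y = z) := by
    intro x
    have hx := mem_extChartAt_source (I := 𝓡 2) x
    obtain ⟨V, hVU, hV, hxV, hVb⟩ := (S.isPatch x).exists_quadratic_bound
      ((extChartAt (𝓡 2) x).map_source hx) hK.nonneg fun p hp w => hK.norm_fderiv_le hp w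
    refine ⟨(extChartAt (𝓡 2) x).source ∩ extChartAt (𝓡 2) x ⁻¹' V,
      isOpen_extChartAt_preimage' x hV, ⟨hx, hxV⟩, fun y hy z hz => ?_⟩
    have h1 := hVb _ hy.2 _ hz.2
    simp only [chartPos, chartNormal, Function.comp, (extChartAt (𝓡 2) x).left_inv hy.1,
      (extChartAt (𝓡 2) x).left_inv hz.1] at h1
    exact ⟨h1.1, fun h => (extChartAt (𝓡 2) x).injOn hy.1 hz.1 (h1.2 h)⟩
  choose V hVo hxV hVb using hloc
  obtain ⟨W', hW', hdiag, hcl⟩ := normal_exists_closure_subset (s := diagonal M)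
    (t := ⋃ x, V x ×ˢ V x) isClosed_diagonal
    (isOpen_iUnion fun x => (hVo x).prod (hVo x)) (by
      rintro ⟨x, y⟩ hxy
      rw [mem_diagonal_iff] at hxy
      simp only at hxy
      subst hxy
      exact mem_iUnion.2 ⟨x, hxV x, hxV x⟩)
  refine ⟨W', closure W', hW', isClosed_closure, subset_closure, fun x => hdiag rfl,
    fun p hp => ?_⟩
  obtain ⟨x, hx⟩ := mem_iUnion.1 (hcl hp)
  have h1 := hVb x _ hx.1 _ hx.2
  have h2 := hVb x _ hx.2 _ hx.1
  refine ⟨h1.1, ?_, h1.2⟩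
  rw [← abs_neg, ← inner_neg_right, neg_sub, norm_sub_rev]
  exact h2.1

/-- The first variation of the energy of two adjacent steps: the second difference at the middle
point is orthogonal to the tangent plane. -/
lemma exists_eq_smul_normal_of_isLocalMin {x : M} {A B : Space}
    (h : IsLocalMin (fun y => ‖S.pos y - A‖ ^ 2 + ‖B - S.pos y‖ ^ 2) x) :
    ∃ c : ℝ, (B - S.pos x) - (S.pos x - A) = c • S.normal x := by
  have hx := mem_extChartAt_source (I := 𝓡 2) x
  have hu := (extChartAt (𝓡 2) x).map_source hx
  have hP := S.isPatch x
  have hinv : (extChartAt (𝓡 2) x).symm (extChartAt (𝓡 2) x x) = x :=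
    (extChartAt (𝓡 2) x).left_inv hx
  have hpos : S.chartPos x (extChartAt (𝓡 2) x x) = S.pos x := by
    rw [chartPos, Function.comp, hinv]
  have hnor : S.chartNormal x (extChartAt (𝓡 2) x x) = S.normal x := by
    rw [chartNormal, Function.comp, hinv]
  have hloc : IsLocalMin (fun p => ‖S.chartPos x p - A‖ ^ 2 + ‖B - S.chartPos x p‖ ^ 2)
      (extChartAt (𝓡 2) x x) := by
    have hc : ContinuousAt (extChartAt (𝓡 2) x).symm (extChartAt (𝓡 2) x x) :=
      continuousAt_extChartAt_symm x
    have h' : IsLocalMin (fun y => ‖S.pos y - A‖ ^ 2 + ‖B - S.pos y‖ ^ 2)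
      ((extChartAt (𝓡 2) x).symm (extChartAt (𝓡 2) x x)) := by rwa [hinv]
    exact h'.comp_tendsto hc
  rw [← hpos, ← hnor]
  refine hP.eq_smul_normal hu fun w => ?_
  have hd := hP.hasFDerivAt_pos hu
  have h1 := hloc.hasFDerivAt_eq_zero ((hd.sub_const A).norm_sq.add (hd.const_sub B).norm_sq)
  have h2 := congrArg (fun L : Plane →L[ℝ] ℝ => L w) h1
  generalize extChartAt (𝓡 2) x x = u at h2 ⊢
  simp at h2
  simp only [inner_sub_left]
  linarith

end ImmersedSurface

namespace ImmersedSurface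

variable {M : Type u} [TopologicalSpace M] [ChartedSpace Plane M] [IsManifold (𝓡 2) ∞ M]
  (S : ImmersedSurface M)

/-- The admissible chains form a closed subset of a compact product of copies of M, so the energy
has a minimizer. Since E < δ² all its steps lie in the open set W', and each interior point can be
varied freely. -/
lemma exists_discrete_geodesic [T2Space M] [CompactSpace M] {W' W : Set (M × M)} (hW' : IsOpen W')
    (hW : IsClosed W) (hsub : W' ⊆ W) {δ : ℝ} (hδ : 0 < δ)
    (hclose : ∀ p ∈ W, ‖S.pos p.2 - S.pos p.1‖ < δ → p ∈ W') {N : ℕ} {E : ℝ} (hE : E < δ ^ 2)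
    (x₀ : ℕ → M) (hx₀ : ∀ i < N, (x₀ i, x₀ (i + 1)) ∈ W)
    (hE₀ : ∑ i ∈ Finset.range N, ‖S.pos (x₀ (i + 1)) - S.pos (x₀ i)‖ ^ 2 ≤ E) :
    ∃ x : ℕ → M, x 0 = x₀ 0 ∧ x N = x₀ N ∧ (∀ i < N, (x i, x (i + 1)) ∈ W) ∧
      ∑ i ∈ Finset.range N, ‖S.pos (x (i + 1)) - S.pos (x i)‖ ^ 2 ≤ E ∧
      ∀ i, i + 1 < N → ∃ c : ℝ, (S.pos (x (i + 2)) - S.pos (x (i + 1))) -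
        (S.pos (x (i + 1)) - S.pos (x i)) = c • S.normal (x (i + 1)) := by
  classical
  have hpos := S.contMDiff_pos.continuous
  set 𝓒 : Set (ℕ → M) := {x | x 0 = x₀ 0 ∧ x N = x₀ N ∧ ∀ i < N, (x i, x (i + 1)) ∈ W} with h𝓒
  set F : (ℕ → M) → ℝ := fun x =>
    ∑ i ∈ Finset.range N, ‖S.pos (x (i + 1)) - S.pos (x i)‖ ^ 2 with hF
  have hWi : ∀ i, IsClosed {x : ℕ → M | (x i, x (i + 1)) ∈ W} := fun i =>
    hW.preimage ((continuous_apply i).prodMk (continuous_apply (i + 1)))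
  have hcl : IsClosed 𝓒 := by
    have h0 : IsClosed {x : ℕ → M | x 0 = x₀ 0} := isClosed_singleton.preimage (continuous_apply 0)
    have h1 : IsClosed {x : ℕ → M | x N = x₀ N} := isClosed_singleton.preimage (continuous_apply N)
    have h2 : IsClosed {x : ℕ → M | ∀ i < N, (x i, x (i + 1)) ∈ W} := by
      simp only [ofPred_forall]
      exact isClosed_iInter fun i => isClosed_iInter fun _ => hWi i
    exact h0.inter (h1.inter h2)
  have hcont : Continuous F := by
    refine continuous_finsetSum _ fun i _ => ?_
    exact (((hpos.comp (continuous_apply (i + 1))).sub (hpos.comp (continuous_apply i))).norm).pow 2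
  obtain ⟨x, hx, hmin⟩ := hcl.isCompact.exists_isMinOn ⟨x₀, rfl, rfl, hx₀⟩ hcont.continuousOn
  have hFx : F x ≤ E := (hmin ⟨rfl, rfl, hx₀⟩).trans hE₀
  have hxW' : ∀ i < N, (x i, x (i + 1)) ∈ W' := by
    intro i hi
    refine hclose _ (hx.2.2 i hi) ?_
    have h1 : ‖S.pos (x (i + 1)) - S.pos (x i)‖ ^ 2 ≤ F x :=
      Finset.single_le_sum (f := fun i => ‖S.pos (x (i + 1)) - S.pos (x i)‖ ^ 2)
        (fun _ _ => by positivity) (Finset.mem_range.2 hi)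
    exact lt_of_pow_lt_pow_left₀ 2 hδ.le ((h1.trans hFx).trans_lt hE)
  refine ⟨x, hx.1, hx.2.1, hx.2.2, hFx, fun i hi => ?_⟩
  have hup : ∀ y, Function.update x (i + 1) y i = x i ∧ Function.update x (i + 1) y (i + 1) = y ∧
      Function.update x (i + 1) y (i + 2) = x (i + 2) := fun y =>
    ⟨Function.update_of_ne (by omega) _ _, Function.update_self _ _ _,
      Function.update_of_ne (by omega) _ _⟩
  have hmem : ∀ᶠ y in 𝓝 (x (i + 1)), Function.update x (i + 1) y ∈ 𝓒 := by
    have h1 : ∀ᶠ y in 𝓝 (x (i + 1)), (x i, y) ∈ W' :=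
      (hW'.preimage (Continuous.prodMk_right (x i))).mem_nhds (hxW' i (by omega))
    have h2 : ∀ᶠ y in 𝓝 (x (i + 1)), (y, x (i + 2)) ∈ W' :=
      (hW'.preimage (Continuous.prodMk_left (x (i + 2)))).mem_nhds (hxW' (i + 1) hi)
    filter_upwards [h1, h2] with y hy1 hy2
    refine ⟨?_, ?_, fun k hk => ?_⟩
    · rw [Function.update_of_ne (by omega)]; exact hx.1
    · rw [Function.update_of_ne (by omega)]; exact hx.2.1
    · by_cases hki : k = i
      · subst hki
        rw [(hup y).1, (hup y).2.1]; exact hsub hy1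
      · by_cases hki' : k = i + 1
        · subst hki'
          rw [(hup y).2.1, (hup y).2.2]; exact hsub hy2
        · rw [Function.update_of_ne hki', Function.update_of_ne (by omega)]
          exact hx.2.2 k hk
  -- Only the two steps at the index i + 1 change when that point moves.
  have hsplit : ∀ z : ℕ → M, F z = ∑ k ∈ ((Finset.range N).erase i).erase (i + 1),
      ‖S.pos (z (k + 1)) - S.pos (z k)‖ ^ 2 + (‖S.pos (z (i + 1)) - S.pos (z i)‖ ^ 2 +
        ‖S.pos (z (i + 2)) - S.pos (z (i + 1))‖ ^ 2) := by
    intro z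
    rw [hF]
    simp only
    rw [← Finset.add_sum_erase _ _ (Finset.mem_range.2 (by omega : i < N)),
      ← Finset.add_sum_erase _ _ (Finset.mem_erase.2 ⟨by omega, Finset.mem_range.2 hi⟩)]
    ring
  refine S.exists_eq_smul_normal_of_isLocalMin ?_
  filter_upwards [hmem] with y hy
  have h1 : F x ≤ F (Function.update x (i + 1) y) := hmin hy
  rw [hsplit, hsplit, (hup y).1, (hup y).2.1, (hup y).2.2] at h1
  have h2 : ∑ k ∈ ((Finset.range N).erase i).erase (i + 1),
      ‖S.pos (Function.update x (i + 1) y (k + 1)) - S.pos (Function.update x (i + 1) y k)‖ ^ 2 =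
      ∑ k ∈ ((Finset.range N).erase i).erase (i + 1), ‖S.pos (x (k + 1)) - S.pos (x k)‖ ^ 2 := by
    refine Finset.sum_congr rfl fun k hk => ?_
    rw [Finset.mem_erase, Finset.mem_erase] at hk
    rw [Function.update_of_ne (by omega), Function.update_of_ne (by omega)]
  rw [h2] at h1
  linarith

/-- The chord of a short curve on a compact surface is almost orthogonal to the surface normal at
its starting point. The bound is linear in the length of the chord, and not only in the length of
the curve. -/
lemma abs_inner_normal_chord_le [T2Space M] [CompactSpace M] {K : ℝ} (hK : S.IsCurvatureBound K)
    {γ : ℝ → M} (hγ : ContinuousOn γ (Icc 0 1)) {c' : ℝ → Space}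
    (hc : ∀ t ∈ Icc (0 : ℝ) 1, HasDerivWithinAt (S.pos ∘ γ) (c' t) (Icc 0 1) t)
    (hc' : ContinuousOn c' (Icc 0 1)) (hne : ∀ t ∈ Icc (0 : ℝ) 1, c' t ≠ 0)
    (hKL : K * (∫ t in (0 : ℝ)..1, ‖c' t‖) ≤ 1 / 16) :
    |⟪S.normal (γ 0), S.pos (γ 1) - S.pos (γ 0)⟫| ≤
      3 / 2 * (K * ∫ t in (0 : ℝ)..1, ‖c' t‖) * ‖S.pos (γ 1) - S.pos (γ 0)‖ := by
  set L := ∫ t in (0 : ℝ)..1, ‖c' t‖ with hL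
  have hL0 : 0 ≤ L := intervalIntegral.integral_nonneg zero_le_one fun _ _ => norm_nonneg _
  obtain ⟨W', W, hW', hW, hsub, hdiag, hb⟩ := S.exists_nhds_diagonal hK
  obtain ⟨δ, hδ, hclose⟩ := S.exists_isOpen_of_norm_lt hW' hW hdiag fun p hp => (hb p hp).2.2
  obtain ⟨κ, hκ, hpts⟩ := exists_equidistant_points hc hc' hne
  -- Uniform continuity: in the compact interval every open neighborhood of the diagonal is an
  -- entourage.
  obtain ⟨η, hη, hηW⟩ : ∃ η > 0, ∀ s ∈ Icc (0 : ℝ) 1, ∀ t ∈ Icc (0 : ℝ) 1, |t - s| < η →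
      (γ s, γ t) ∈ W' := by
    have hg : Continuous fun t : Icc (0 : ℝ) 1 => γ t := continuousOn_iff_continuous_domRestrict.1 hγ
    have hopen : IsOpen {p : Icc (0 : ℝ) 1 × Icc (0 : ℝ) 1 | (γ p.1, γ p.2) ∈ W'} :=
      hW'.preimage ((hg.comp continuous_fst).prodMk (hg.comp continuous_snd))
    have hu : {p : Icc (0 : ℝ) 1 × Icc (0 : ℝ) 1 | (γ p.1, γ p.2) ∈ W'} ∈
        uniformity (Icc (0 : ℝ) 1) := by
      rw [← nhdsSet_diagonal_eq_uniformity, hopen.mem_nhdsSet]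
      rintro ⟨s, t⟩ hst
      rw [mem_diagonal_iff] at hst
      simp only at hst
      subst hst
      exact hdiag _
    obtain ⟨η, hη, h⟩ := Metric.mem_uniformity_dist.1 hu
    refine ⟨η, hη, fun s hs t ht hst => h (a := ⟨s, hs⟩) (b := ⟨t, ht⟩) ?_⟩
    rw [Subtype.dist_eq, Real.dist_eq, abs_sub_comm]
    exact hst
  -- Large N makes the parameter steps of the sampled curve smaller than η and its energy L²/N
  -- smaller than δ².
  obtain ⟨N, hN⟩ := exists_nat_gt (max (L / (κ * η)) (L ^ 2 / δ ^ 2))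
  have hN1 := (le_max_left _ _).trans_lt hN
  have hN2 := (le_max_right _ _).trans_lt hN
  have hN' : (0 : ℝ) < N := lt_of_le_of_lt (by positivity) hN2
  have hN0 : 0 < N := by exact_mod_cast hN'
  obtain ⟨t, ht0, htN, htI, ht⟩ := hpts N hN0
  obtain ⟨x, hx0, hxN, hxW, hxE, hxc⟩ := S.exists_discrete_geodesic hW' hW hsub hδ hclose
    (N := N) (E := L ^ 2 / N) (by
      rw [div_lt_iff₀ hN']
      rw [div_lt_iff₀ (by positivity)] at hN2
      linarith) (fun i => γ (t i))
    (fun i hi => hsub (hηW _ (htI i) _ (htI (i + 1)) (by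
      have h1 := (ht i hi).1
      rw [div_lt_iff₀ (by positivity)] at hN1
      have h2 : L / N < κ * η := by rw [div_lt_iff₀ hN']; linarith
      exact lt_of_mul_lt_mul_left (h1.trans_lt h2) hκ.le)))
    (by
      refine (Finset.sum_le_card_nsmul _ _ ((L / N) ^ 2) fun i hi => ?_).trans (le_of_eq ?_)
      · exact pow_le_pow_left₀ (norm_nonneg _) (ht i (Finset.mem_range.1 hi)).2 2
      · rw [Finset.card_range, nsmul_eq_mul]; field_simp)
  -- The constants match: (11/10) · (1/16) = 11/160 and (15/11) · (11/10) = 3/2.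
  have key := abs_inner_sum_le_of_discrete_geodesic hN0
    (v := fun i => S.pos (x (i + 1)) - S.pos (x i)) (n := fun i => S.normal (x i))
    (K := 11 / 10 * K) (L := L) (by have := hK.nonneg; positivity) hL0 (by linarith)
    (fun i => S.norm_normal _) (fun i hi => (hb _ (hxW i hi)).1) (fun i hi => (hb _ (hxW i hi)).2.1)
    hxc hxE
  rw [Finset.sum_range_sub fun i => S.pos (x i), hx0, hxN, ht0, htN] at key
  linarith

end ImmersedSurface

/-! ### Uniqueness for quadratic differential equations in the plane -/

/-- A parametrized solution, starting at the origin in the direction of the first axis, of the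
differential equation `a dx² + b dx dy + c dy² = 0`. -/
structure IsQuadraticSolution (a b c : ℝ × ℝ → ℝ) (τ : ℝ) (x y x' y' : ℝ → ℝ) : Prop where
  pos : 0 < τ
  hasDeriv_fst : ∀ t ∈ Icc 0 τ, HasDerivWithinAt x (x' t) (Icc 0 τ) t
  hasDeriv_snd : ∀ t ∈ Icc 0 τ, HasDerivWithinAt y (y' t) (Icc 0 τ) t
  continuous_fst : ContinuousWithinAt x' (Icc 0 τ) 0
  continuous_snd : ContinuousWithinAt y' (Icc 0 τ) 0
  fst_zero : x 0 = 0
  snd_zero : y 0 = 0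
  deriv_fst_pos : 0 < x' 0
  deriv_snd_zero : y' 0 = 0
  eq_zero : ∀ t ∈ Icc 0 τ,
    a (x t, y t) * x' t ^ 2 + b (x t, y t) * (x' t * y' t) + c (x t, y t) * y' t ^ 2 = 0

namespace IsQuadraticSolution

variable {a b c : ℝ × ℝ → ℝ} {τ : ℝ} {x y x' y' : ℝ → ℝ}

lemma exists_small (h : IsQuadraticSolution a b c τ x y x' y') {s : Set (ℝ × ℝ)}
    (hs : s ∈ 𝓝 (0 : ℝ × ℝ)) {μ : ℝ} (hμ : 0 < μ) :
    ∃ T, 0 < T ∧ T < τ ∧ ∀ t ∈ Icc 0 T, x' 0 / 2 ≤ x' t ∧ x' t ≤ 2 * x' 0 ∧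
      |y' t| ≤ μ * x' t ∧ (x t, y t) ∈ s := by
  have hX := h.deriv_fst_pos
  have h0 : (0 : ℝ) ∈ Icc 0 τ := ⟨le_rfl, h.pos.le⟩
  have h1 : ∀ᶠ t in 𝓝[Icc 0 τ] 0, x' 0 / 2 ≤ x' t :=
    h.continuous_fst.eventually (eventually_ge_nhds (by linarith))
  have h2 : ∀ᶠ t in 𝓝[Icc 0 τ] 0, x' t ≤ 2 * x' 0 :=
    h.continuous_fst.eventually (eventually_le_nhds (by linarith))
  have h3 : ∀ᶠ t in 𝓝[Icc 0 τ] 0, |y' t| ≤ μ * (x' 0 / 2) := by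
    refine h.continuous_snd.abs.eventually (eventually_le_nhds ?_)
    simp only [h.deriv_snd_zero, abs_zero]; positivity
  have h4 : ∀ᶠ t in 𝓝[Icc 0 τ] 0, (x t, y t) ∈ s := by
    have := (h.hasDeriv_fst 0 h0).continuousWithinAt.prodMk
      (h.hasDeriv_snd 0 h0).continuousWithinAt
    refine this.eventually ?_
    simp only [h.fst_zero, h.snd_zero]
    exact hs
  have h5 := (h1.and (h2.and (h3.and h4)))
  rw [nhdsWithin_Icc_eq_nhdsGE h.pos] at h5
  obtain ⟨u, hu, hsub⟩ := (mem_nhdsGE_iff_exists_Icc_subset).1 h5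
  replace hu : 0 < u := hu
  refine ⟨min u (τ / 2), lt_min hu (half_pos h.pos),
    (min_le_right _ _).trans_lt (half_lt_self h.pos), fun t ht => ?_⟩
  obtain ⟨k1, k2, k3, k4⟩ := hsub ⟨ht.1, ht.2.trans (min_le_left _ _)⟩
  exact ⟨k1, k2, k3.trans (by gcongr), k4⟩

lemma mul_sub_le_sub (h : IsQuadraticSolution a b c τ x y x' y') {T κ : ℝ} (hT : T ≤ τ)
    (hκ : ∀ t ∈ Icc 0 T, κ ≤ x' t) {s t : ℝ} (hs : s ∈ Icc 0 T) (ht : t ∈ Icc 0 T) (hst : s ≤ t) :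
    κ * (t - s) ≤ x t - x s := by
  have hsub : Icc s t ⊆ Icc 0 τ := Icc_subset_Icc hs.1 (ht.2.trans hT)
  refine (convex_Icc s t).mul_sub_le_image_sub_of_le_deriv (f := x)
    (fun p hp => ((h.hasDeriv_fst p (hsub hp)).continuousWithinAt).mono hsub) ?_ ?_ s
    (left_mem_Icc.2 hst) t (right_mem_Icc.2 hst) hst
  all_goals
    rw [interior_Icc]
    intro p hp
    have hp' := hsub (Ioo_subset_Icc_self hp)
    have hd : HasDerivAt x (x' p) p := (h.hasDeriv_fst p hp').hasDerivAt
      (Icc_mem_nhds (hs.1.trans_lt hp.1) (hp.2.trans_le (ht.2.trans hT)))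
  · exact hd.differentiableAt.differentiableWithinAt
  · rw [hd.deriv]
    exact hκ p ⟨hs.1.trans hp.1.le, hp.2.le.trans ht.2⟩

/-- Two solutions that start in the same direction meet again, if the direction is a simple root of
the quadratic form. -/
lemma exists_eq {x₁ y₁ x₁' y₁' x₂ y₂ x₂' y₂' : ℝ → ℝ} {τ₁ τ₂ : ℝ}
    (h₁ : IsQuadraticSolution a b c τ₁ x₁ y₁ x₁' y₁')
    (h₂ : IsQuadraticSolution a b c τ₂ x₂ y₂ x₂' y₂')
    {s : Set (ℝ × ℝ)} (hs : s ∈ 𝓝 (0 : ℝ × ℝ)) {Λ : ℝ}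
    (ha : ∀ x y y', (x, y) ∈ s → (x, y') ∈ s → |a (x, y) - a (x, y')| ≤ Λ * |y - y'|)
    (hb : ∀ x y y', (x, y) ∈ s → (x, y') ∈ s → |b (x, y) - b (x, y')| ≤ Λ * |y - y'|)
    (hc : ∀ x y y', (x, y) ∈ s → (x, y') ∈ s → |c (x, y) - c (x, y')| ≤ Λ * |y - y'|)
    (hbc : ContinuousAt b 0) (hcc : ContinuousAt c 0) (hb0 : b 0 ≠ 0) :
    ∃ t₁ ∈ Ioo 0 τ₁, ∃ t₂ ∈ Ioo 0 τ₂, x₁ t₁ = x₂ t₂ ∧ y₁ t₁ = y₂ t₂ := by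
  set β := |b 0| with hβ
  have hβ0 : 0 < β := abs_pos.2 hb0
  set C := |c 0| + 1 with hC
  have hC0 : 0 < C := by positivity
  -- A slope bound so small that the second root of the quadratic equation stays away: the factor B
  -- + C(m₁ + m₂) below keeps absolute value at least β/2.
  set μ := min 1 (β / (8 * C)) with hμ
  have hμ0 : 0 < μ := lt_min one_pos (by positivity)
  have hμC : C * (2 * μ) ≤ β / 4 := by
    have : μ ≤ β / (8 * C) := min_le_right _ _
    rw [le_div_iff₀ (by positivity)] at this
    linarith
  have hs' : s ∩ ({p | |b p - b 0| < β / 4} ∩ {p | |c p| < C}) ∈ 𝓝 (0 : ℝ × ℝ) := by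
    refine Filter.inter_mem hs (Filter.inter_mem ?_ ?_)
    · have := (hbc.sub_const (b 0)).abs
      refine this.eventually (eventually_lt_nhds ?_)
      simpa using by positivity
    · exact hcc.abs.eventually (eventually_lt_nhds (by rw [hC]; linarith))
  obtain ⟨T₁, hT₁, hTτ₁, hg₁⟩ := h₁.exists_small hs' hμ0
  obtain ⟨T₂, hT₂, hTτ₂, hg₂⟩ := h₂.exists_small hs' hμ0
  have hX₁ := h₁.deriv_fst_pos
  have hX₂ := h₂.deriv_fst_pos
  have hm₁ : ∀ {s t}, s ∈ Icc 0 T₁ → t ∈ Icc 0 T₁ → s ≤ t → x₁' 0 / 2 * (t - s) ≤ x₁ t - x₁ s :=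
    fun hs ht => h₁.mul_sub_le_sub hTτ₁.le (fun t ht => (hg₁ t ht).1) hs ht
  have hm₂ : ∀ {s t}, s ∈ Icc 0 T₂ → t ∈ Icc 0 T₂ → s ≤ t → x₂' 0 / 2 * (t - s) ≤ x₂ t - x₂ s :=
    fun hs ht => h₂.mul_sub_le_sub hTτ₂.le (fun t ht => (hg₂ t ht).1) hs ht
  have hx₂T : 0 < x₂ T₂ := by
    have := hm₂ ⟨le_rfl, hT₂.le⟩ ⟨hT₂.le, le_rfl⟩ hT₂.le
    rw [h₂.fst_zero, sub_zero, sub_zero] at this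
    exact lt_of_lt_of_le (by positivity) this
  -- an initial interval on which the second solution covers the first coordinate of the first one
  obtain ⟨T, hT, hTT₁, hxT⟩ : ∃ T, 0 < T ∧ T ≤ T₁ ∧ x₁ T ≤ x₂ T₂ := by
    have h1 : ∀ᶠ t in 𝓝[Icc 0 τ₁] 0, x₁ t ≤ x₂ T₂ := by
      refine (h₁.hasDeriv_fst 0 ⟨le_rfl, h₁.pos.le⟩).continuousWithinAt.eventually
        (eventually_le_nhds ?_)
      rwa [h₁.fst_zero]
    rw [nhdsWithin_Icc_eq_nhdsGE h₁.pos] at h1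
    obtain ⟨u, hu, hsub⟩ := (mem_nhdsGE_iff_exists_Icc_subset).1 h1
    replace hu : 0 < u := hu
    exact ⟨min u T₁, lt_min hu hT₁, min_le_right _ _,
      hsub ⟨(lt_min hu hT₁).le, min_le_left _ _⟩⟩
  have hsub₁ : Icc 0 T ⊆ Icc 0 T₁ := Icc_subset_Icc le_rfl hTT₁
  have hsub₁' : Icc 0 T ⊆ Icc 0 τ₁ := hsub₁.trans (Icc_subset_Icc le_rfl hTτ₁.le)
  have hsub₂' : Icc 0 T₂ ⊆ Icc 0 τ₂ := Icc_subset_Icc le_rfl hTτ₂.le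
  -- A reparametrization of the second solution that matches the first coordinates; outside of the
  -- interval its value is irrelevant.
  have hex : ∀ t, ∃ σ, t ∈ Icc 0 T → σ ∈ Icc 0 T₂ ∧ x₂ σ = x₁ t := by
    intro t
    by_cases ht : t ∈ Icc 0 T
    · have hcont : ContinuousOn x₂ (Icc 0 T₂) := fun p hp =>
        ((h₂.hasDeriv_fst p (hsub₂' hp)).continuousWithinAt).mono hsub₂'
      obtain ⟨σ, hσ, h⟩ := intermediate_value_Icc hT₂.le hcont (show x₁ t ∈ Icc _ _ by
        have k1 := hm₁ ⟨le_rfl, hT₁.le⟩ (hsub₁ ht) ht.1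
        have k2 := hm₁ (hsub₁ ht) ⟨hT.le, hTT₁⟩ ht.2
        rw [h₁.fst_zero] at k1
        rw [h₂.fst_zero]
        have k3 : 0 ≤ x₁' 0 / 2 * (t - 0) := by have := ht.1; rw [sub_zero]; positivity
        have k4 : 0 ≤ x₁' 0 / 2 * (T - t) := by have := sub_nonneg.2 ht.2; positivity
        constructor <;> linarith)
      exact ⟨σ, fun _ => ⟨hσ, h⟩⟩
    · exact ⟨0, fun h => absurd h ht⟩
  choose σ hσ' using hex
  have hσ : ∀ t ∈ Icc 0 T, σ t ∈ Icc 0 T₂ := fun t ht => (hσ' t ht).1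
  have hσx : ∀ t ∈ Icc 0 T, x₂ (σ t) = x₁ t := fun t ht => (hσ' t ht).2
  have hinj : ∀ p ∈ Icc 0 T₂, ∀ q ∈ Icc 0 T₂, x₂' 0 / 2 * |p - q| ≤ |x₂ p - x₂ q| := by
    intro p hp q hq
    rcases le_total p q with h | h
    · rw [abs_sub_comm, abs_of_nonneg (sub_nonneg.2 h), abs_sub_comm]
      exact (hm₂ hp hq h).trans (le_abs_self _)
    · rw [abs_of_nonneg (sub_nonneg.2 h)]
      exact (hm₂ hq hp h).trans (le_abs_self _)
  have hx₁c : ContinuousOn x₁ (Icc 0 T) := fun p hp =>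
    ((h₁.hasDeriv_fst p (hsub₁' hp)).continuousWithinAt).mono hsub₁'
  have hσc : ContinuousOn σ (Icc 0 T) := by
    intro t ht
    rw [ContinuousWithinAt, tendsto_iff_dist_tendsto_zero]
    have h1 : Filter.Tendsto (fun p => (x₂' 0 / 2)⁻¹ * |x₁ p - x₁ t|) (𝓝[Icc 0 T] t) (𝓝 0) := by
      have := (((hx₁c t ht).sub_const (x₁ t)).abs).const_mul (x₂' 0 / 2)⁻¹
      simpa using this
    refine squeeze_zero' (Filter.Eventually.of_forall fun _ => dist_nonneg) ?_ h1
    filter_upwards [self_mem_nhdsWithin] with p hp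
    have := hinj _ (hσ p hp) _ (hσ t ht)
    rw [hσx p hp, hσx t ht] at this
    rw [Real.dist_eq, le_inv_mul_iff₀ (by positivity)]
    exact this
  have hσ0 : σ 0 = 0 := by
    have h0 : (0 : ℝ) ∈ Icc 0 T := ⟨le_rfl, hT.le⟩
    have := hinj _ (hσ 0 h0) 0 ⟨le_rfl, hT₂.le⟩
    rw [hσx 0 h0, h₁.fst_zero, h₂.fst_zero, sub_zero, sub_zero, abs_zero] at this
    have h2 : |σ 0| ≤ 0 := by
      by_contra h3
      push Not at h3
      have := mul_pos (half_pos hX₂) h3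
      linarith
    exact abs_nonpos_iff.1 h2
  have hσd : ∀ t ∈ Icc 0 T, HasDerivWithinAt σ (x₁' t / x₂' (σ t)) (Icc 0 T) t := by
    intro t ht
    have hpos : 0 < x₂' (σ t) := (half_pos hX₂).trans_le (hg₂ _ (hσ t ht)).1
    have hmaps : Filter.Tendsto σ (𝓝[Icc 0 T] t) (𝓝[Icc 0 T₂] (σ t)) :=
      (hσc t ht).tendsto_nhdsWithin hσ
    have hd₂ := ((h₂.hasDeriv_fst (σ t) (hsub₂' (hσ t ht))).mono hsub₂').hasFDerivWithinAt
    have hd₁ := ((h₁.hasDeriv_fst t (hsub₁' ht)).mono hsub₁').hasFDerivWithinAt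
    have key := hd₂.of_comp_of_leftInverse (g := σ)
      (f'symm := ContinuousLinearMap.toSpanSingleton ℝ (x₂' (σ t))⁻¹) hmaps hd₁
      (by filter_upwards [self_mem_nhdsWithin] with p hp using hσx p hp) (by
        intro z
        simp
        field_simp) ht
    refine key.hasDerivWithinAt.congr_deriv ?_
    change ((1 : ℝ) • x₁' t) • (x₂' (σ t))⁻¹ = _
    rw [one_smul, smul_eq_mul, div_eq_mul_inv]
  -- The gap between the solutions above the same first coordinate. It starts at zero and satisfies
  -- |F'| ≤ const · |F|, so it vanishes.
  set F : ℝ → ℝ := fun t => y₁ t - y₂ (σ t) with hF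
  have hFd : ∀ t ∈ Icc 0 T, HasDerivWithinAt F
      (y₁' t - y₂' (σ t) * (x₁' t / x₂' (σ t))) (Icc 0 T) t := by
    intro t ht
    have k1 := (h₁.hasDeriv_snd t (hsub₁' ht)).mono hsub₁'
    have k2 := (h₂.hasDeriv_snd (σ t) (hsub₂' (hσ t ht))).comp t (hσd t ht)
      fun p hp => hsub₂' (hσ p hp)
    exact k1.sub k2
  have hbound : ∀ t ∈ Icc 0 T, ‖y₁' t - y₂' (σ t) * (x₁' t / x₂' (σ t))‖ ≤
      (2 * x₁' 0 * (6 * Λ / β)) * ‖F t‖ := by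
    intro t ht
    obtain ⟨k1, k2, k3, k4, k5, k6⟩ := hg₁ t (hsub₁ ht)
    obtain ⟨l1, l2, l3, l4, l5, l6⟩ := hg₂ _ (hσ t ht)
    have e₁ := h₁.eq_zero t (hsub₁' ht)
    have e₂ := h₂.eq_zero _ (hsub₂' (hσ t ht))
    rw [hσx t ht] at l4 l5 l6 e₂
    simp only [mem_ofPred_eq] at k5 k6 l5 l6
    have p₁ : 0 < x₁' t := (half_pos hX₁).trans_le k1
    have p₂ : 0 < x₂' (σ t) := (half_pos hX₂).trans_le l1
    have dA := ha _ _ _ k4 l4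
    have dB := hb _ _ _ k4 l4
    have dC := hc _ _ _ k4 l4
    have hF' : F t = y₁ t - y₂ (σ t) := rfl
    rw [← hF'] at dA dB dC
    obtain ⟨m₁, hm₁⟩ : ∃ m, m = y₁' t / x₁' t := ⟨_, rfl⟩
    obtain ⟨m₂, hm₂⟩ : ∃ m, m = y₂' (σ t) / x₂' (σ t) := ⟨_, rfl⟩
    have y₁e : y₁' t = m₁ * x₁' t := by rw [hm₁]; field_simp
    have y₂e : y₂' (σ t) = m₂ * x₂' (σ t) := by rw [hm₂]; field_simp
    rw [y₁e, abs_mul, abs_of_pos p₁] at k3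
    rw [y₂e, abs_mul, abs_of_pos p₂] at l3
    have m₁μ : |m₁| ≤ μ := le_of_mul_le_mul_right k3 p₁
    have m₂μ : |m₂| ≤ μ := le_of_mul_le_mul_right l3 p₂
    have m₁1 : |m₁| ≤ 1 := m₁μ.trans (min_le_left _ _)
    rw [y₁e] at e₁
    rw [y₂e] at e₂
    have quot : y₁' t - y₂' (σ t) * (x₁' t / x₂' (σ t)) = x₁' t * (m₁ - m₂) := by
      rw [y₁e, y₂e]; field_simp
    generalize a (x₁ t, y₁ t) = A₁ at *
    generalize a (x₁ t, y₂ (σ t)) = A₂ at *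
    generalize b (x₁ t, y₁ t) = B₁ at *
    generalize b (x₁ t, y₂ (σ t)) = B₂ at *
    generalize c (x₁ t, y₁ t) = C₁ at *
    generalize c (x₁ t, y₂ (σ t)) = C₂ at *
    have e₁' : A₁ + B₁ * m₁ + C₁ * m₁ ^ 2 = 0 := by
      have : x₁' t ^ 2 * (A₁ + B₁ * m₁ + C₁ * m₁ ^ 2) = 0 := by rw [← e₁]; ring
      exact (mul_eq_zero.1 this).resolve_left (by positivity)
    have e₂' : A₂ + B₂ * m₂ + C₂ * m₂ ^ 2 = 0 := by
      have : x₂' (σ t) ^ 2 * (A₂ + B₂ * m₂ + C₂ * m₂ ^ 2) = 0 := by rw [← e₂]; ring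
      exact (mul_eq_zero.1 this).resolve_left (by positivity)
    -- The difference of the two equations for the slopes. The factor of m₁ - m₂ is bounded away
    -- from zero because the root is simple, and the right side is Lipschitz in F.
    have hid : (m₁ - m₂) * (B₂ + C₂ * (m₁ + m₂)) =
        -((A₁ - A₂) + (B₁ - B₂) * m₁ + (C₁ - C₂) * m₁ ^ 2) := by linear_combination e₁' - e₂'
    have hΛF : 0 ≤ Λ * |F t| := (abs_nonneg _).trans dA
    have hup : |(A₁ - A₂) + (B₁ - B₂) * m₁ + (C₁ - C₂) * m₁ ^ 2| ≤ 3 * (Λ * |F t|) := by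
      have i₁ : |(B₁ - B₂) * m₁| ≤ Λ * |F t| := by
        rw [abs_mul]
        exact (mul_le_of_le_one_right (abs_nonneg _) m₁1).trans dB
      have i₂ : |(C₁ - C₂) * m₁ ^ 2| ≤ Λ * |F t| := by
        rw [abs_mul, abs_pow]
        exact (mul_le_of_le_one_right (abs_nonneg _) (pow_le_one₀ (abs_nonneg _) m₁1)).trans dC
      have i₃ := abs_add_three (A₁ - A₂) ((B₁ - B₂) * m₁) ((C₁ - C₂) * m₁ ^ 2)
      linarith
    have hlow : β / 2 ≤ |B₂ + C₂ * (m₁ + m₂)| := by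
      have i₁ : |C₂ * (m₁ + m₂)| ≤ β / 4 := by
        rw [abs_mul]
        refine le_trans ?_ hμC
        have i₂ : |m₁ + m₂| ≤ 2 * μ := (abs_add_le _ _).trans (by linarith)
        gcongr
      have i₂ : β ≤ |B₂| + |B₂ - b 0| := by
        have : b 0 = B₂ - (B₂ - b 0) := by ring
        rw [hβ]
        conv_lhs => rw [this]
        exact abs_sub _ _
      have i₃ : |B₂| ≤ |B₂ + C₂ * (m₁ + m₂)| + |C₂ * (m₁ + m₂)| := by
        have : B₂ = (B₂ + C₂ * (m₁ + m₂)) - C₂ * (m₁ + m₂) := by ring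
        conv_lhs => rw [this]
        exact abs_sub _ _
      linarith
    have hm : |m₁ - m₂| ≤ 6 * Λ / β * |F t| := by
      have i₁ : |m₁ - m₂| * (β / 2) ≤ 3 * (Λ * |F t|) := by
        calc |m₁ - m₂| * (β / 2) ≤ |m₁ - m₂| * |B₂ + C₂ * (m₁ + m₂)| := by gcongr
          _ = _ := by rw [← abs_mul, hid, abs_neg]
          _ ≤ _ := hup
      rw [div_mul_eq_mul_div, le_div_iff₀ hβ0]
      linarith
    rw [quot, Real.norm_eq_abs, Real.norm_eq_abs, abs_mul, abs_of_pos p₁, mul_assoc]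
    exact mul_le_mul k2 hm (abs_nonneg _) (by positivity)
  have hzero := eq_zero_of_abs_deriv_le_mul_abs_self_of_eq_zero_right
    (f := F) (a := 0) (b := T) (fun t ht => (hFd t ht).continuousWithinAt)
    (fun t ht => (hFd t (Ico_subset_Icc_self ht)).mono_of_mem_nhdsWithin
      (Icc_mem_nhdsGE_of_mem ht)) (by
        simp only [hF, hσ0, h₁.snd_zero, h₂.snd_zero, sub_zero])
    (fun t ht => hbound t (Ico_subset_Icc_self ht)) T ⟨hT.le, le_rfl⟩
  have hTT : T ∈ Icc 0 T := ⟨hT.le, le_rfl⟩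
  refine ⟨T, ⟨hT, hTT₁.trans_lt hTτ₁⟩, σ T, ⟨(hσ T hTT).1.lt_of_ne ?_,
    (hσ T hTT).2.trans_lt hTτ₂⟩, (hσx T hTT).symm, sub_eq_zero.1 hzero⟩
  intro h0
  have k1 := hσx T hTT
  rw [← h0, h₂.fst_zero] at k1
  have k2 := hm₁ ⟨le_rfl, hT₁.le⟩ (hsub₁ hTT) hT.le
  rw [h₁.fst_zero, ← k1, sub_zero, sub_zero] at k2
  have : 0 < x₁' 0 / 2 * T := by positivity
  linarith

end IsQuadraticSolution

/-! ### Uniqueness of curvature lines -/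

/-- The square of a triple product is a Gram determinant. -/
lemma inner_cross_sq (n p z : Space) : ⟪n, cross p z⟫ ^ 2 =
    ‖n‖ ^ 2 * (‖p‖ ^ 2 * ‖z‖ ^ 2 - ⟪p, z⟫ ^ 2) -
      ⟪n, p⟫ * (⟪n, p⟫ * ‖z‖ ^ 2 - ⟪p, z⟫ * ⟪n, z⟫) +
      ⟪n, z⟫ * (⟪n, p⟫ * ⟪p, z⟫ - ‖p‖ ^ 2 * ⟪n, z⟫) := by
  simp only [space_inner, space_norm_sq, cross_zero', cross_one', cross_two']; ring

lemma inner_cross_combination (n p q p' q' : Space) (x y : ℝ) :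
    ⟪n, cross (x • p + y • q) (x • p' + y • q')⟫ =
      ⟪n, cross p p'⟫ * x ^ 2 + (⟪n, cross p q'⟫ + ⟪n, cross q p'⟫) * (x * y) +
        ⟪n, cross q q'⟫ * y ^ 2 := by
  simp only [space_inner, cross_zero', cross_one', cross_two', PiLp.add_apply, PiLp.smul_apply,
    smul_eq_mul]
  ring

lemma inner_cross_smul_self (n p : Space) (k : ℝ) : ⟪n, cross p (k • p)⟫ = 0 := by
  simp only [space_inner, cross_zero', cross_one', cross_two', PiLp.smul_apply, smul_eq_mul]
  ring

/-- The rotation of the plane by a right angle. -/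
noncomputable def planeRot (v : Plane) : Plane := !₂[-v 1, v 0]

lemma plane_norm_sq (v : Plane) : ‖v‖ ^ 2 = v 0 ^ 2 + v 1 ^ 2 := by
  rw [EuclideanSpace.norm_sq_eq]; simp [Fin.sum_univ_two]

lemma plane_inner (v w : Plane) : ⟪v, w⟫ = v 0 * w 0 + v 1 * w 1 := by
  simp [PiLp.inner_apply, Fin.sum_univ_two]; ring

lemma eq_combination {v : Plane} (hv : v ≠ 0) (w : Plane) :
    w = (⟪v, w⟫ / ‖v‖ ^ 2) • v + (⟪planeRot v, w⟫ / ‖v‖ ^ 2) • planeRot v := by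
  have h : v 0 ^ 2 + v 1 ^ 2 ≠ 0 := by
    rw [← plane_norm_sq]; exact pow_ne_zero 2 (norm_ne_zero_iff.2 hv)
  ext i
  fin_cases i <;> simp [plane_inner, plane_norm_sq, planeRot] <;> field_simp <;> ring

/-! ### The quadratic differential equation of curvature lines. -/

namespace IsPatch

variable {U : Set Plane} {r ν : Plane → Space} {u : Plane}

lemma contDiffAt_inner_cross (h : IsPatch U r ν) (hu : u ∈ U) (v w : Plane) :
    ContDiffAt ℝ 1 (fun p => ⟪ν p, cross (fderiv ℝ r p v) (fderiv ℝ ν p w)⟫) u := by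
  have hproj : ∀ {f : Plane → Space}, ContDiffAt ℝ 1 f u → ∀ i, ContDiffAt ℝ 1 (fun p => f p i) u :=
    fun hf i => (EuclideanSpace.proj (𝕜 := ℝ) i : Space →L[ℝ] ℝ).contDiff.contDiffAt.comp u hf
  have h1 : ContDiffAt ℝ 1 ν u := (h.contDiffAt_normal hu).of_le (by simp)
  have h2 : ContDiffAt ℝ 1 (fun p => fderiv ℝ r p v) u :=
    ((h.contDiffAt_fderiv_pos hu).of_le (by simp)).clm_apply contDiffAt_const
  have h3 : ContDiffAt ℝ 1 (fun p => fderiv ℝ ν p w) u :=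
    ((h.contDiffAt_fderiv_normal hu).of_le (by simp)).clm_apply contDiffAt_const
  have k1 := hproj h1
  have k2 := hproj h2
  have k3 := hproj h3
  simp only [space_inner, cross_zero', cross_one', cross_two']
  exact (((k1 0).mul (((k2 1).mul (k3 2)).sub ((k2 2).mul (k3 1)))).add
    ((k1 1).mul (((k2 2).mul (k3 0)).sub ((k2 0).mul (k3 2))))).add
    ((k1 2).mul (((k2 0).mul (k3 1)).sub ((k2 1).mul (k3 0))))

/-- At a point that is not umbilical a principal direction is a simple root of the quadratic form
whose zeros are the principal directions. -/
lemma inner_cross_add_ne_zero (h : IsPatch U r ν) (hu : u ∈ U)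
    (humb : ¬ ∃ k : ℝ, ∀ w, fderiv ℝ ν u w = k • fderiv ℝ r u w) {v : Plane} (hv : v ≠ 0)
    {k : ℝ} (hk : fderiv ℝ ν u v = k • fderiv ℝ r u v) :
    ⟪ν u, cross (fderiv ℝ r u v) (fderiv ℝ ν u (planeRot v))⟫ +
      ⟪ν u, cross (fderiv ℝ r u (planeRot v)) (fderiv ℝ ν u v)⟫ ≠ 0 := by
  intro h0
  set v' := planeRot v with hv'
  -- If the coefficient vanished, z would be orthogonal to the normal, to dr v by self-adjointness,
  -- and to their cross product; then z = 0 and k would be the eigenvalue in every direction.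
  set z := fderiv ℝ ν u v' - k • fderiv ℝ r u v' with hz
  have h1 : ⟪ν u, cross (fderiv ℝ r u v) z⟫ = 0 := by
    rw [← h0, hk, hz]
    simp only [space_inner, cross_zero', cross_one', cross_two', PiLp.sub_apply, PiLp.smul_apply,
      smul_eq_mul]
    ring
  have h2 : ⟪ν u, z⟫ = 0 := by
    rw [hz, inner_sub_right, inner_smul_right, h.inner_normal u hu, h.inner_fderiv_normal hu]
    ring
  have h3 : ⟪fderiv ℝ r u v, z⟫ = 0 := by
    rw [hz, inner_sub_right, inner_smul_right, real_inner_comm (fderiv ℝ ν u v'),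
      h.inner_fderiv_comm hu, hk, inner_smul_left, real_inner_comm (fderiv ℝ r u v')]
    simp
  have h4 := inner_cross_sq (ν u) (fderiv ℝ r u v) z
  rw [h1, h2, h3, h.inner_normal u hu, h.norm_normal u hu] at h4
  have h5 : ‖fderiv ℝ r u v‖ ≠ 0 := by
    rw [norm_ne_zero_iff]
    intro h6
    exact hv (h.injective u hu (by rw [h6, map_zero]))
  have h6 : z = 0 := by
    have : ‖fderiv ℝ r u v‖ ^ 2 * ‖z‖ ^ 2 = 0 := by linarith
    rcases mul_eq_zero.1 this with h7 | h7
    · exact absurd (pow_eq_zero_iff (two_ne_zero)|>.1 h7) h5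
    · exact norm_eq_zero.1 (pow_eq_zero_iff (two_ne_zero)|>.1 h7)
  rw [hz, sub_eq_zero] at h6
  refine humb ⟨k, fun w => ?_⟩
  rw [eq_combination hv w, map_add, map_add, map_smul, map_smul, map_smul, map_smul, ← hv', h6, hk,
    smul_add, smul_comm k, smul_comm k]

/-- A curvature line, in a parametrized patch. -/
structure IsCurvatureLine (U : Set Plane) (r ν : Plane → Space) (τ : ℝ) (w w' : ℝ → Plane) :
    Prop where
  pos : 0 < τ
  mem : ∀ t ∈ Icc 0 τ, w t ∈ U
  hasDeriv : ∀ t ∈ Icc 0 τ, HasDerivWithinAt w (w' t) (Icc 0 τ) t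
  continuous : ContinuousWithinAt w' (Icc 0 τ) 0
  principal : ∀ t ∈ Icc 0 τ, ∃ k : ℝ, fderiv ℝ ν (w t) (w' t) = k • fderiv ℝ r (w t) (w' t)

/-- Where dν w' is parallel to dr w', the triple product ⟨ν, dr w' × dν w'⟩ vanishes. In coordinates
along v and its rotation this is a quadratic form in the velocity. -/
lemma IsCurvatureLine.isQuadraticSolution {τ : ℝ} {w w' : ℝ → Plane} {v : Plane}
    (hw : IsCurvatureLine U r ν τ w w') (h0 : w 0 = u) (hv : v ≠ 0) {κ : ℝ} (hκ : 0 < κ)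
    (hv0 : w' 0 = κ • v) :
    IsQuadraticSolution
      (fun p => ⟪ν (u + p.1 • v + p.2 • planeRot v),
        cross (fderiv ℝ r (u + p.1 • v + p.2 • planeRot v) v)
          (fderiv ℝ ν (u + p.1 • v + p.2 • planeRot v) v)⟫)
      (fun p => ⟪ν (u + p.1 • v + p.2 • planeRot v),
        cross (fderiv ℝ r (u + p.1 • v + p.2 • planeRot v) v)
          (fderiv ℝ ν (u + p.1 • v + p.2 • planeRot v) (planeRot v))⟫ +
        ⟪ν (u + p.1 • v + p.2 • planeRot v),
        cross (fderiv ℝ r (u + p.1 • v + p.2 • planeRot v) (planeRot v))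
          (fderiv ℝ ν (u + p.1 • v + p.2 • planeRot v) v)⟫)
      (fun p => ⟪ν (u + p.1 • v + p.2 • planeRot v),
        cross (fderiv ℝ r (u + p.1 • v + p.2 • planeRot v) (planeRot v))
          (fderiv ℝ ν (u + p.1 • v + p.2 • planeRot v) (planeRot v))⟫)
      τ (fun t => ⟪v, w t - u⟫ / ‖v‖ ^ 2) (fun t => ⟪planeRot v, w t - u⟫ / ‖v‖ ^ 2)
      (fun t => ⟪v, w' t⟫ / ‖v‖ ^ 2) (fun t => ⟪planeRot v, w' t⟫ / ‖v‖ ^ 2) where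
  pos := hw.pos
  hasDeriv_fst t ht := by
    have := ((hasDerivWithinAt_const t (Icc 0 τ) v).inner ℝ
      ((hw.hasDeriv t ht).sub_const u)).div_const (‖v‖ ^ 2)
    simpa using this
  hasDeriv_snd t ht := by
    have := ((hasDerivWithinAt_const t (Icc 0 τ) (planeRot v)).inner ℝ
      ((hw.hasDeriv t ht).sub_const u)).div_const (‖v‖ ^ 2)
    simpa using this
  continuous_fst := (continuousWithinAt_const.inner hw.continuous).div_const _
  continuous_snd := (continuousWithinAt_const.inner hw.continuous).div_const _
  fst_zero := by simp [h0]
  snd_zero := by simp [h0]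
  deriv_fst_pos := by
    rw [hv0, inner_smul_right, real_inner_self_eq_norm_sq]
    have := norm_pos_iff.2 hv
    positivity
  deriv_snd_zero := by
    rw [hv0, inner_smul_right]
    have : ⟪planeRot v, v⟫ = 0 := by rw [plane_inner]; simp [planeRot]; ring
    rw [this]; simp
  eq_zero t ht := by
    have hwt : u + (⟪v, w t - u⟫ / ‖v‖ ^ 2) • v +
        (⟪planeRot v, w t - u⟫ / ‖v‖ ^ 2) • planeRot v = w t := by
      rw [add_assoc, ← eq_combination hv]; abel
    simp only [hwt]
    rw [← inner_cross_combination, ← map_smul, ← map_smul, ← map_smul, ← map_smul, ← map_add,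
      ← map_add, ← eq_combination hv]
    obtain ⟨k, hk⟩ := hw.principal t ht
    rw [hk, inner_cross_smul_self]

/-- Two curvature lines that start in the same direction at a point that is not umbilical meet
again. -/
lemma IsCurvatureLine.exists_eq (h : IsPatch U r ν) (hu : u ∈ U)
    (humb : ¬ ∃ k : ℝ, ∀ w, fderiv ℝ ν u w = k • fderiv ℝ r u w)
    {τ₁ τ₂ : ℝ} {w₁ w₁' w₂ w₂' : ℝ → Plane} (h₁ : IsCurvatureLine U r ν τ₁ w₁ w₁')
    (h₂ : IsCurvatureLine U r ν τ₂ w₂ w₂') (h₁0 : w₁ 0 = u) (h₂0 : w₂ 0 = u)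
    (hne : w₁' 0 ≠ 0) {κ : ℝ} (hκ : 0 < κ) (hpar : w₂' 0 = κ • w₁' 0) :
    ∃ t₁ ∈ Ioo 0 τ₁, ∃ t₂ ∈ Ioo 0 τ₂, w₁ t₁ = w₂ t₂ := by
  set v := w₁' 0 with hv
  have q₁ := h₁.isQuadraticSolution h₁0 hne (κ := 1) one_pos (by simp [hv])
  have q₂ := h₂.isQuadraticSolution h₂0 hne hκ hpar
  set Φ : ℝ × ℝ → Plane := fun p => u + p.1 • v + p.2 • planeRot v with hΦ
  have hΦ0 : Φ 0 = u := by simp [hΦ]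
  have hΦd : ContDiffAt ℝ 1 Φ 0 := by
    have : ContDiff ℝ 1 Φ := by
      rw [hΦ]; fun_prop
    exact this.contDiffAt
  have hsm : ∀ α β : Plane, ContDiffAt ℝ 1
      (fun p => ⟪ν (Φ p), cross (fderiv ℝ r (Φ p) α) (fderiv ℝ ν (Φ p) β)⟫) 0 := by
    intro α β
    have := h.contDiffAt_inner_cross hu α β
    rw [← hΦ0] at this
    exact this.comp (0 : ℝ × ℝ) hΦd
  have ha := hsm v v
  have hb := (hsm v (planeRot v)).add (hsm (planeRot v) v)
  have hc := hsm (planeRot v) (planeRot v)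
  obtain ⟨Ka, sa, hsa, hla⟩ := ha.exists_lipschitzOnWith
  obtain ⟨Kb, sb, hsb, hlb⟩ := hb.exists_lipschitzOnWith
  obtain ⟨Kc, sc, hsc, hlc⟩ := hc.exists_lipschitzOnWith
  have hLip : ∀ {f : ℝ × ℝ → ℝ} {K : NNReal} {s : Set (ℝ × ℝ)}, LipschitzOnWith K f s →
      K ≤ Ka + Kb + Kc → sa ∩ (sb ∩ sc) ⊆ s → ∀ x y y', (x, y) ∈ sa ∩ (sb ∩ sc) →
        (x, y') ∈ sa ∩ (sb ∩ sc) → |f (x, y) - f (x, y')| ≤ ((Ka + Kb + Kc : NNReal) : ℝ) * |y - y'| := by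
    intro f K s hf hK hs x y y' h1 h2
    have := hf.dist_le_mul _ (hs h1) _ (hs h2)
    rw [Real.dist_eq, Prod.dist_eq, dist_self, Real.dist_eq, max_eq_right (abs_nonneg _)] at this
    exact this.trans (by gcongr)
  obtain ⟨k, hk⟩ := h₁.principal 0 ⟨le_rfl, h₁.pos.le⟩
  rw [h₁0, ← hv] at hk
  obtain ⟨t₁, ht₁, t₂, ht₂, hx, hy⟩ := q₁.exists_eq q₂
    (Filter.inter_mem hsa (Filter.inter_mem hsb hsc)) (Λ := ((Ka + Kb + Kc : NNReal) : ℝ))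
    (hLip hla (by rw [add_assoc]; exact le_self_add) inter_subset_left)
    (hLip hlb (by rw [add_right_comm]; exact le_add_self)
      (inter_subset_right.trans inter_subset_left))
    (hLip hlc le_add_self (inter_subset_right.trans inter_subset_right))
    hb.continuousAt hc.continuousAt (by
      have := h.inner_cross_add_ne_zero hu humb hne hk
      rw [← hΦ0] at this
      exact this)
  refine ⟨t₁, ht₁, t₂, ht₂, ?_⟩
  have e₁ := eq_combination hne (w₁ t₁ - u)
  rw [hx, hy, ← eq_combination hne] at e₁
  exact sub_left_injective e₁

end IsPatch

/-! ### The edges of a discrete net of curvature lines -/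

lemma ImmersedSurface.IsPrincipal.neg {M : Type u} [TopologicalSpace M]
    [ChartedSpace Plane M] {S : ImmersedSurface M} {x : M} {w : Space} (h : S.IsPrincipal x w) :
    S.IsPrincipal x (-w) := by
  obtain ⟨h0, v, k, hv, hk⟩ := h
  refine ⟨neg_ne_zero.2 h0, -v, k, by rw [map_neg, hv], ?_⟩
  rw [ImmersedSurface.IsShape, smul_neg, map_neg, map_neg, hk]

namespace DiscreteNet

variable {M : Type u} [TopologicalSpace M] [ChartedSpace Plane M]
  [Topology.CWComplex (univ : Set M)] {S : ImmersedSurface M} {N : DiscreteNet S}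

lemma path_true (i : N.Edge) : N.path (i, true) = N.param i := by
  funext t; simp [path]

lemma path_false (i : N.Edge) : N.path (i, false) = N.param i ∘ fun t => 1 - t := by
  funext t; simp [path]

lemma one_sub_mem {t : ℝ} (ht : t ∈ Icc (0 : ℝ) 1) : 1 - t ∈ Icc (0 : ℝ) 1 :=
  ⟨by linarith [ht.2], by linarith [ht.1]⟩

lemma contMDiffOn_path (a : N.Edge × Bool) :
    ContMDiffOn 𝓘(ℝ, ℝ) (𝓡 2) ∞ (N.path a) (Icc 0 1) := by
  obtain ⟨i, b⟩ := a
  cases b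
  · rw [path_false]
    refine (N.contMDiffOn_param i).comp (t := Icc 0 1) ?_ fun t ht => one_sub_mem ht
    have : ContDiff ℝ ∞ fun t : ℝ => 1 - t := by fun_prop
    exact this.contMDiff.contMDiffOn
  · rw [path_true]
    exact N.contMDiffOn_param i

lemma contDiffOn_pos_path (a : N.Edge × Bool) : ContDiffOn ℝ ∞ (S.pos ∘ N.path a) (Icc 0 1) :=
  contMDiffOn_iff_contDiffOn.1 (S.contMDiff_pos.comp_contMDiffOn (contMDiffOn_path a))

lemma hasDerivWithinAt_pos_path (a : N.Edge × Bool) {t : ℝ} (ht : t ∈ Icc (0 : ℝ) 1) :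
    HasDerivWithinAt (S.pos ∘ N.path a) (derivWithin (S.pos ∘ N.path a) (Icc 0 1) t)
      (Icc 0 1) t :=
  (((contDiffOn_pos_path a).differentiableOn (by simp)) t ht).hasDerivWithinAt

lemma continuousOn_deriv_pos_path (a : N.Edge × Bool) :
    ContinuousOn (derivWithin (S.pos ∘ N.path a) (Icc 0 1)) (Icc 0 1) :=
  (contDiffOn_pos_path a).continuousOn_derivWithin (uniqueDiffOn_Icc zero_lt_one) (by simp)

lemma derivWithin_pos_path_false (i : N.Edge) {t : ℝ} (ht : t ∈ Icc (0 : ℝ) 1) :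
    derivWithin (S.pos ∘ N.path (i, false)) (Icc 0 1) t =
      -derivWithin (S.pos ∘ N.param i) (Icc 0 1) (1 - t) := by
  have h1 := hasDerivWithinAt_pos_path (i, true) (one_sub_mem ht)
  rw [path_true] at h1
  have h2 : HasDerivWithinAt (fun t : ℝ => 1 - t) (-1) (Icc 0 1) t :=
    ((hasDerivAt_id t).const_sub 1).hasDerivWithinAt
  have h3 := h1.scomp t h2 fun t ht => one_sub_mem ht
  rw [neg_one_smul] at h3
  rw [path_false]
  exact h3.derivWithin (uniqueDiffOn_Icc zero_lt_one t ht)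

lemma deriv_pos_path_ne (a : N.Edge × Bool) {t : ℝ} (ht : t ∈ Icc (0 : ℝ) 1) :
    derivWithin (S.pos ∘ N.path a) (Icc 0 1) t ≠ 0 := by
  obtain ⟨i, b⟩ := a
  cases b
  · rw [derivWithin_pos_path_false i ht, neg_ne_zero]
    exact N.deriv_param_ne i _ (one_sub_mem ht)
  · rw [path_true]
    exact N.deriv_param_ne i t ht

lemma IsCurvatureLineNet.principal_path (hN : N.IsCurvatureLineNet) (a : N.Edge × Bool) {t : ℝ}
    (ht : t ∈ Icc (0 : ℝ) 1) :
    S.IsPrincipal (N.path a t) (derivWithin (S.pos ∘ N.path a) (Icc 0 1) t) := by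
  obtain ⟨i, b⟩ := a
  cases b
  · rw [derivWithin_pos_path_false i ht, path_false]
    exact (hN.principal i _ (one_sub_mem ht)).neg
  · rw [path_true]
    exact hN.principal i t ht

lemma path_mem_openCell (a : N.Edge × Bool) {t : ℝ} (ht : t ∈ Ioo (0 : ℝ) 1) :
    N.path a t ∈ Topology.RelCWComplex.openCell (C := (univ : Set M)) 1 a.1 := by
  rw [← N.image_Ioo]
  obtain ⟨i, b⟩ := a
  cases b
  · rw [path_false]
    exact ⟨1 - t, ⟨by linarith [ht.2], by linarith [ht.1]⟩, rfl⟩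
  · rw [path_true]
    exact ⟨t, ht, rfl⟩

variable {v : N.Vertex}

/-- Distinct edges emanating from a vertex do not meet in their interiors. -/
lemma path_ne_path {d d' : N.Star v} (h : d ≠ d') {s t : ℝ} (hs : s ∈ Ioo (0 : ℝ) 1)
    (ht : t ∈ Ioo (0 : ℝ) 1) : N.path d.1 s ≠ N.path d'.1 t := by
  intro heq
  have h1 := path_mem_openCell d.1 hs
  have h2 := path_mem_openCell d'.1 ht
  rw [← heq] at h2
  have hcell : d.1.1 = d'.1.1 := by
    by_contra hne
    have hdis := Topology.RelCWComplex.disjoint_openCell_of_ne (C := (univ : Set M)) (n := 1)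
      (m := 1) (i := d.1.1) (j := d'.1.1) (by
        intro h; exact hne (by simpa using h))
    exact (Set.disjoint_left.1 hdis) h1 h2
  have hp := d.2
  have hp' := d'.2
  obtain ⟨⟨i, b⟩, hd⟩ := d
  obtain ⟨⟨j, b'⟩, hd'⟩ := d'
  simp only at hcell
  subst hcell
  have hb : b ≠ b' := by
    rintro rfl; exact h rfl
  -- The same cell traversed both ways from one vertex would be a loop.
  have key : N.param i 0 = N.param i 1 := by
    rcases b with _ | _ <;> rcases b' with _ | _
    · exact absurd rfl hb
    · simp [path] at hd hd'; rw [hd, hd']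
    · simp [path] at hd hd'; rw [hd, hd']
    · exact absurd rfl hb
  have := N.injOn_param i ⟨le_rfl, zero_le_one⟩ ⟨zero_le_one, le_rfl⟩ key
  norm_num at this

lemma velocity_ne (d : N.Star v) : velocity d ≠ 0 :=
  deriv_pos_path_ne d.1 ⟨le_rfl, zero_le_one⟩

lemma isPrincipal_velocity (hN : N.IsCurvatureLineNet) (d : N.Star v) :
    S.IsPrincipal (N.point v) (velocity d) := by
  rw [← d.2]
  exact hN.principal_path d.1 ⟨le_rfl, zero_le_one⟩

lemma norm_edgeVec_le_length (d : N.Star v) : ‖edgeVec d‖ ≤ length d :=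
  norm_sub_le_integral_norm_deriv (c := S.pos ∘ N.path d.1)
    (fun _ ht => hasDerivWithinAt_pos_path d.1 ht) (continuousOn_deriv_pos_path d.1)
    le_rfl zero_le_one le_rfl

lemma length_pos (d : N.Star v) : 0 < length d := by
  have h1 : (0 : ℝ) ≤ length d := intervalIntegral.integral_nonneg zero_le_one
    fun _ _ => norm_nonneg _
  refine h1.lt_of_ne fun h0 => ?_
  have h2 := norm_edgeVec_le_length d
  rw [← h0] at h2
  have h3 : ∀ t ∈ Ioc (0 : ℝ) 1, (fun _ => (0 : ℝ)) t ≤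
      ‖derivWithin (S.pos ∘ N.path d.1) (Icc 0 1) t‖ := fun _ _ => norm_nonneg _
  have h4 := intervalIntegral.integral_pos (a := 0) (b := 1) zero_lt_one
    (f := fun t => ‖derivWithin (S.pos ∘ N.path d.1) (Icc 0 1) t‖)
    (continuousOn_deriv_pos_path d.1).norm h3
    ⟨0, ⟨le_rfl, zero_le_one⟩, norm_pos_iff.2 (deriv_pos_path_ne d.1 ⟨le_rfl, zero_le_one⟩)⟩
  exact h4.ne h0

variable [IsManifold (𝓡 2) ∞ M]

/-- In the chart at a vertex, an edge starts as a curvature line of the patch. -/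
lemma exists_isCurvatureLine (hN : N.IsCurvatureLineNet) (d : N.Star v) :
    ∃ τ < 1, ∃ w' : ℝ → Plane,
      (∀ t ∈ Icc 0 τ, N.path d.1 t ∈ (extChartAt (𝓡 2) (N.point v)).source) ∧
      IsPatch.IsCurvatureLine (extChartAt (𝓡 2) (N.point v)).target (S.chartPos (N.point v))
        (S.chartNormal (N.point v)) τ (extChartAt (𝓡 2) (N.point v) ∘ N.path d.1) w' ∧
      fderiv ℝ (S.chartPos (N.point v)) (extChartAt (𝓡 2) (N.point v) (N.point v)) (w' 0) =
        velocity d := by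
  set φ := extChartAt (𝓡 2) (N.point v) with hφ
  have hP := S.isPatch (N.point v)
  have h01 : (0 : ℝ) ∈ Icc (0 : ℝ) 1 := ⟨le_rfl, zero_le_one⟩
  obtain ⟨τ, hτ0, hτ1, hsrc⟩ : ∃ τ, 0 < τ ∧ τ < 1 ∧ ∀ t ∈ Icc 0 τ, N.path d.1 t ∈ φ.source := by
    have h1 : ∀ᶠ t in 𝓝[Icc 0 1] 0, N.path d.1 t ∈ φ.source := by
      refine ((contMDiffOn_path d.1).continuousOn 0 h01).eventually ?_
      rw [d.2]
      exact (isOpen_extChartAt_source (N.point v)).mem_nhds (mem_extChartAt_source _)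
    rw [nhdsWithin_Icc_eq_nhdsGE zero_lt_one] at h1
    obtain ⟨u, hu, hsub⟩ := (mem_nhdsGE_iff_exists_Icc_subset).1 h1
    replace hu : 0 < u := hu
    exact ⟨min u (1 / 2), lt_min hu (by norm_num), (min_le_right _ _).trans_lt (by norm_num),
      fun t ht => hsub ⟨ht.1, ht.2.trans (min_le_left _ _)⟩⟩
  have hsub : Icc 0 τ ⊆ Icc 0 1 := Icc_subset_Icc le_rfl hτ1.le
  have hsm : ContDiffOn ℝ ∞ (φ ∘ N.path d.1) (Icc 0 τ) := by
    refine contMDiffOn_iff_contDiffOn.1 (ContMDiffOn.comp (t := φ.source) ?_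
      ((contMDiffOn_path d.1).mono hsub) hsrc)
    rw [hφ, extChartAt_source]
    exact contMDiffOn_extChartAt
  have hud := uniqueDiffOn_Icc hτ0
  have hd : ∀ t ∈ Icc 0 τ, HasDerivWithinAt (φ ∘ N.path d.1)
      (derivWithin (φ ∘ N.path d.1) (Icc 0 τ) t) (Icc 0 τ) t := fun t ht =>
    ((hsm.differentiableOn (by simp)) t ht).hasDerivWithinAt
  have hchain : ∀ t ∈ Icc 0 τ, fderiv ℝ (S.chartPos (N.point v)) (φ (N.path d.1 t))
      (derivWithin (φ ∘ N.path d.1) (Icc 0 τ) t) =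
      derivWithin (S.pos ∘ N.path d.1) (Icc 0 1) t := by
    intro t ht
    have h1 := (hP.hasFDerivAt_pos (φ.map_source (hsrc t ht))).comp_hasDerivWithinAt t (hd t ht)
    have h2 : ∀ s ∈ Icc 0 τ, (S.pos ∘ N.path d.1) s =
        (S.chartPos (N.point v) ∘ (φ ∘ N.path d.1)) s := by
      intro s hs
      simp only [Function.comp, ImmersedSurface.chartPos, ← hφ, φ.left_inv (hsrc s hs)]
    have h3 := h1.congr h2 (h2 t ht)
    have h4 := (hasDerivWithinAt_pos_path d.1 (hsub ht)).mono hsub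
    rw [← h3.derivWithin (hud t ht), h4.derivWithin (hud t ht)]
  refine ⟨τ, hτ1, derivWithin (φ ∘ N.path d.1) (Icc 0 τ), hsrc, ⟨hτ0,
    fun t ht => φ.map_source (hsrc t ht), hd, ?_, fun t ht => ?_⟩, ?_⟩
  · exact hsm.continuousOn_derivWithin hud (by simp) 0 ⟨le_rfl, hτ0.le⟩
  · obtain ⟨-, z, k, hz, hk⟩ := hN.principal_path d.1 (hsub ht)
    have h1 : chartDiff (N.point v) (N.path d.1 t) z =
        derivWithin (φ ∘ N.path d.1) (Icc 0 τ) t := by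
      apply hP.injective _ (φ.map_source (hsrc t ht))
      rw [hchain t ht, ← hz, S.dpos_eq (hsrc t ht)]
    -- The sign comes from the shape operator being minus the differential of the normal.
    refine ⟨-k, ?_⟩
    rw [ImmersedSurface.IsShape, map_smul, S.dpos_eq (hsrc t ht), S.dnormal_eq (hsrc t ht), h1,
      ← hφ] at hk
    rw [neg_smul, Function.comp, hk, neg_neg]
  · have := hchain 0 ⟨le_rfl, hτ0.le⟩
    rwa [d.2] at this

/-- Distinct edges emanating from a vertex that is not umbilical start in distinct directions. -/
lemma velocity_ne_smul (hN : N.IsCurvatureLineNet) (humb : ¬ S.IsUmbilic (N.point v))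
    {d d' : N.Star v} (h : d ≠ d') {κ : ℝ} (hκ : 0 < κ) : velocity d' ≠ κ • velocity d := by
  intro heq
  set φ := extChartAt (𝓡 2) (N.point v) with hφ
  have hP := S.isPatch (N.point v)
  have hsrc := mem_extChartAt_source (I := 𝓡 2) (N.point v)
  have hu := φ.map_source hsrc
  obtain ⟨τ, hτ, w, hs, hw, hv⟩ := exists_isCurvatureLine hN d
  obtain ⟨τ', hτ', w', hs', hw', hv'⟩ := exists_isCurvatureLine hN d'
  have humb' : ¬ ∃ k : ℝ, ∀ z, fderiv ℝ (S.chartNormal (N.point v)) (φ (N.point v)) z =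
      k • fderiv ℝ (S.chartPos (N.point v)) (φ (N.point v)) z := by
    rintro ⟨k, hk⟩
    refine humb ⟨-k, fun z => ?_⟩
    rw [ImmersedSurface.IsShape, map_smul, S.dpos_eq hsrc, S.dnormal_eq hsrc, ← hφ, hk, neg_smul]
  obtain ⟨t, ht, t', ht', hmeet⟩ := IsPatch.IsCurvatureLine.exists_eq hP hu humb' hw hw'
    (by rw [Function.comp, d.2]) (by rw [Function.comp, d'.2])
    (by
      intro h0
      rw [h0, map_zero] at hv
      exact velocity_ne d hv.symm) hκ (by
      apply hP.injective _ hu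
      rw [map_smul, hv, hv', heq])
  refine path_ne_path h (s := t) (t := t') ⟨ht.1, ht.2.trans hτ⟩ ⟨ht'.1, ht'.2.trans hτ'⟩ ?_
  exact φ.injOn (hs t (Ioo_subset_Icc_self ht)) (hs' t' (Ioo_subset_Icc_self ht')) hmeet

end DiscreteNet

/-! ### Principal directions and the edges at a vertex -/

lemma eq_smul_cross {n w z : Space} (hn : n ≠ 0) (hw : w ≠ 0) (hnw : ⟪n, w⟫ = 0)
    (h₁ : ⟪n, z⟫ = 0) (h₂ : ⟪w, z⟫ = 0) :
    z = (⟪cross n w, z⟫ / ‖cross n w‖ ^ 2) • cross n w := by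
  have hm : ‖cross n w‖ ^ 2 = ‖n‖ ^ 2 * ‖w‖ ^ 2 := by rw [norm_cross_sq, hnw]; ring
  have hpos : 0 < ‖cross n w‖ ^ 2 := by
    rw [hm]
    have := norm_pos_iff.2 hn
    have := norm_pos_iff.2 hw
    positivity
  have hsq := inner_cross_sq z n w
  rw [real_inner_comm n z, real_inner_comm w z, h₁, h₂, hnw, real_inner_comm] at hsq
  have hsq' : ⟪cross n w, z⟫ ^ 2 = ‖z‖ ^ 2 * ‖cross n w‖ ^ 2 := by rw [hsq, hm]; ring
  rw [← sub_eq_zero, ← norm_eq_zero, ← pow_eq_zero_iff (two_ne_zero), norm_sub_sq_real,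
    inner_smul_right, norm_smul, mul_pow, Real.norm_eq_abs, sq_abs,
    real_inner_comm (cross n w) z, div_pow]
  generalize ⟪cross n w, z⟫ = a at hsq' ⊢
  generalize ‖cross n w‖ ^ 2 = b at hsq' hpos ⊢
  field_simp
  rw [hsq']
  ring

namespace ImmersedSurface

variable {M : Type u} [TopologicalSpace M] [ChartedSpace Plane M] {S : ImmersedSurface M}

lemma IsPrincipal.inner_normal {x : M} {w : Space} (h : S.IsPrincipal x w) :
    ⟪S.normal x, w⟫ = 0 := by
  obtain ⟨-, v, -, rfl, -⟩ := h
  exact S.inner_normal x v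

lemma normal_ne_zero (x : M) : S.normal x ≠ 0 := by
  rw [← norm_ne_zero_iff, S.norm_normal]; norm_num

variable [IsManifold (𝓡 2) ∞ M]

/-- At a point that is not umbilical, two principal directions are parallel or orthogonal. -/
lemma IsPrincipal.parallel_or_orthogonal {x : M} (humb : ¬ S.IsUmbilic x) {w₁ w₂ : Space}
    (h₁ : S.IsPrincipal x w₁) (h₂ : S.IsPrincipal x w₂) :
    (∃ c : ℝ, c ≠ 0 ∧ w₂ = c • w₁) ∨ ⟪w₁, w₂⟫ = 0 := by
  obtain ⟨hw₁, v₁, k₁, rfl, hk₁⟩ := h₁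
  obtain ⟨hw₂, v₂, k₂, rfl, hk₂⟩ := h₂
  rw [IsShape, map_smul] at hk₁ hk₂
  by_cases hk : k₁ = k₂
  · left
    by_cases hpar : ∃ c : ℝ, c • v₁ = v₂
    · obtain ⟨c, rfl⟩ := hpar
      refine ⟨c, ?_, map_smul _ _ _⟩
      rintro rfl
      exact hw₂ (by rw [zero_smul, map_zero])
    · exfalso
      push Not at hpar
      have hv₁ : v₁ ≠ 0 := by
        rintro rfl; exact hw₁ (map_zero _)
      have hind : LinearIndependent ℝ ![v₁, v₂] := (LinearIndependent.pair_iff' hv₁).2 hpar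
      have hfin : Module.finrank ℝ (TangentSpace (𝓡 2) x) = 2 :=
        (finrank_euclideanSpace_fin : Module.finrank ℝ Plane = 2)
      have hspan := hind.span_eq_top_of_card_eq_finrank (by rw [hfin]; simp)
      refine humb ⟨k₁, fun v => ?_⟩
      have hv : v ∈ Submodule.span ℝ (range ![v₁, v₂]) := by rw [hspan]; trivial
      rw [Matrix.range_cons, Matrix.range_cons, Matrix.range_empty, union_empty,
        singleton_union, Submodule.mem_span_pair] at hv
      obtain ⟨a, b, rfl⟩ := hv
      rw [IsShape, map_smul, map_add, map_add, map_smul, map_smul, map_smul, map_smul, smul_add,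
        smul_comm k₁, smul_comm k₁, hk₁, hk, hk₂]
      simp only [neg_add, smul_neg]
  · right
    have h := S.inner_dnormal_comm x v₁ v₂
    rw [neg_eq_iff_eq_neg.1 hk₁.symm, neg_eq_iff_eq_neg.1 hk₂.symm, inner_neg_left, inner_neg_left,
      inner_smul_left, inner_smul_left, real_inner_comm (S.dpos x v₁) (S.dpos x v₂)] at h
    simp only [conj_trivial] at h
    have h' : (k₁ - k₂) * ⟪S.dpos x v₁, S.dpos x v₂⟫ = 0 := by linarith
    exact (mul_eq_zero.1 h').resolve_left (sub_ne_zero.2 hk)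

end ImmersedSurface

namespace DiscreteNet

variable {M : Type u} [TopologicalSpace M] [ChartedSpace Plane M]
  [Topology.CWComplex (univ : Set M)] {S : ImmersedSurface M} {N : DiscreteNet S} {v : N.Vertex}

/-- Among any three edges at a vertex that is not umbilical, one is associated with a given
principal direction. -/
lemma exists_mem_associated [IsManifold (𝓡 2) ∞ M] (hN : N.IsCurvatureLineNet)
    (humb : ¬ S.IsUmbilic (N.point v)) {w : Space} (hw : S.IsPrincipal (N.point v) w)
    {D : Set (N.Star v)} (hD : 3 ≤ D.ncard) : ∃ d ∈ D, Associated d w := by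
  classical
  by_contra hcon
  push Not at hcon
  set n := S.normal (N.point v) with hn
  have hn0 : n ≠ 0 := ImmersedSurface.normal_ne_zero _
  set m := cross n w with hm
  have hperp : ∀ d ∈ D, ∃ c : ℝ, c ≠ 0 ∧ velocity d = c • m := by
    intro d hd
    have hp := isPrincipal_velocity hN d
    rcases hw.parallel_or_orthogonal humb hp with h | h
    · exact absurd h (hcon d hd)
    · have h1 := eq_smul_cross hn0 hw.1 hw.inner_normal hp.inner_normal h
      refine ⟨_, ?_, h1⟩
      intro h0
      rw [h0, zero_smul] at h1
      exact velocity_ne d h1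
  choose! c hc0 hc using hperp
  -- All velocities would be multiples of the single direction m. Two edges with multipliers of the
  -- same sign would leave in the same direction, so there are at most two edges.
  have hinj : InjOn (fun d => decide (0 < c d)) D := by
    intro d hd d' hd' h
    by_contra hne
    have hsign : 0 < c d' / c d := by
      rcases (hc0 d hd).lt_or_gt with h1 | h1 <;> rcases (hc0 d' hd').lt_or_gt with h2 | h2
      · exact div_pos_of_neg_of_neg h2 h1
      · simp [h2, not_lt.2 h1.le] at h
      · simp [h1, not_lt.2 h2.le] at h
      · exact div_pos h2 h1
    refine velocity_ne_smul hN humb hne hsign ?_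
    rw [hc d hd, hc d' hd', smul_smul, div_mul_cancel₀ _ (hc0 d hd)]
  have hle := Set.ncard_le_ncard_of_injOn (t := (univ : Set Bool)) _ (fun _ _ => mem_univ _) hinj
  rw [Set.ncard_univ, Nat.card_eq_fintype_card, Fintype.card_bool] at hle
  omega

/-! ### Regularity, orientation and Delaunay edges of a vertex star. -/

section Star

variable {σ : Equiv.Perm (N.Star v)} {ε ρ : ℝ}

lemma IsMaxLength.pos (h : N.IsMaxLength v ε) : 0 < ε := by
  obtain ⟨d, rfl⟩ := h.1
  exact length_pos d

lemma IsMaxLength.length_le (h : N.IsMaxLength v ε) (d : N.Star v) : length d ≤ ε :=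
  h.2 ⟨d, rfl⟩

/-- The defining inequality bounds only the first edge of a pair from below, so it is used in both
orders. -/
lemma shapeRegular (hσ : IsCyclicOrder σ) (hε : N.IsMaxLength v ε)
    (hρ : N.IsShapeRegularity v ε ρ) (d : N.Star v) :
    ShapeRegular ε ρ (edgeVec d) (edgeVec (σ d)) := by
  have h1 := hρ.1.2 d (σ d) ((hσ.2 _ _).2 (Or.inl rfl))
  have h2 := hρ.1.2 (σ d) d ((hσ.2 _ _).2 (Or.inr rfl))
  exact ⟨hε.pos, hρ.1.1, (norm_edgeVec_le_length d).trans (hε.length_le d),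
    (norm_edgeVec_le_length (σ d)).trans (hε.length_le (σ d)), h1.1, h2.1, h1.2⟩

lemma shapeRegular_symm (hσ : IsCyclicOrder σ) (hε : N.IsMaxLength v ε)
    (hρ : N.IsShapeRegularity v ε ρ) (d : N.Star v) :
    ShapeRegular ε ρ (edgeVec d) (edgeVec (σ.symm d)) := by
  have := (shapeRegular hσ hε hρ (σ.symm d)).symm
  rwa [Equiv.apply_symm_apply] at this

/-- `Nat.card` is zero on infinite types, so a positive valence forces finiteness. -/
lemma IsCurvatureLineNet.finite_star (hN : N.IsCurvatureLineNet) (v : N.Vertex) :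
    Finite (N.Star v) := by
  refine Nat.finite_of_card_ne_zero (?_ : N.valence v ≠ 0)
  by_cases h : S.IsUmbilic (N.point v)
  · have := hN.two_lt_valence v h; omega
  · have := hN.valence_eq v h; omega

/-- Opposite sides at every edge means that consecutive triangles have the same orientation. The
sign propagates along the single cycle, and replacing the normal by its negative makes it positive.
-/
lemma exists_normal_pos (hσ : IsCyclicOrder σ) (ho : IsOriented σ) [Nonempty (N.Star v)] :
    ∃ n : Space, (n = S.normal (N.point v) ∨ n = -S.normal (N.point v)) ∧
      ∀ d, 0 < ⟪n, cross (edgeVec d) (edgeVec (σ d))⟫ := by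
  set g : N.Star v → ℝ := fun d => ⟪S.normal (N.point v), cross (edgeVec d) (edgeVec (σ d))⟫ with hg
  have hgg : ∀ d, 0 < g (σ d) * g d := by
    intro d
    have h1 := ho (σ d)
    rw [Equiv.symm_apply_apply, inner_cross_comm _ (edgeVec (σ d)) (edgeVec d)] at h1
    change g (σ d) * -g d < 0 at h1
    linarith
  have hiff : ∀ d, 0 < g (σ d) ↔ 0 < g d := by
    intro d
    exact ⟨fun h => pos_of_mul_pos_right (hgg d) h.le,
      fun h => pos_of_mul_pos_left (hgg d) h.le⟩
  have hpow : ∀ (k : ℤ) d, 0 < g ((σ ^ k) d) ↔ 0 < g d := by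
    intro k
    induction k with
    | zero => simp
    | succ k ih => intro d; rw [zpow_add_one, Equiv.Perm.mul_apply, ih, hiff]
    | pred k ih =>
      intro d
      rw [zpow_sub_one, Equiv.Perm.mul_apply, ih, ← hiff (σ⁻¹ d), show σ (σ⁻¹ d) = d from σ.apply_symm_apply d]
  have hall : ∀ d d', 0 < g d ↔ 0 < g d' := by
    intro d d'
    obtain ⟨k, rfl⟩ := hσ.1 d d'
    exact (hpow k d).symm
  obtain ⟨d₀⟩ := ‹Nonempty (N.Star v)›
  have hne : ∀ d, g d ≠ 0 := by
    intro d h0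
    have := hgg d
    rw [h0] at this; simp at this
  rcases (hne d₀).lt_or_gt with h | h
  · refine ⟨_, Or.inr rfl, fun d => ?_⟩
    rw [inner_neg_left]
    have h1 : ¬ 0 < g d := fun h' => absurd ((hall d d₀).1 h') (not_lt.2 h.le)
    have h2 := (not_lt.1 h1).lt_of_ne (hne d)
    linarith
  · exact ⟨_, Or.inl rfl, fun d => (hall d d₀).2 h⟩

variable [IsManifold (𝓡 2) ∞ M] [T2Space M] [CompactSpace M]

lemma abs_inner_normal_edgeVec_le {K : ℝ} (hK : S.IsCurvatureBound K) (hε : N.IsMaxLength v ε)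
    (hKε : K * ε ≤ 1 / 16) (d : N.Star v) :
    |⟪S.normal (N.point v), edgeVec d⟫| ≤ 3 / 2 * (K * ε) * ‖edgeVec d‖ := by
  have hK0 := hK.nonneg
  have h1 : K * length d ≤ K * ε := mul_le_mul_of_nonneg_left (hε.length_le d) hK0
  have h2 := S.abs_inner_normal_chord_le hK (contMDiffOn_path d.1).continuousOn
    (fun t ht => hasDerivWithinAt_pos_path d.1 ht) (continuousOn_deriv_pos_path d.1)
    (fun t ht => deriv_pos_path_ne d.1 ht) (h1.trans hKε)
  rw [d.2] at h2
  change |⟪_, S.pos (N.path d.1 1) - S.pos (N.path d.1 0)⟫| ≤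
    _ * ‖S.pos (N.path d.1 1) - S.pos (N.path d.1 0)‖
  rw [d.2]
  refine h2.trans ?_
  gcongr
  exact hε.length_le d

lemma three_le_ncard_isDelaunay (hv : N.valence v = 4) (hσ : IsCyclicOrder σ)
    (ho : IsOriented σ) {K : ℝ} (hK : S.IsCurvatureBound K) (hε : N.IsMaxLength v ε)
    (hρ : N.IsShapeRegularity v ε ρ) (hKε : K * ε ≤ 1 / (16 * ρ ^ 2)) :
    3 ≤ {d : N.Star v | IsDelaunay (1 / (2 * ρ ^ 2)) (edgeVec d) (edgeVec (σ d))
      (edgeVec (σ.symm d))}.ncard := by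
  have hcard : Nat.card (N.Star v) = 4 := hv
  have hfin : Finite (N.Star v) := Nat.finite_of_card_ne_zero (by omega)
  have := Fintype.ofFinite (N.Star v)
  have hne : Nonempty (N.Star v) := Nat.card_pos_iff.1 (by omega) |>.1
  have hρ1 : (1 : ℝ) ≤ ρ ^ 2 := one_le_pow₀ hρ.1.1
  have hKε' : K * ε ≤ 1 / 16 := hKε.trans (by gcongr; linarith)
  obtain ⟨n, hn, hpos⟩ := exists_normal_pos hσ ho
  have hn1 : ‖n‖ = 1 := by
    rcases hn with rfl | rfl
    · exact S.norm_normal _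
    · rw [norm_neg]; exact S.norm_normal _
  have hη : ∀ d : N.Star v,
      |⟪n, edgeVec d⟫| ≤ 3 / 2 * (1 / (16 * ρ ^ 2)) * ‖edgeVec d‖ := by
    intro d
    have h1 := abs_inner_normal_edgeVec_le hK hε hKε' d
    have h2 : |⟪n, edgeVec d⟫| = |⟪S.normal (N.point v), edgeVec d⟫| := by
      rcases hn with rfl | rfl
      · rfl
      · rw [inner_neg_left, abs_neg]
    rw [h2]
    refine h1.trans ?_
    gcongr
  set D := {d : N.Star v | IsDelaunay (1 / (2 * ρ ^ 2)) (edgeVec d) (edgeVec (σ d))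
      (edgeVec (σ.symm d))} with hD
  have hsub : Dᶜ.ncard ≤ 1 := by
    rw [Set.ncard_le_one]
    intro d hd d' hd'
    by_contra hdd
    rcases isDelaunay_or_isDelaunay σ (by rw [← Nat.card_eq_fintype_card, hcard]) edgeVec hn1 hpos
      (shapeRegular hσ hε hρ) hη hdd with h | h
    · exact hd h
    · exact hd' h
  have := Set.ncard_add_ncard_compl D
  omega

end Star

end DiscreteNet

/-! ### Assembly of the three claims. -/

theorem mainTheorem3 (ρ : ℝ) :
    ∃ C : ℝ, 0 < C ∧
      ∀ (M : Type u) [TopologicalSpace M] [T2Space M] [CompactSpace M]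
        [ChartedSpace Plane M] [IsManifold (𝓡 2) ∞ M]
        [Topology.CWComplex (univ : Set M)]
        (S : ImmersedSurface M) (N : DiscreteNet S), N.IsCurvatureLineNet →
      ∀ (v : N.Vertex) (σ : Equiv.Perm (N.Star v)), DiscreteNet.IsCyclicOrder σ →
        (N.valence v = 4 → DiscreteNet.IsOriented σ) →
      ∀ K ε : ℝ, S.IsCurvatureBound K → N.IsMaxLength v ε → N.IsShapeRegularity v ε ρ →
        ε ≤ 1 / (16 * K * ρ ^ 2) →
        (∀ d : N.Star v, DiscreteNet.IsAreaMaximizing σ d →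
          1 / C * ε ^ 2 ≤ DiscreteNet.area σ d ∧ DiscreteNet.area σ d ≤ C * ε ^ 2) ∧
        (¬ S.IsUmbilic (N.point v) → ∀ w : Space, S.IsPrincipal (N.point v) w →
          ∃ d : N.Star v, DiscreteNet.Associated d w ∧ 0 < DiscreteNet.area σ d) ∧
        (N.valence v = 4 →
          3 ≤ {d : N.Star v | IsDelaunay (1 / (2 * ρ ^ 2)) (DiscreteNet.edgeVec d)
            (DiscreteNet.edgeVec (σ d)) (DiscreteNet.edgeVec (σ.symm d))}.ncard) := by
  -- Dominates the constants 16ρ⁴ of the lower and ρ² of the upper bound; the summand 1 makes it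
  -- positive for every real ρ.
  refine ⟨16 * ρ ^ 4 + ρ ^ 2 + 1, by positivity, ?_⟩
  intro M _ _ _ _ _ _ S N hN v σ hσ ho K ε hK hε hρ hsample
  have hε0 := hε.pos
  have hρ1 := hρ.1.1
  have hρ0 : 0 < ρ := zero_lt_one.trans_le hρ1
  -- For K = 0 the right side of the sampling condition is 1/0 = 0, which contradicts ε > 0.
  have hK0 : 0 < K := by
    refine hK.nonneg.lt_of_ne fun h => ?_
    rw [← h] at hsample
    simp at hsample
    linarith
  have hKε : K * ε ≤ 1 / (16 * ρ ^ 2) := by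
    rw [le_div_iff₀ (by positivity)] at hsample ⊢
    linarith
  have hr := DiscreteNet.shapeRegular hσ hε hρ
  have hr' := DiscreteNet.shapeRegular_symm hσ hε hρ
  have hlow : ∀ a : ℝ, ε ^ 2 / (16 * ρ ^ 4) ≤ a →
      1 / (16 * ρ ^ 4 + ρ ^ 2 + 1) * ε ^ 2 ≤ a := by
    intro a ha
    refine le_trans ?_ ha
    rw [one_div_mul_eq_div]
    gcongr
    nlinarith
  have hdel := fun hv => DiscreteNet.three_le_ncard_isDelaunay hv hσ (ho hv) hK hε hρ hKε
  -- Gives the positivity in the second claim and, applied to the direction of a maximizing edge,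
  -- the lower bound in the first.
  have hex : ¬ S.IsUmbilic (N.point v) → ∀ w : Space, S.IsPrincipal (N.point v) w →
      ∃ d : N.Star v, DiscreteNet.Associated d w ∧
        ε ^ 2 / (16 * ρ ^ 4) ≤ DiscreteNet.area σ d := by
    intro humb w hw
    obtain ⟨d, hd, hdw⟩ := DiscreteNet.exists_mem_associated hN humb hw
      (hdel (hN.valence_eq v humb))
    exact ⟨d, hdw, (hr d).le_area_of_isDelaunay (hr' d) hd⟩
  refine ⟨fun d hd => ⟨hlow _ ?_, ?_⟩, fun humb w hw => ?_, hdel⟩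
  · by_cases humb : S.IsUmbilic (N.point v)
    · have := hN.finite_star v
      have : Nonempty (N.Star v) := ⟨d⟩
      obtain ⟨d₀, h₀⟩ := Finite.exists_min fun d : N.Star v => ‖DiscreteNet.edgeVec d‖
      exact ((hr d₀).le_area_of_shortest (hr' d₀) (h₀ _) (h₀ _)).trans (hd.1 humb d₀)
    · obtain ⟨d', hd', ha⟩ := hex humb _ (DiscreteNet.isPrincipal_velocity hN d)
      exact ha.trans (hd.2 humb d' hd')
  · refine ((hr d).area_le (hr' d)).trans ?_
    gcongr
    nlinarith [pow_pos hρ0 4]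
  · obtain ⟨d, hd, ha⟩ := hex humb w hw
    exact ⟨d, hd, lt_of_lt_of_le (by positivity) ha⟩
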